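/- **Model.** A seller has inventory $x>0$ of a single product and a season $[0,T]$, $T>0$. Feasible prices are $[\underline p,\overline p]\cup\{p_\infty\}$ with $0\le\underline p<\overline p$, where $p_\infty$ is a cut-off price. A demand function $\lambda$ satisfies $\lambda(p_\infty)=0$, is nonnegative and strictly decreasing on $[\underline p,\overline p]$ with inverse $\gamma$, and $r(l)=l\gamma(l)$ is concave on the range of $\lambda$. In the problem of size $n$ the inventory is $nx$ and the demand function is $n\lambda$. A policy $\pi$ sets at each time $t$ a feasible price $p(t)$ that depends only on the demand before $t$ (not on $\lambda$); the cumulative demand is $D(t)=N\big(\int_0^t n\lambda(p(s))\,ds\big)$ with $N$ a unit-rate Poisson process. The policy is admissible if $D$ exists and is unique on $[0,T]$, $D(T)\le nx$ almost surely, and the revenue $\int_0^T p\,dD$ is integrable. Put $J_n^\pi=E\int_0^Tp(s)\,dD(s)$, let $J_n^D$ be the supremum of $\int_0^T p(s)\,n\lambda(p(s))\,ds$ over measurable feasible price paths with $\int_0^T n\lambda(p(s))\,ds\le nx$, and let $R_n^\pi(x,T;\lambda)=1-J_n^\pi/J_n^D$. **Assumption A** (constants $M,K,m_L,m_U>0$):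 $|\lambda|\le M$ on $[\underline p,\overline p]$; $\lambda(p)$ and $r(\lambda(p))$ are $K$-Lipschitz in $p\in[\underline p,\overline p]$, and $\gamma$ is $K$-Lipschitz on the range of $\lambda$; $r$ is twice differentiable there with $-m_L\le r''\le-m_U$. **Assumption B** (constant $\varepsilon>0$): $p^D=\max\{p^u,p^c\}\in[\underline p+\varepsilon,\overline p-\varepsilon]$, where $p^u$ maximizes $r(\lambda(p))$ and $p^c$ minimizes $|\lambda(p)-x/T|$ over $[\underline p,\overline p]$. **Algorithm DPA with exponent $d<1/2$** (size $n\ge2$; $L=\log n$). In Step 2, period $i=1,2,\dots$ has length $\tau_i^u=T\,n^{1-2d-(1-d)(3/5)^{i-1}}L^5$ and grid size $\kappa_i^u=\lceil n^{\frac15(3/5)^{i-1}(1-d)}L\rceil$. In Step 3, $\tau_i^c=T\,n^{1-2d-(1-d)(2/3)^{i-1}}L^3$ and $\kappa_i^c=\lceil n^{\frac13(2/3)^{i-1}(1-d)}L\rceil$. The number $N^u$ of periods of Step 2 is the least $l\ge1$ with $n^{2d-1+(1-d)(3/5)^l}<L^5$, and the number $N^c$ for Step 3 is the least $l\ge1$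 with $n^{2d-1+(1-d)(2/3)^l}<L^3$ (taken to be $1$ if there is no such $l$, which can happen only for $n=2$). A period on a price interval $[a,b]$ with grid size $\kappa$ applies the left endpoints $p_j$ of the $\kappa$ equal parts of $[a,b]$ one after the other, each for a fraction $1/\kappa$ of the period, and observes the demand rates $\hat d(p_j)$. The mesh is $g=(b-a)/\kappa$, $\hat p^u=\arg\max_j p_j\hat d(p_j)$, and $\hat p^c=\arg\min_j|\hat d(p_j)-nx/T|$ (least index in case of ties). *Step 2.* Begin with $[\underline p,\overline p]$. At the end of a period, if $\hat p^c>\hat p^u+2\sqrt L\,g$, go to Step 3. Otherwise put $\hat p=\max\{\hat p^c,\hat p^u\}$ and continue with $[\hat p-\frac L3g,\hat p+\frac{2L}3g]\cap[\underline p,\overline p]$. If all $N^u$ periods end without a transition, use $\min\{\overline p,\hat p+2\sqrt L\,g\}$ (last period's values) for the rest of the season. *Step 3.* Begin again with $[\underline p,\overline p]$. After each period continue with $[\hat p^c-\frac L2g,\hat p^c+\frac L2g]\cap[\underline p,\overline p]$. After $N^c$ periods use the last $\hat p^c$ for the rest of the season. Throughout, $p_\infty$ is used as soon as no whole unit of inventory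 is left, and the procedure is cut off at time $T$. **Corollary 1.** For every $\delta<1/2$ there is an exponent $d\in[\delta,1/2)$ such that the policy $\pi_\delta$ generated by Algorithm DPA with exponent $d$ has the following property. For all positive $M,K,m_L,m_U,\varepsilon,x,T$ there is a constant $C>0$ such that, for every parameterized family $\Gamma=\{\lambda(\cdot\,;z):z\in Z\}$ of demand functions all of which satisfy Assumptions A and B with these constants, and for every $n\ge2$, the policy $\pi_\delta$ is admissible in the problem of size $n$ for every $\lambda\in\Gamma$ and $$\sup_{\lambda\in\Gamma}R_n^{\pi_\delta}(x,T;\lambda)\le\frac{C(\log n)^{3.5}}{n^\delta}.$$ -/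

import Mathlib

open MeasureTheory ProbabilityTheory Set
open scoped NNReal

namespace DynamicPricing

noncomputable section

/-- The data of a single-product pricing problem that are known to the seller: the interval
`[lo, hi]` of regular prices, the cut-off price `cut` (at which there is no demand), the initial
inventory and the length of the selling season. -/
structure Market where
  lo : ℝ
  hi : ℝ
  cut : ℝ
  inventory : ℝ
  horizon : ℝ

/-- The problem of size `n`: the inventory is multiplied by `n`. -/
def Market.scale (m : Market) (n : ℕ) : Market :=
  { m with inventory := n * m.inventory }

/-- The demand function of the problem of size `n`. -/
def scaleDemand (n : ℕ) (lam : ℝ → ℝ) : ℝ → ℝ := fun p => n * lam p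

/-- The feasible prices `[lo, hi] ∪ {cut}`. -/
def Market.feasible (m : Market) : Set ℝ := Icc m.lo m.hi ∪ {m.cut}

/-! ### Demand functions -/

/-- The range of the demand rate over the regular prices. -/
def demandRange (m : Market) (lam : ℝ → ℝ) : Set ℝ := lam '' Icc m.lo m.hi

/-- The inverse demand function `γ`. -/
def inverseDemand (m : Market) (lam : ℝ → ℝ) : ℝ → ℝ := Function.invFunOn lam (Icc m.lo m.hi)

/-- The revenue rate `r(l) = l γ(l)` as a function of the demand rate `l`. -/
def revenueRate (m : Market) (lam : ℝ → ℝ) (l : ℝ) : ℝ := l * inverseDemand m lam l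

/-- Regular demand functions: nonnegative, zero at the cut-off price, decreasing and invertible on
`[lo, hi]`, with a concave revenue rate. -/
structure IsRegularDemand (m : Market) (lam : ℝ → ℝ) : Prop where
  cutoff : lam m.cut = 0
  nonneg : ∀ p ∈ Icc m.lo m.hi, 0 ≤ lam p
  strictAnti : StrictAntiOn lam (Icc m.lo m.hi)
  concave : ConcaveOn ℝ (demandRange m lam) (revenueRate m lam)

/-- The class `Γ(M, K, mL, mU)`: regular demand functions that are bounded by `M`, for which the
demand rate and the revenue rate (as functions of the price) and the inverse demand function are
`K`-Lipschitz, and whose revenue rate is twice differentiable in the demand rate with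
`-mL ≤ r'' ≤ -mU` (derivatives are one-sided at the ends of the range). -/
structure AssumptionA (m : Market) (M K mL mU : ℝ) (lam : ℝ → ℝ) : Prop where
  regular : IsRegularDemand m lam
  bounded : ∀ p ∈ Icc m.lo m.hi, |lam p| ≤ M
  lipschitz_demand : ∀ p ∈ Icc m.lo m.hi, ∀ q ∈ Icc m.lo m.hi, |lam p - lam q| ≤ K * |p - q|
  lipschitz_revenue : ∀ p ∈ Icc m.lo m.hi, ∀ q ∈ Icc m.lo m.hi,
    |revenueRate m lam (lam p) - revenueRate m lam (lam q)| ≤ K * |p - q|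
  lipschitz_inverse : ∀ l ∈ demandRange m lam, ∀ l' ∈ demandRange m lam,
    |inverseDemand m lam l - inverseDemand m lam l'| ≤ K * |l - l'|
  differentiable : DifferentiableOn ℝ (revenueRate m lam) (demandRange m lam)
  differentiable_deriv :
    DifferentiableOn ℝ (derivWithin (revenueRate m lam) (demandRange m lam)) (demandRange m lam)
  second_deriv : ∀ l ∈ demandRange m lam,
    -mL ≤ derivWithin (derivWithin (revenueRate m lam) (demandRange m lam)) (demandRange m lam) l ∧
    derivWithin (derivWithin (revenueRate m lam) (demandRange m lam)) (demandRange m lam) l ≤ -mU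

/-- `p` is an unconstrained optimal price `p^u`. -/
def IsUnconstrainedPrice (m : Market) (lam : ℝ → ℝ) (p : ℝ) : Prop :=
  p ∈ Icc m.lo m.hi ∧ IsMaxOn (fun q => revenueRate m lam (lam q)) (Icc m.lo m.hi) p

/-- `p` is a constrained price `p^c`, at which the demand rate is nearest to
`inventory / horizon`. -/
def IsConstrainedPrice (m : Market) (lam : ℝ → ℝ) (p : ℝ) : Prop :=
  p ∈ Icc m.lo m.hi ∧ IsMinOn (fun q => |lam q - m.inventory / m.horizon|) (Icc m.lo m.hi) p

/-- The price `p^D = max {p^u, p^c}` lies in `[lo + ε, hi - ε]`. -/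
def AssumptionB (m : Market) (ε : ℝ) (lam : ℝ → ℝ) : Prop :=
  ∃ pu pc, IsUnconstrainedPrice m lam pu ∧ IsConstrainedPrice m lam pc ∧
    max pu pc ∈ Icc (m.lo + ε) (m.hi - ε)

/-- The deterministic value `J^D`: the supremum of the revenue `∫₀ᵀ r(λ(p(s))) ds` over measurable
feasible price paths with `∫₀ᵀ λ(p(s)) ds ≤ inventory`. The revenue rate at price `p` is written
`p * λ(p)`, which is `r(λ(p))` on `[lo, hi]` and `0` at the cut-off price. -/
def deterministicValue (m : Market) (lam : ℝ → ℝ) : ℝ :=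
  sSup {v : ℝ | ∃ p : ℝ → ℝ, Measurable p ∧ (∀ s ∈ Icc 0 m.horizon, p s ∈ m.feasible) ∧
    ∫ s in (0 : ℝ)..m.horizon, lam (p s) ≤ m.inventory ∧
    v = ∫ s in (0 : ℝ)..m.horizon, p s * lam (p s)}

/-! ### The stochastic model -/

/-- A unit-rate Poisson process: a counting process with right-continuous nondecreasing paths from
`0`, with independent increments, the increment over `(s, t]` being Poisson of mean `t - s`. -/
structure IsUnitPoissonProcess {Ω : Type*} [MeasurableSpace Ω] (N : ℝ≥0 → Ω → ℕ)
    (P : Measure Ω) : Prop where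
  measurable : ∀ t, Measurable (N t)
  zero : ∀ ω, N 0 ω = 0
  monotone : ∀ ω, Monotone fun t => N t ω
  right_continuous : ∀ ω t, ContinuousWithinAt (fun s => N s ω) (Ici t) t
  poisson : ∀ s t, s ≤ t → HasLaw (fun ω => N t ω - N s ω) (poissonMeasure (t - s)) P
  indep : HasIndepIncrements N P

/-- A pricing policy: the price at time `t`, given the path of the cumulative demand. (The earlier
prices are themselves determined by the earlier demand.) -/
abbrev Policy := (ℝ → ℕ) → ℝ → ℝ

/-- The price at time `t` depends only on the demand before time `t`. -/
def NonAnticipating (π : Policy) : Prop :=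
  ∀ (D D' : ℝ → ℕ) (t : ℝ), (∀ s ∈ Ico 0 t, D s = D' s) → π D t = π D' t

/-- `D` is the cumulative demand up to time `t` when `π` is used and the demand function is `lam`:
`D(t) = N(∫₀ᵗ λ(p(s)) ds)` for `0 ≤ t ≤ T`, where `p(s)` is the price that `π` sets at time `s`
when it observes `D`. -/
def IsDemandProcess {Ω : Type*} (π : Policy) (lam : ℝ → ℝ) (T : ℝ) (N : ℝ≥0 → Ω → ℕ)
    (D : ℝ → Ω → ℕ) : Prop :=
  ∀ ω, IntervalIntegrable (fun s => lam (π (fun u => D u ω) s)) volume 0 T ∧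
    ∀ t ∈ Icc 0 T,
      D t ω = N (Real.toNNReal (∫ s in (0 : ℝ)..t, lam (π (fun u => D u ω) s))) ω

/-- The demand process (it exists and is unique on `[0, T]` for admissible policies). -/
def demandProcess {Ω : Type*} (π : Policy) (lam : ℝ → ℝ) (T : ℝ) (N : ℝ≥0 → Ω → ℕ) :
    ℝ → Ω → ℕ :=
  Classical.epsilon (IsDemandProcess π lam T N)

/-- The time at which unit number `k + 1` is demanded. -/
def saleTime (D : ℝ → ℕ) (k : ℕ) : ℝ := sInf {t : ℝ | 0 ≤ t ∧ k + 1 ≤ D t}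

/-- The realized revenue `∫₀ᵀ p(s) dD(s)`, that is, the sum over the units demanded up to time `T`
of the prices in force when they are demanded. -/
def revenue (π : Policy) (T : ℝ) (D : ℝ → ℕ) : ℝ :=
  ∑ k ∈ Finset.range (D T), π D (saleTime D k)

/-- The expected revenue `J^π`. -/
def expectedRevenue {Ω : Type*} [MeasurableSpace Ω] (m : Market) (π : Policy) (lam : ℝ → ℝ)
    (N : ℝ≥0 → Ω → ℕ) (P : Measure Ω) : ℝ :=
  ∫ ω, revenue π m.horizon (fun t => demandProcess π lam m.horizon N t ω) ∂P

/-- `π` is an admissible policy when the demand function is `lam`: it is non-anticipating, its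
prices are feasible, the demand process under `π` is well defined, the inventory constraint holds,
and the revenue has an expectation. -/
structure IsAdmissible {Ω : Type*} [MeasurableSpace Ω] (m : Market) (π : Policy) (lam : ℝ → ℝ)
    (N : ℝ≥0 → Ω → ℕ) (P : Measure Ω) : Prop where
  nonAnticipating : NonAnticipating π
  feasible : ∀ D, ∀ t ∈ Icc 0 m.horizon, π D t ∈ m.feasible
  exists_demand : ∃ D, IsDemandProcess π lam m.horizon N D
  unique_demand : ∀ D D', IsDemandProcess π lam m.horizon N D →
    IsDemandProcess π lam m.horizon N D' → ∀ t ∈ Icc 0 m.horizon, D t = D' t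
  inventory : ∀ᵐ ω ∂P, (demandProcess π lam m.horizon N m.horizon ω : ℝ) ≤ m.inventory
  integrable : Integrable
    (fun ω => revenue π m.horizon (fun t => demandProcess π lam m.horizon N t ω)) P

/-- The regret `R^π = 1 - J^π / J^D`. -/
def regret {Ω : Type*} [MeasurableSpace Ω] (m : Market) (π : Policy) (lam : ℝ → ℝ)
    (N : ℝ≥0 → Ω → ℕ) (P : Measure Ω) : ℝ :=
  1 - expectedRevenue m π lam N P / deterministicValue m lam

/-- The regret `R_n^π` of a policy in the problem of size `n`. -/
def regretOfSize {Ω : Type*} [MeasurableSpace Ω] (n : ℕ) (m : Market) (π : Policy) (lam : ℝ → ℝ)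
    (N : ℝ≥0 → Ω → ℕ) (P : Measure Ω) : ℝ :=
  regret (m.scale n) π (scaleDemand n lam) N P

/-! ### Algorithm DPA

Learning periods and grid points are numbered from `0`: period `k` below is period `i = k + 1` in
formulas numbered from `1`. The market `m` is the one in which the algorithm runs, so that
`m.inventory` is `n x` for the problem of size `n`. The parameter `d` is the exponent in the
lengths of the learning periods. -/

/-- The grid size `n^((1/5)(3/5)^(i-1)(1-d)) log n` of period `i = k + 1` of Step 2, before
rounding. -/
def kappaU (n : ℕ) (d : ℝ) (k : ℕ) : ℝ :=
  (n : ℝ) ^ ((1 / 5 : ℝ) * (3 / 5 : ℝ) ^ k * (1 - d)) * Real.log n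

/-- The grid size of period `i = k + 1` of Step 3, before rounding. -/
def kappaC (n : ℕ) (d : ℝ) (k : ℕ) : ℝ :=
  (n : ℝ) ^ ((1 / 3 : ℝ) * (2 / 3 : ℝ) ^ k * (1 - d)) * Real.log n

/-- The length of period `i = k + 1` of Step 2, as a fraction of the season. -/
def tauU (n : ℕ) (d : ℝ) (k : ℕ) : ℝ :=
  (n : ℝ) ^ (1 - 2 * d - (1 - d) * (3 / 5 : ℝ) ^ k) * Real.log n ^ 5

/-- The length of period `i = k + 1` of Step 3, as a fraction of the season. -/
def tauC (n : ℕ) (d : ℝ) (k : ℕ) : ℝ :=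
  (n : ℝ) ^ (1 - 2 * d - (1 - d) * (2 / 3 : ℝ) ^ k) * Real.log n ^ 3

/-- The nominal length of the price interval of period `i = k + 1` of Step 2, as a fraction of
`hi - lo`. -/
def widthU (n : ℕ) (d : ℝ) (k : ℕ) : ℝ :=
  (n : ℝ) ^ (-(1 / 2 : ℝ) * (1 - d) * (1 - (3 / 5 : ℝ) ^ k))

/-- The nominal length of the price interval of period `i = k + 1` of Step 3, as a fraction of
`hi - lo`. -/
def widthC (n : ℕ) (d : ℝ) (k : ℕ) : ℝ :=
  (n : ℝ) ^ (-(1 - d) * (1 - (2 / 3 : ℝ) ^ k))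

/-- The number `N^u` of periods of Step 2: the least `l ≥ 1` such that, in period `l`,
`(width / κ)² (log n)^(1/2) < n^(-d) (log n)^3.5`. (If `d < 1/2`, such an `l` exists for every
`n ≥ 3`; where there is none, the number is set to `1`.) -/
def periodsU (n : ℕ) (d : ℝ) : ℕ :=
  max 1 (sInf {l : ℕ | 1 ≤ l ∧ (widthU n d (l - 1) / kappaU n d (l - 1)) ^ 2 *
    √(Real.log n) < (n : ℝ) ^ (-d) * Real.log n ^ (7 / 2 : ℝ)})

/-- The number `N^c` of periods of Step 3: the least `l ≥ 1` such that, in period `l`,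
`(width / κ) (log n)^(1/2) < n^(-d) (log n)^2.5` (same convention). -/
def periodsC (n : ℕ) (d : ℝ) : ℕ :=
  max 1 (sInf {l : ℕ | 1 ≤ l ∧ (widthC n d (l - 1) / kappaC n d (l - 1)) *
    √(Real.log n) < (n : ℝ) ^ (-d) * Real.log n ^ (5 / 2 : ℝ)})

/-- The demand strictly before time `t`. -/
def demandBefore (D : ℝ → ℕ) (t : ℝ) : ℕ := sSup (D '' Ico 0 t)

/-- The least index `j < k` at which `f` is minimal among `f 0, …, f (k - 1)`. -/
def argminIndex (f : ℕ → ℝ) (k : ℕ) : ℕ := sInf {j : ℕ | j < k ∧ ∀ i < k, f j ≤ f i}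

/-- A learning period: it starts at time `start` and has length `length`; the price interval
`[a, b]` is divided into `grid` equal parts, and so is the time. -/
structure Period where
  start : ℝ
  length : ℝ
  a : ℝ
  b : ℝ
  grid : ℕ

namespace Period

/-- The distance of neighbouring grid prices. -/
def mesh (q : Period) : ℝ := (q.b - q.a) / q.grid

/-- The time for which each grid price is applied. -/
def step (q : Period) : ℝ := q.length / q.grid

/-- The grid prices: left endpoints of the parts of `[a, b]`. -/
def price (q : Period) (j : ℕ) : ℝ := q.a + j * q.mesh

/-- The time from which grid price `j` is applied. -/
def time (q : Period) (j : ℕ) : ℝ := q.start + j * q.step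

/-- The price that is applied at time `t` of the period. -/
def priceAt (q : Period) (t : ℝ) : ℝ := q.price (sInf {j : ℕ | t < q.time (j + 1)})

/-- The observed demand rate at grid price `j`. -/
def rate (q : Period) (D : ℝ → ℕ) (j : ℕ) : ℝ :=
  ((demandBefore D (q.time (j + 1)) : ℝ) - demandBefore D (q.time j)) / q.step

/-- The empirical unconstrained optimal price. -/
def hatU (q : Period) (D : ℝ → ℕ) : ℝ :=
  q.price (argminIndex (fun j => -(q.price j * q.rate D j)) q.grid)

/-- The empirical constrained optimal price, for the target rate `c`. -/
def hatC (q : Period) (c : ℝ) (D : ℝ → ℕ) : ℝ :=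
  q.price (argminIndex (fun j => |q.rate D j - c|) q.grid)

end Period

/-- The start of period `k` of Step 2 (and the end of the period before it). -/
def startU (m : Market) (n : ℕ) (d : ℝ) (k : ℕ) : ℝ :=
  ∑ i ∈ Finset.range k, m.horizon * tauU n d i

/-- The start of period `k` of Step 3, counted from the beginning of Step 3. -/
def startC (m : Market) (n : ℕ) (d : ℝ) (k : ℕ) : ℝ :=
  ∑ i ∈ Finset.range k, m.horizon * tauC n d i

/-- The learning periods of Step 2, as long as that step goes on. -/
def periodU (m : Market) (n : ℕ) (d : ℝ) (D : ℝ → ℕ) : ℕ → Period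
  | 0 => ⟨startU m n d 0, m.horizon * tauU n d 0, m.lo, m.hi, ⌈kappaU n d 0⌉₊⟩
  | k + 1 =>
    let q := periodU m n d D k
    let p := max (q.hatC (m.inventory / m.horizon) D) (q.hatU D)
    ⟨startU m n d (k + 1), m.horizon * tauU n d (k + 1),
      max m.lo (p - Real.log n / 3 * q.mesh), min m.hi (p + 2 * Real.log n / 3 * q.mesh),
      ⌈kappaU n d (k + 1)⌉₊⟩

/-- The condition, at the end of period `k` of Step 2, for a transition to Step 3. -/
def transition (m : Market) (n : ℕ) (d : ℝ) (D : ℝ → ℕ) (k : ℕ) : Prop :=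
  (periodU m n d D k).hatC (m.inventory / m.horizon) D >
    (periodU m n d D k).hatU D + 2 * √(Real.log n) * (periodU m n d D k).mesh

/-- The period of Step 2 at whose end Step 3 is entered, if it is entered. -/
def transitionIndex (m : Market) (n : ℕ) (d : ℝ) (D : ℝ → ℕ) : ℕ :=
  sInf {k : ℕ | k < periodsU n d ∧ transition m n d D k}

/-- The learning periods of Step 3, if it begins at time `s`. -/
def periodC (m : Market) (n : ℕ) (d : ℝ) (s : ℝ) (D : ℝ → ℕ) : ℕ → Period
  | 0 => ⟨s + startC m n d 0, m.horizon * tauC n d 0, m.lo, m.hi, ⌈kappaC n d 0⌉₊⟩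
  | k + 1 =>
    let q := periodC m n d s D k
    let p := q.hatC (m.inventory / m.horizon) D
    ⟨s + startC m n d (k + 1), m.horizon * tauC n d (k + 1),
      max m.lo (p - Real.log n / 2 * q.mesh), min m.hi (p + Real.log n / 2 * q.mesh),
      ⌈kappaC n d (k + 1)⌉₊⟩

/-- The price of Step 4(a), truncated at `hi`. -/
def finalPriceU (m : Market) (n : ℕ) (d : ℝ) (D : ℝ → ℕ) : ℝ :=
  let q := periodU m n d D (periodsU n d - 1)
  min m.hi (max (q.hatC (m.inventory / m.horizon) D) (q.hatU D) + 2 * √(Real.log n) * q.mesh)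

/-- The price of Step 4(b). -/
def finalPriceC (m : Market) (n : ℕ) (d : ℝ) (s : ℝ) (D : ℝ → ℕ) : ℝ :=
  (periodC m n d s D (periodsC n d - 1)).hatC (m.inventory / m.horizon) D

/-- The price at time `t` in Step 3, begun at time `s`, and in Step 4(b) after it. -/
def priceC (m : Market) (n : ℕ) (d : ℝ) (s : ℝ) (D : ℝ → ℕ) (t : ℝ) : ℝ :=
  if t < s + startC m n d (periodsC n d) then
    (periodC m n d s D (sInf {k : ℕ | t < s + startC m n d (k + 1)})).priceAt t
  else finalPriceC m n d s D

/-- The price at time `t` in Step 2, and in Step 4(a) after it. -/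
def priceU (m : Market) (n : ℕ) (d : ℝ) (D : ℝ → ℕ) (t : ℝ) : ℝ :=
  if t < startU m n d (periodsU n d) then
    (periodU m n d D (sInf {k : ℕ | t < startU m n d (k + 1)})).priceAt t
  else finalPriceU m n d D

open Classical in
/-- Algorithm DPA: the cut-off price as soon as no whole unit is left; otherwise, Step 3 (and
Step 4(b)) if the transition condition has held at the end of a period of Step 2 that is over at
time `t`; otherwise, Step 2 (and Step 4(a)). -/
def dpa (m : Market) (n : ℕ) (d : ℝ) : Policy := fun D t =>
  if m.inventory < demandBefore D t + 1 then m.cut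
  else if ∃ k < periodsU n d, startU m n d (k + 1) ≤ t ∧ transition m n d D k then
    priceC m n d (startU m n d (transitionIndex m n d D + 1)) D t
  else priceU m n d D t

end

end DynamicPricing

namespace DynamicPricing

/-! ### Demand paths, sale times -/

/-! The prices of the algorithm change only at finitely many fixed times and depend only on the
demand before these times (`isStepwise_uncensoredDpa`). Such a policy has an intensity that can be
built interval by interval. Running out of stock merely stops this intensity at a random level, and
since the jumps of a Poisson process almost surely have size one, the stopped path sells exactly
`min (demand) ⌊n x⌋` units. This gives admissibility and identifies the revenue with that of the
uncensored path, taken over the units in stock (`censor_isAdmissible`).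

By Lagrange duality the deterministic value is `n T V`, where `V` is the revenue rate at `p^D`
(`deterministicValue_scale`). It therefore suffices that, outside an event of small probability, the
uncensored path earns at least `n T V - O(n * order)` and has intensity at most `n x + O(n *
order)`, with `order = n^(-d) L^5`: demand beyond the stock costs at most `R` per unit
(`Tuned.revenue_ge`). Both bounds are recorded in `Window`, which adds up over consecutive stretches
of time.

Chernoff bounds (`poisson_tail`, `increment_bound`) control all increments of the Poisson process at
once; on the resulting event the analysis is deterministic. The parameters are balanced as follows.
In Step 2 the observed rates have an error of order `√L * mesh²`. Revenue is quadratic near its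
maximum, so for large `n` the empirical prices are within `√L * mesh / 4` of the true ones, and an
interval of `L` meshes catches the optimum. Prices in an interval of width `w` lose `O(w²)`, and
length times `w²` is `order` in every period. In Step 3 the error is of order `√L * mesh`, the loss
is linear in `w`, and length times `w` is at most `order`.

The delicate point is the demand in Step 2: revenue is flat near `p^u`, but the demand rate has a
first-order term, which could exhaust the stock too early. The intervals of Step 2 are placed
asymmetrically, so that the mean grid price is at least `p^D`; the first-order terms then sum to
something nonpositive, and only a quadratic excess remains (`Tuned.locatedU_succ`). If `p^c` is
markedly above `p^u`, the transition condition leads to Step 3; if it is not, then `p^D` is close to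
`p^u` and the revenue loss is quadratic.

For `0 < d < 1/2` the number of periods is bounded uniformly in `n`, and all of them fit into the
season when `n` is large (`exists_tuned`). Choosing `d` strictly above `δ` lets a power of `n`
absorb the surplus logarithms. The finitely many small sizes are covered by the trivial bound 1 for
the regret. -/

lemma demandBefore_congr {D D' : ℝ → ℕ} {t : ℝ} (h : ∀ s ∈ Ico 0 t, D s = D' s) :
    demandBefore D t = demandBefore D' t := by
  unfold demandBefore
  rw [image_congr h]

lemma demandBefore_le {D : ℝ → ℕ} {t : ℝ} {c : ℕ} (h : ∀ s ∈ Ico 0 t, D s ≤ c) :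
    demandBefore D t ≤ c :=
  csSup_le' (by rintro _ ⟨s, hs, rfl⟩; exact h s hs)

lemma le_demandBefore {D : ℝ → ℕ} {s t : ℝ} (hD : MonotoneOn D (Icc 0 t)) (hs : s ∈ Ico 0 t) :
    D s ≤ demandBefore D t := by
  refine le_csSup ⟨D t, ?_⟩ (mem_image_of_mem _ hs)
  rintro _ ⟨r, hr, rfl⟩
  exact hD ⟨hr.1, hr.2.le⟩ ⟨hr.1.trans hr.2.le, le_rfl⟩ hr.2.le

lemma lt_demandBefore_iff {D : ℝ → ℕ} {t : ℝ} (hD : MonotoneOn D (Icc 0 t)) {c : ℕ} :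
    c < demandBefore D t ↔ ∃ s ∈ Ico 0 t, c < D s := by
  constructor
  · intro h
    by_contra! hcon
    exact absurd (demandBefore_le hcon) (by omega)
  · rintro ⟨s, hs, h⟩
    exact h.trans_le (le_demandBefore hD hs)

/-- The demand before a positive time is attained shortly before it. -/
lemma exists_demandBefore_eq {D : ℝ → ℕ} {t : ℝ} (hD : MonotoneOn D (Icc 0 t)) (ht : 0 < t) :
    ∃ s ∈ Ico 0 t, ∀ u ∈ Ico s t, D u = demandBefore D t := by
  have hne : (D '' Ico 0 t).Nonempty := ⟨D 0, 0, ⟨le_rfl, ht⟩, rfl⟩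
  have hb : BddAbove (D '' Ico 0 t) := by
    refine ⟨D t, ?_⟩
    rintro _ ⟨r, hr, rfl⟩
    exact hD ⟨hr.1, hr.2.le⟩ ⟨hr.1.trans hr.2.le, le_rfl⟩ hr.2.le
  obtain ⟨s, hs, hse⟩ := Nat.sSup_mem hne hb
  refine ⟨s, hs, fun u hu => le_antisymm (le_demandBefore hD ⟨hs.1.trans hu.1, hu.2⟩) ?_⟩
  calc demandBefore D t = D s := hse.symm
    _ ≤ D u := hD ⟨hs.1, hs.2.le⟩ ⟨hs.1.trans hu.1, hu.2.le⟩ hu.1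

lemma demandBefore_zero (D : ℝ → ℕ) : demandBefore D 0 = 0 := by
  simp [demandBefore]

lemma demandBefore_mono {D : ℝ → ℕ} {s t : ℝ} (hD : MonotoneOn D (Icc 0 t)) (hst : s ≤ t) :
    demandBefore D s ≤ demandBefore D t :=
  demandBefore_le fun _ hu => le_demandBefore hD ⟨hu.1, hu.2.trans_le hst⟩

lemma saleTime_nonneg (D : ℝ → ℕ) (k : ℕ) : 0 ≤ saleTime D k :=
  Real.sInf_nonneg fun _ h => h.1

lemma saleTime_le {D : ℝ → ℕ} {k : ℕ} {T : ℝ} (hT : 0 ≤ T) (hk : k < D T) :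
    saleTime D k ≤ T :=
  csInf_le ⟨0, fun _ h => h.1⟩ ⟨hT, hk⟩

/-- Translates sale times into the demand before fixed times, which is all that a stepwise policy
observes. -/
lemma saleTime_lt_iff {D : ℝ → ℕ} {k : ℕ} {T t : ℝ} (hT : 0 ≤ T) (hk : k < D T)
    (hD : MonotoneOn D (Icc 0 t)) : saleTime D k < t ↔ k < demandBefore D t := by
  have hb : BddBelow {t : ℝ | 0 ≤ t ∧ k + 1 ≤ D t} := ⟨0, fun _ h => h.1⟩
  rw [saleTime, csInf_lt_iff hb ⟨T, hT, hk⟩, lt_demandBefore_iff hD]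
  constructor
  · rintro ⟨s, ⟨h0, h1⟩, h2⟩
    exact ⟨s, ⟨h0, h2⟩, h1⟩
  · rintro ⟨s, ⟨h0, h1⟩, h2⟩
    exact ⟨s, ⟨h0, h2⟩, h1⟩

/-- The infimum defining the sale time is decided within `[0, T]`, because the unit is demanded
there on both paths; what the paths do after `T` is irrelevant. -/
lemma saleTime_congr {D D' : ℝ → ℕ} {k : ℕ} {T : ℝ} (hT : 0 ≤ T) (hk : k < D T)
    (h : ∀ t ∈ Icc 0 T, k < D t ↔ k < D' t) : saleTime D k = saleTime D' k := by
  have hk' : k < D' T := (h T ⟨hT, le_rfl⟩).1 hk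
  have hb : ∀ E : ℝ → ℕ, BddBelow {t : ℝ | 0 ≤ t ∧ k + 1 ≤ E t} := fun E => ⟨0, fun _ h => h.1⟩
  have key : ∀ E E' : ℝ → ℕ, k < E T → k < E' T → (∀ t ∈ Icc 0 T, k < E t → k < E' t) →
      saleTime E' k ≤ saleTime E k := by
    intro E E' hE hE' hEE
    refine le_csInf ⟨T, hT, hE⟩ ?_
    rintro t ⟨ht, htk⟩
    rcases le_or_gt t T with h1 | h1
    · exact csInf_le (hb _) ⟨ht, hEE t ⟨ht, h1⟩ htk⟩
    · exact (csInf_le (hb _) ⟨hT, hE'⟩).trans h1.le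
  exact le_antisymm (key _ _ hk' hk fun t ht => (h t ht).2) (key _ _ hk hk' fun t ht => (h t ht).1)

/-! ### Integrals of functions that are given on an open interval -/

/-- Prices may jump at the ends of an interval, so integrands are only known inside it; the
endpoints are null. -/
lemma intervalIntegral_congr_Ioo {f g : ℝ → ℝ} {a b : ℝ} (hab : a ≤ b)
    (h : ∀ s ∈ Ioo a b, f s = g s) (hg : IntervalIntegrable g volume a b) :
    IntervalIntegrable f volume a b ∧ ∫ s in a..b, f s = ∫ s in a..b, g s := by
  have hae : ∀ᵐ x ∂volume, x ∈ uIoc a b → g x = f x := by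
    have : ∀ᵐ x : ℝ ∂volume, x ≠ b := by
      simp [ae_iff, measure_singleton]
    filter_upwards [this] with x hx hxm
    rw [uIoc_of_le hab] at hxm
    exact (h x ⟨hxm.1, lt_of_le_of_ne hxm.2 hx⟩).symm
  refine ⟨hg.congr_ae ?_, (intervalIntegral.integral_congr_ae hae).symm⟩
  exact (ae_restrict_iff' measurableSet_uIoc).2 hae

lemma intervalIntegral_of_Ioo_const {f : ℝ → ℝ} {a b c : ℝ} (hab : a ≤ b)
    (h : ∀ s ∈ Ioo a b, f s = c) :
    IntervalIntegrable f volume a b ∧ ∫ s in a..b, f s = c * (b - a) := by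
  have := intervalIntegral_congr_Ioo hab h intervalIntegrable_const
  refine ⟨this.1, ?_⟩
  rw [this.2]
  simp [mul_comm]

/-! ### Stepwise policies -/

/-- The price can change only at finitely many given times, and it depends only on the demand
before these times. -/
structure IsStepwise (q : Policy) (B : Finset ℝ) : Prop where
  const : ∀ D t t', 0 ≤ t → t ≤ t' → (∀ b ∈ B, ¬(t < b ∧ b ≤ t')) → q D t = q D t'
  adapted : ∀ D D' t, (∀ b ∈ B, b ≤ t → demandBefore D b = demandBefore D' b) → q D t = q D' t

/-- The policy that follows `q` until no whole unit of the inventory is left. -/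
noncomputable def censor (I cut : ℝ) (q : Policy) : Policy := fun D t =>
  open Classical in if I < demandBefore D t + 1 then cut else q D t

/-- The demand path with counting path `ν` and cumulative intensity `G`. -/
noncomputable def demandPath (ν : ℝ≥0 → ℕ) (G : ℝ → ℝ) : ℝ → ℕ := fun t => ν (G t).toNNReal

lemma demandPath_mono {ν : ℝ≥0 → ℕ} (hν : Monotone ν) {G : ℝ → ℝ} (hG : Monotone G) :
    Monotone (demandPath ν G) := fun _ _ h => hν (Real.toNNReal_le_toNNReal (hG h))

/-- The cumulative intensity under the policy `q` up to time `b i`, if `q` changes the price only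
at the times `b 0 ≤ b 1 ≤ …`. -/
noncomputable def intensity (lam : ℝ → ℝ) (q : Policy) (b : ℕ → ℝ) (ν : ℝ≥0 → ℕ) : ℕ → ℝ → ℝ
  | 0 => fun _ => 0
  | i + 1 => fun s => intensity lam q b ν i (min s (b i)) +
      lam (q (demandPath ν (intensity lam q b ν i)) (b i)) * max 0 (s - b i)

section intensity

variable {lam : ℝ → ℝ} {q : Policy} {b : ℕ → ℝ} {ν : ℝ≥0 → ℕ}

lemma intensity_continuous (i : ℕ) : Continuous (intensity lam q b ν i) := by
  induction i with
  | zero => exact continuous_const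
  | succ i ih => simp only [intensity]; fun_prop

lemma intensity_mono (h0 : ∀ D t, 0 ≤ t → 0 ≤ lam (q D t)) (hb0 : ∀ i, 0 ≤ b i) (i : ℕ) :
    Monotone (intensity lam q b ν i) := by
  induction i with
  | zero => exact monotone_const
  | succ i ih =>
    intro s t hst
    simp only [intensity]
    have := h0 (demandPath ν (intensity lam q b ν i)) (b i) (hb0 i)
    gcongr
    exact ih (min_le_min hst le_rfl)

lemma intensity_zero (hb0 : ∀ i, 0 ≤ b i) (i : ℕ) : intensity lam q b ν i 0 = 0 := by
  induction i with
  | zero => rfl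
  | succ i ih => simp [intensity, hb0 i, ih]

/-- Later stages extend the earlier ones without altering them, so what is observed up to `b i` is
final at stage `i`. -/
lemma intensity_eq_of_le (hb : Monotone b) {i j : ℕ} (hij : i ≤ j) {s : ℝ} (hs : s ≤ b i) :
    intensity lam q b ν j s = intensity lam q b ν i s := by
  induction j, hij using Nat.le_induction with
  | base => rfl
  | succ j hij ih =>
    have h1 : s ≤ b j := hs.trans (hb hij)
    simp [intensity, h1, ih]

/-- Between consecutive breakpoints the price is constant, and it depends on demand strictly before
times up to `b i`, where stages `i` and `j` agree. -/
lemma price_demandPath_intensity {B : Finset ℝ} (hq : IsStepwise q B) (hb : Monotone b)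
    (hb0 : ∀ i, 0 ≤ b i) {i j : ℕ} (hij : i < j)
    (hB : ∀ x ∈ B, ¬(b i < x ∧ x < b (i + 1))) {s : ℝ} (hs : s ∈ Ico (b i) (b (i + 1))) :
    q (demandPath ν (intensity lam q b ν j)) s =
      q (demandPath ν (intensity lam q b ν i)) (b i) := by
  rw [← hq.const _ (b i) s (hb0 i) hs.1 fun x hx h => hB x hx ⟨h.1, h.2.trans_lt hs.2⟩]
  refine hq.adapted _ _ _ fun x _ hx => demandBefore_congr fun u hu => ?_
  simp only [demandPath]
  rw [intensity_eq_of_le hb hij.le (hu.2.le.trans hx)]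

/-- The fixed-point equation of the model: the recursively built intensity integrates the very rate
that the policy sets when it observes the resulting demand. Each induction step adds one interval
with a constant rate. -/
lemma intensity_eq_integral {B : Finset ℝ} (hq : IsStepwise q B) (hb : Monotone b)
    (hb00 : b 0 = 0) {K : ℕ} (hB : ∀ i < K, ∀ x ∈ B, ¬(b i < x ∧ x < b (i + 1))) (i : ℕ)
    (hi : i ≤ K) : ∀ t ∈ Icc 0 (b i),
      IntervalIntegrable (fun s => lam (q (demandPath ν (intensity lam q b ν K)) s)) volume 0 t ∧
      intensity lam q b ν K t =
        ∫ s in (0 : ℝ)..t, lam (q (demandPath ν (intensity lam q b ν K)) s) := by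
  have hb0 : ∀ i, 0 ≤ b i := fun i => hb00 ▸ hb (Nat.zero_le i)
  induction i with
  | zero =>
    intro t ht
    rw [hb00] at ht
    have : t = 0 := le_antisymm ht.2 ht.1
    subst this
    simp [intensity_zero hb0]
  | succ i ih =>
    intro t ht
    rcases le_or_gt t (b i) with h | h
    · exact ih (by omega) t ⟨ht.1, h⟩
    obtain ⟨h1, h2⟩ := ih (by omega) (b i) ⟨hb0 i, le_rfl⟩
    obtain ⟨h3, h4⟩ := intervalIntegral_of_Ioo_const (a := b i) (b := t) h.le
      (f := fun s => lam (q (demandPath ν (intensity lam q b ν K)) s))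
      (c := lam (q (demandPath ν (intensity lam q b ν i)) (b i))) (fun s hs => by
        rw [price_demandPath_intensity hq hb hb0 (by omega) (hB i (by omega))
          ⟨hs.1.le, hs.2.trans_le ht.2⟩])
    refine ⟨h1.trans h3, ?_⟩
    rw [← intervalIntegral.integral_add_adjacent_intervals h1 h3, ← h2, h4,
      intensity_eq_of_le hb (show i + 1 ≤ K by omega) ht.2,
      intensity_eq_of_le hb (show i ≤ K by omega) le_rfl]
    simp [intensity, h.le]

end intensity

/-- Finitely many times in `[0, T]` can be enumerated in increasing order. -/
lemma exists_breakpoints (B : Finset ℝ) {T : ℝ} (hT : 0 < T) :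
    ∃ (K : ℕ) (b : ℕ → ℝ), Monotone b ∧ b 0 = 0 ∧ b K = T ∧
      ∀ i < K, ∀ x ∈ B, ¬(b i < x ∧ x < b (i + 1)) := by
  classical
  set S : Finset ℝ := insert 0 (insert T (B.filter fun x => 0 < x ∧ x < T)) with hS
  have hSmem : ∀ x ∈ S, 0 ≤ x ∧ x ≤ T := by
    intro x hx
    simp only [hS, Finset.mem_insert, Finset.mem_filter] at hx
    rcases hx with rfl | rfl | h
    · exact ⟨le_rfl, hT.le⟩
    · exact ⟨hT.le, le_rfl⟩
    · exact ⟨h.2.1.le, h.2.2.le⟩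
  have hcard : 0 < S.card := Finset.card_pos.2 ⟨0, by simp [hS]⟩
  obtain ⟨K, hK⟩ : ∃ K, S.card = K + 1 := ⟨S.card - 1, by omega⟩
  set e := S.orderEmbOfFin hK with he
  have hsurj : ∀ x ∈ S, ∃ j, e j = x := by
    intro x hx
    have : x ∈ Set.range e := by rw [Finset.range_orderEmbOfFin]; exact hx
    exact this
  -- The sequence stays at its last value after index `K`, which makes it monotone on all of `ℕ`.
  refine ⟨K, fun i => e ⟨min i K, by omega⟩, ?_, ?_, ?_, ?_⟩
  · intro i j hij
    exact e.monotone (by simp only [Fin.mk_le_mk]; omega)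
  · obtain ⟨j, hj⟩ := hsurj 0 (by simp [hS])
    refine le_antisymm ?_ (hSmem _ (Finset.orderEmbOfFin_mem _ _ _)).1
    rw [← hj]
    exact e.monotone (by simp)
  · obtain ⟨j, hj⟩ := hsurj T (by simp [hS])
    refine le_antisymm (hSmem _ (Finset.orderEmbOfFin_mem _ _ _)).2 ?_
    conv_lhs => rw [← hj]
    exact e.monotone (by simp only [Fin.le_def]; omega)
  · rintro i hi x hx ⟨h1, h2⟩
    have hx0 := (hSmem _ (Finset.orderEmbOfFin_mem S hK ⟨min i K, by omega⟩)).1.trans_lt h1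
    have hxT := h2.trans_le (hSmem _ (Finset.orderEmbOfFin_mem S hK ⟨min (i + 1) K, by omega⟩)).2
    obtain ⟨j, rfl⟩ := hsurj x (by simp [hS, hx, hx0, hxT])
    simp only [e.lt_iff_lt, Fin.lt_def] at h1 h2
    omega

/-! ### Censoring -/

/-- The intensity level at which no whole unit of the inventory is left. -/
lemma exists_stockout {ν : ℝ≥0 → ℕ} (hν : Monotone ν)
    (hrc : ∀ t, ContinuousWithinAt ν (Ici t) t) (I A : ℝ) :
    ∃ σ : ℝ, 0 ≤ σ ∧ ∀ u : ℝ, 0 ≤ u → u ≤ A → (I < ν u.toNNReal + 1 ↔ σ ≤ u) := by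
  by_cases hne : ∃ u : ℝ≥0, I < ν u + 1
  · obtain ⟨τ, hτ⟩ : ∃ τ : ℝ≥0, ∀ u, I < ν u + 1 ↔ τ ≤ u := by
      set S : Set ℝ≥0 := {u | I < ν u + 1} with hS
      have hup : ∀ u v, u ≤ v → I < ν u + 1 → I < ν v + 1 := by
        intro u v huv h
        have : (ν u : ℝ) ≤ ν v := by exact_mod_cast hν huv
        linarith
      -- The infimum is attained: by right-continuity `ν` is constant on some `[sInf S, c)`, and
      -- this interval meets `S`.
      have hmem : I < ν (sInf S) + 1 := by
        have h1 : ∀ᶠ u in nhdsWithin (sInf S) (Ici (sInf S)), ν u = ν (sInf S) := by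
          have := hrc (sInf S)
          rw [ContinuousWithinAt, nhds_discrete, Filter.tendsto_pure] at this
          exact this
        obtain ⟨c, hc, hsub⟩ := (mem_nhdsGE_iff_exists_Ico_subset' (show sInf S < sInf S + 1 by
          exact lt_add_one _)).1 h1
        obtain ⟨u, hu, huc⟩ := exists_lt_of_csInf_lt (show S.Nonempty from hne) hc
        have h2 : ν u = ν (sInf S) := hsub ⟨csInf_le' hu, huc⟩
        rw [← h2]
        exact hu
      exact ⟨sInf S, fun u => ⟨fun h => csInf_le' h, fun h => hup _ _ h hmem⟩⟩
    refine ⟨τ, τ.2, fun u hu _ => ?_⟩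
    rw [hτ, Real.le_toNNReal_iff_coe_le hu]
  · push Not at hne
    -- The stock never runs out, so any level beyond the range `[0, A]` makes both sides of the
    -- equivalence false.
    refine ⟨max 0 A + 1, by positivity, fun u hu hA => ⟨fun h => ?_, fun h => ?_⟩⟩
    · exact absurd h (not_lt.2 (hne _))
    · have := le_max_right 0 A
      linarith

section censor

variable {lam : ℝ → ℝ} {q : Policy} {B : Finset ℝ} {ν : ℝ≥0 → ℕ} {I cut T σ : ℝ} {G : ℝ → ℝ}

lemma censor_of_lt {D : ℝ → ℕ} {t : ℝ} (h : I < demandBefore D t + 1) :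
    censor I cut q D t = cut := by simp [censor, h]

lemma censor_of_not_lt {D : ℝ → ℕ} {t : ℝ} (h : ¬I < demandBefore D t + 1) :
    censor I cut q D t = q D t := by simp [censor, h]

/-- The demand process of the censored policy is obtained by stopping the intensity of the
uncensored policy at the level `σ` of the stock-out. -/
lemma censored_exists (hν : Monotone ν) (hν0 : ν 0 = 0) (hq : IsStepwise q B)
    (hcut : lam cut = 0) (hG : Monotone G) (hGc : Continuous G) (hG0 : G 0 = 0)
    (hint : ∀ t ∈ Icc 0 T, IntervalIntegrable (fun s => lam (q (demandPath ν G) s)) volume 0 t ∧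
      G t = ∫ s in (0 : ℝ)..t, lam (q (demandPath ν G) s))
    (hσ0 : 0 ≤ σ) (hσ : ∀ u : ℝ, 0 ≤ u → u ≤ G T → (I < ν u.toNNReal + 1 ↔ σ ≤ u)) :
    ∀ t ∈ Icc 0 T,
      IntervalIntegrable (fun s => lam (censor I cut q (demandPath ν fun r => min (G r) σ) s))
        volume 0 t ∧
      min (G t) σ =
        ∫ s in (0 : ℝ)..t, lam (censor I cut q (demandPath ν fun r => min (G r) σ) s) := by
  set D := demandPath ν fun r => min (G r) σ with hD
  have hDm : Monotone D := demandPath_mono hν fun a b h => min_le_min (hG h) le_rfl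
  have hGnn : ∀ t, 0 ≤ t → 0 ≤ G t := fun t ht => hG0 ▸ hG ht
  -- As long as the level has not been reached strictly before `s`, the left limit of the demand
  -- leaves a whole unit, and the stopped and unstopped paths look the same to the policy.
  have before : 0 < σ → ∀ s ∈ Icc 0 T, (∀ r, 0 ≤ r → r < s → G r < σ) →
      lam (censor I cut q D s) = lam (q (demandPath ν G) s) := by
    intro hσp s hs h
    have h1 : ¬I < demandBefore D s + 1 := by
      rcases hs.1.eq_or_lt with h0 | h0
      · have := (hσ 0 le_rfl (hGnn _ (hs.1.trans hs.2))).not.2 (not_le.2 hσp)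
        rw [← h0, demandBefore_zero]
        simpa [hν0] using this
      obtain ⟨r, hr, hr'⟩ := exists_demandBefore_eq (hDm.monotoneOn _) h0
      rw [← hr' r ⟨le_rfl, hr.2⟩, hD, demandPath, min_eq_left (h r hr.1 hr.2).le,
        hσ _ (hGnn r hr.1) (hG (hr.2.le.trans hs.2))]
      exact not_le.2 (h r hr.1 hr.2)
    rw [censor_of_not_lt h1]
    refine congrArg lam (hq.adapted _ _ _ fun x _ hx => demandBefore_congr fun u hu => ?_)
    simp only [hD, demandPath]
    rw [min_eq_left (h u hu.1 (hu.2.trans_le hx)).le]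
  have after : ∀ s a, 0 ≤ a → a < s → s ≤ T → σ ≤ G a → lam (censor I cut q D s) = 0 := by
    intro s a h0 has hsT ha
    rw [censor_of_lt, hcut]
    have h1 : D a ≤ demandBefore D s := le_demandBefore (hDm.monotoneOn _) ⟨h0, has⟩
    have h2 : I < D a + 1 := by
      rw [hD, demandPath, min_eq_right ha]
      exact (hσ σ hσ0 (ha.trans (hG (has.le.trans hsT)))).2 le_rfl
    have h3 : (D a : ℝ) ≤ demandBefore D s := by exact_mod_cast h1
    linarith
  intro t ht
  rcases lt_or_ge (G t) σ with h | h
  · have hσp := (hGnn t ht.1).trans_lt h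
    obtain ⟨h1, h2⟩ := intervalIntegral_congr_Ioo ht.1 (fun s hs => before hσp s
      ⟨hs.1.le, hs.2.le.trans ht.2⟩ fun r _ hr => (hG (hr.le.trans hs.2.le)).trans_lt h) (hint t ht).1
    exact ⟨h1, by rw [h2, min_eq_left h.le]; exact (hint t ht).2⟩
  · -- the first time at which the level `σ` is reached
    set S : Set ℝ := Icc 0 t ∩ G ⁻¹' Ici σ with hS
    have hSc : IsClosed S := isClosed_Icc.inter (isClosed_Ici.preimage hGc)
    have hSb : BddBelow S := ⟨0, fun _ h => h.1.1⟩
    have hSn : S.Nonempty := ⟨t, ⟨ht.1, le_rfl⟩, h⟩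
    obtain ⟨ha1, ha2⟩ := hSc.csInf_mem hSn hSb
    set a := sInf S with ha
    have hlt : ∀ r, 0 ≤ r → r < a → G r < σ := by
      intro r hr hra
      by_contra! hcon
      exact absurd (csInf_le hSb ⟨⟨hr, hra.le.trans ha1.2⟩, hcon⟩) (not_le.2 hra)
    have hGa : G a = σ := by
      obtain ⟨a', ha', hGa'⟩ := intermediate_value_Icc ha1.1 hGc.continuousOn
        (show σ ∈ Icc (G 0) (G a) from ⟨by rw [hG0]; exact hσ0, ha2⟩)
      rcases ha'.2.eq_or_lt with h1 | h1
      · rw [← h1, hGa']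
      · exact absurd hGa' (hlt a' ha'.1 h1).ne
    have haT : a ≤ T := ha1.2.trans ht.2
    obtain ⟨h3, h4⟩ := intervalIntegral_of_Ioo_const (f := fun s => lam (censor I cut q D s))
      (c := 0) (a := a) (b := t) ha1.2 fun s hs =>
        after s a ha1.1 hs.1 (hs.2.le.trans ht.2) ha2
    -- If the level is reached at time 0, then `σ = 0`: there is not even one unit at the start and
    -- the rate vanishes throughout.
    rcases ha1.1.eq_or_lt with h0 | h0
    · rw [← h0] at h3 h4 hGa
      refine ⟨h3, ?_⟩
      rw [h4, min_eq_right h]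
      simp [← hGa, hG0]
    · have hσp : 0 < σ := (hGnn 0 le_rfl).trans_lt (hlt 0 le_rfl h0)
      obtain ⟨h1, h2⟩ := intervalIntegral_congr_Ioo ha1.1 (fun s hs => before hσp s
        ⟨hs.1.le, hs.2.le.trans haT⟩ fun r h0 hr => hlt r h0 (hr.trans hs.2)) (hint a ⟨ha1.1, haT⟩).1
      refine ⟨h1.trans h3, ?_⟩
      rw [← intervalIntegral.integral_add_adjacent_intervals h1 h3, h2, h4,
        ← (hint a ⟨ha1.1, haT⟩).2, min_eq_right h, hGa]
      simp

/-- The intensity of the censored policy is the intensity of the uncensored policy, stopped at the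
level `σ`. -/
lemma censored_unique (hν : Monotone ν) (hq : IsStepwise q B)
    (hcut : lam cut = 0) (h0 : ∀ D t, 0 ≤ t → 0 ≤ lam (q D t))
    (hG : Monotone G) (hG0 : G 0 = 0)
    (hint : ∀ t ∈ Icc 0 T, IntervalIntegrable (fun s => lam (q (demandPath ν G) s)) volume 0 t ∧
      G t = ∫ s in (0 : ℝ)..t, lam (q (demandPath ν G) s))
    (hT : 0 < T)
    {D : ℝ → ℕ} (hDi : IntervalIntegrable (fun s => lam (censor I cut q D s)) volume 0 T)
    (hD : ∀ t ∈ Icc 0 T, D t =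
      ν (Real.toNNReal (∫ s in (0 : ℝ)..t, lam (censor I cut q D s))))
    (hσ0 : 0 ≤ σ) (hσ : ∀ u : ℝ, 0 ≤ u →
      u ≤ max (G T) (∫ s in (0 : ℝ)..T, lam (censor I cut q D s)) →
      (I < ν u.toNNReal + 1 ↔ σ ≤ u)) :
    ∀ t ∈ Icc 0 T, ∫ s in (0 : ℝ)..t, lam (censor I cut q D s) = min (G t) σ := by
  set f : ℝ → ℝ := fun s => lam (censor I cut q D s) with hf
  set Λ : ℝ → ℝ := fun t => ∫ s in (0 : ℝ)..t, f s with hΛ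
  have hf0 : ∀ t, 0 ≤ t → 0 ≤ f t := by
    intro t ht
    by_cases h : I < demandBefore D t + 1
    · simp only [hf]; rw [censor_of_lt h, hcut]
    · simp only [hf]; rw [censor_of_not_lt h]; exact h0 _ _ ht
  have hfi : ∀ s ∈ Icc 0 T, ∀ t ∈ Icc 0 T, IntervalIntegrable f volume s t := fun s hs t ht =>
    hDi.mono_set (by rw [uIcc_of_le hT.le]; exact uIcc_subset_Icc hs ht)
  have hadd : ∀ s ∈ Icc 0 T, ∀ t ∈ Icc 0 T, Λ t = Λ s + ∫ r in s..t, f r := fun s hs t ht =>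
    (intervalIntegral.integral_add_adjacent_intervals (hfi 0 ⟨le_rfl, hT.le⟩ s hs)
      (hfi s hs t ht)).symm
  have hΛm : ∀ s ∈ Icc 0 T, ∀ t ∈ Icc 0 T, s ≤ t → Λ s ≤ Λ t := by
    intro s hs t ht hst
    rw [hadd s hs t ht]
    have := intervalIntegral.integral_nonneg (μ := volume) hst fun u hu => hf0 u (hs.1.trans hu.1)
    linarith
  have hΛ0 : Λ 0 = 0 := by simp [hΛ]
  have hΛnn : ∀ t ∈ Icc 0 T, 0 ≤ Λ t := fun t ht =>
    hΛ0 ▸ hΛm 0 ⟨le_rfl, hT.le⟩ t ht ht.1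
  have hGnn : ∀ t, 0 ≤ t → 0 ≤ G t := fun t ht => hG0 ▸ hG ht
  have hDΛ : ∀ t ∈ Icc 0 T, D t = ν (Λ t).toNNReal := hD
  have hDm : MonotoneOn D (Icc 0 T) := fun s hs t ht hst => by
    rw [hDΛ s hs, hDΛ t ht]
    exact hν (Real.toNNReal_le_toNNReal (hΛm s hs t ht hst))
  have hDm' : ∀ t ≤ T, MonotoneOn D (Icc 0 t) := fun t ht => hDm.mono (Icc_subset_Icc_right ht)
  have hΛT : ∀ t ∈ Icc 0 T, Λ t ≤ max (G T) (Λ T) := fun t ht =>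
    (hΛm t ht T ⟨hT.le, le_rfl⟩ ht.2).trans (le_max_right _ _)
  -- no demand after the level `σ` has been reached
  have halted : ∀ a ∈ Icc 0 T, ∀ t ∈ Icc 0 T, a ≤ t → σ ≤ Λ a → Λ t = Λ a := by
    intro a ha t ht hat haσ
    have h1 := (intervalIntegral_of_Ioo_const (f := f) (c := 0) hat fun s hs => by
      simp only [hf]
      rw [censor_of_lt, hcut]
      have h2 := (hσ _ (hΛnn a ha) (hΛT a ha)).2 haσ
      rw [← hDΛ a ha] at h2
      have h3 : (D a : ℝ) ≤ demandBefore D s := by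
        exact_mod_cast le_demandBefore (hDm' s (hs.2.le.trans ht.2)) ⟨ha.1, hs.1⟩
      linarith).2
    rw [hadd a ha t ht, h1]
    simp
  -- before that, the uncensored policy is used
  have go : ∀ t ∈ Icc 0 T, Λ t < σ → ∀ s ∈ Ioo 0 t, f s = lam (q D s) := by
    intro t ht htσ s hs
    simp only [hf]
    rw [censor_of_not_lt]
    have hsT : s ≤ T := hs.2.le.trans ht.2
    obtain ⟨r, hr, hr'⟩ := exists_demandBefore_eq (hDm' s hsT) hs.1
    have hrT : r ∈ Icc 0 T := ⟨hr.1, hr.2.le.trans hsT⟩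
    rw [← hr' r ⟨le_rfl, hr.2⟩, hDΛ r hrT, hσ _ (hΛnn r hrT) (hΛT r hrT)]
    exact not_le.2 ((hΛm r hrT t ht (hr.2.le.trans hs.2.le)).trans_lt htσ)
  obtain ⟨K, b, hb, hb00, hbK, hB⟩ := exists_breakpoints B hT
  have hb0 : ∀ i, 0 ≤ b i := fun i => hb00 ▸ hb (Nat.zero_le i)
  -- Induction over the breakpoints. On the next interval the policy sees only what happened up to
  -- `b i`, where `D` is already known, so its uncensored price is determined. Censoring can only
  -- lower the rate, whence `Λ ≤ G`. Either `Λ` is still below `σ` and nothing was censored, or it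
  -- crossed `σ` by continuity and stopped there.
  have main : ∀ i ≤ K, ∀ t ∈ Icc 0 (b i), Λ t = min (G t) σ := by
    intro i
    induction i with
    | zero =>
      intro _ t ht
      rw [hb00] at ht
      have : t = 0 := le_antisymm ht.2 ht.1
      rw [this, hΛ0, hG0, min_eq_left hσ0]
    | succ i ih =>
      intro hi t ht
      rcases le_or_gt t (b i) with h | h
      · exact ih (by omega) t ⟨ht.1, h⟩
      have hbT : b (i + 1) ≤ T := hbK ▸ hb hi
      have htT : t ∈ Icc 0 T := ⟨ht.1, ht.2.trans hbT⟩
      have hbi : b i ∈ Icc 0 T := ⟨hb0 i, h.le.trans htT.2⟩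
      have ihb := ih (by omega) (b i) ⟨hb0 i, le_rfl⟩
      rcases le_or_gt σ (G (b i)) with hcase | hcase
      · rw [min_eq_right hcase] at ihb
        rw [halted _ hbi t htT h.le ihb.ge, ihb, min_eq_right (hcase.trans (hG h.le))]
      rw [min_eq_left hcase.le] at ihb
      have hDG : ∀ s ∈ Icc 0 (b i), D s = demandPath ν G s := by
        intro s hs
        rw [hDΛ s ⟨hs.1, hs.2.trans hbi.2⟩, ih (by omega) s hs,
          min_eq_left ((hG hs.2).trans hcase.le), demandPath]
      have hrate : ∀ s ∈ Ico (b i) (b (i + 1)), q D s = q (demandPath ν G) s := by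
        intro s hs
        refine hq.adapted _ _ _ fun x hx hxs => demandBefore_congr fun u hu => ?_
        refine hDG u ⟨hu.1, ?_⟩
        by_contra! hcon
        exact hB i (by omega) x hx ⟨hcon.trans hu.2, hxs.trans_lt hs.2⟩
      have hGi : IntervalIntegrable (fun s => lam (q (demandPath ν G) s)) volume (b i) t :=
        (hint t htT).1.mono_set (by
          rw [uIcc_of_le ht.1, uIcc_of_le h.le]; exact Icc_subset_Icc_left (hb0 i))
      have hGadd : G t = G (b i) + ∫ s in (b i)..t, lam (q (demandPath ν G) s) := by
        rw [(hint t htT).2, (hint _ hbi).2,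
          intervalIntegral.integral_add_adjacent_intervals (hint _ hbi).1 hGi]
      have hle : Λ t ≤ G t := by
        rw [hadd _ hbi t htT, hGadd, ihb]
        gcongr
        refine intervalIntegral.integral_mono_on_of_le_Ioo h.le (hfi _ hbi t htT) hGi ?_
        intro s hs
        simp only [hf]
        by_cases hI : I < demandBefore D s + 1
        · rw [censor_of_lt hI, hcut]
          exact h0 _ _ ((hb0 i).trans hs.1.le)
        · rw [censor_of_not_lt hI, hrate s ⟨hs.1.le, hs.2.trans_le ht.2⟩]
      rcases lt_or_ge (Λ t) σ with h1 | h1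
      · have : Λ t = G t := by
          rw [hadd _ hbi t htT, hGadd, ihb]
          congr 1
          refine (intervalIntegral_congr_Ioo h.le (fun s hs => ?_) hGi).2
          rw [go t htT h1 s ⟨(hb0 i).trans_lt hs.1, hs.2⟩,
            hrate s ⟨hs.1.le, hs.2.trans_le ht.2⟩]
        rw [← this, min_eq_left h1.le]
      · rw [min_eq_right (h1.trans hle)]
        refine le_antisymm ?_ h1
        have hcont : ContinuousOn Λ (Icc (b i) t) := by
          have := intervalIntegral.continuousOn_primitive_interval (f := f) (μ := volume)
            (a := 0) (b := T) (by rw [← intervalIntegrable_iff']; exact hDi)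
          rw [uIcc_of_le hT.le] at this
          exact this.mono (Icc_subset_Icc hbi.1 htT.2)
        obtain ⟨a, ha, haσ⟩ := intermediate_value_Icc h.le hcont
          (show σ ∈ Icc (Λ (b i)) (Λ t) from ⟨ihb ▸ hcase.le, h1⟩)
        rw [halted a ⟨hbi.1.trans ha.1, ha.2.trans htT.2⟩ t htT ha.2 haσ.ge, haσ]
  intro t ht
  exact main K le_rfl t ⟨ht.1, hbK ▸ ht.2⟩

end censor

/-! ### Revenue of a censored policy -/

/-- The revenue of the uncensored policy `q` from the first `c` units. -/
noncomputable def cumRevenue (q : Policy) (D : ℝ → ℕ) (c : ℕ) : ℝ :=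
  ∑ k ∈ Finset.range c, q D (saleTime D k)

/-- At the level `σ` the count exceeds `I - 1`, just before it the count was at most `I - 1`, and
the jump adds at most one; hence the count at `σ` is exactly `⌊I⌋₊`. -/
lemma stopped_eq_min {ν : ℝ≥0 → ℕ} (hν : Monotone ν) (hν0 : ν 0 = 0) {I A σ : ℝ} (hI : 0 ≤ I)
    (hσ0 : 0 ≤ σ) (hσ : ∀ u : ℝ, 0 ≤ u → u ≤ A → (I < ν u.toNNReal + 1 ↔ σ ≤ u))
    (hj : ∀ u : ℝ≥0, 0 < u → u ≤ A → ∃ s < u, ν u ≤ ν s + 1) {u : ℝ} (hu : 0 ≤ u) (huA : u ≤ A) :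
    ν (min u σ).toNNReal = min (ν u.toNNReal) ⌊I⌋₊ := by
  rcases lt_or_ge u σ with h | h
  · rw [min_eq_left h.le, min_eq_left]
    refine Nat.le_floor ?_
    have := (hσ u hu huA).not.2 (not_le.2 h)
    push Not at this
    linarith
  · rw [min_eq_right h]
    have h1 : I < ν σ.toNNReal + 1 := (hσ σ hσ0 (h.trans huA)).2 le_rfl
    have h2 : (ν σ.toNNReal : ℝ) ≤ I := by
      rcases hσ0.eq_or_lt with h0 | h0
      · rw [← h0]; simpa [hν0] using hI
      · obtain ⟨s, hs, hs'⟩ := hj σ.toNNReal (by simpa using h0)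
          (by rw [Real.coe_toNNReal _ hσ0]; exact h.trans huA)
        have hsσ : (s : ℝ) < σ := by rwa [Real.lt_toNNReal_iff_coe_lt] at hs
        have h3 := (hσ s s.2 (hsσ.le.trans (h.trans huA))).not.2 (not_le.2 hsσ)
        rw [Real.toNNReal_coe] at h3
        have h4 : (ν σ.toNNReal : ℝ) ≤ ν s + 1 := by exact_mod_cast hs'
        linarith
    have h3 : ⌊I⌋₊ = ν σ.toNNReal := (Nat.floor_eq_iff hI).2 ⟨h2, h1⟩
    rw [h3, min_eq_right]
    exact hν (Real.toNNReal_le_toNNReal h)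

/-- A unit with index below `⌊I⌋₊` is sold at the same time on both paths. Up to that time the paths
agree and a whole unit is left, so the price is the uncensored one. -/
lemma revenue_censor {q : Policy} {B : Finset ℝ} (hq : IsStepwise q B) {I cut T : ℝ}
    (hI : 0 ≤ I) (hT : 0 ≤ T) {D E : ℝ → ℕ} (hE : MonotoneOn E (Icc 0 T))
    (hD : ∀ t ∈ Icc 0 T, D t = min (E t) ⌊I⌋₊) :
    revenue (censor I cut q) T D = cumRevenue q E (min (E T) ⌊I⌋₊) := by
  have hTT : T ∈ Icc 0 T := ⟨hT, le_rfl⟩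
  have hDm : MonotoneOn D (Icc 0 T) := fun s hs t ht hst => by
    rw [hD s hs, hD t ht]
    exact min_le_min (hE hs ht hst) le_rfl
  rw [revenue, cumRevenue, hD T hTT]
  refine Finset.sum_congr rfl fun k hk => ?_
  rw [Finset.mem_range] at hk
  have hkI : k < ⌊I⌋₊ := hk.trans_le (min_le_right _ _)
  have hkD : k < D T := by rw [hD T hTT]; exact hk
  have hkE : k < E T := hk.trans_le (min_le_left _ _)
  have hst : saleTime D k = saleTime E k := saleTime_congr hT hkD fun t ht => by
    rw [hD t ht, lt_min_iff]
    exact ⟨fun h => h.1, fun h => ⟨h, hkI⟩⟩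
  have hle : saleTime E k ≤ T := saleTime_le hT hkE
  have hbef : ∀ s ∈ Ico 0 (saleTime E k), E s ≤ k := by
    intro s hs
    by_contra! hcon
    have h1 : k < demandBefore E (saleTime E k) :=
      (lt_demandBefore_iff (hE.mono (Icc_subset_Icc_right hle))).2 ⟨s, hs, hcon⟩
    exact lt_irrefl _ ((saleTime_lt_iff hT hkE (hE.mono (Icc_subset_Icc_right hle))).2 h1)
  have hDE : ∀ s ∈ Ico 0 (saleTime E k), D s = E s := by
    intro s hs
    rw [hD s ⟨hs.1, hs.2.le.trans hle⟩]
    exact min_eq_left ((hbef s hs).trans hkI.le)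
  rw [hst, censor_of_not_lt]
  · exact hq.adapted _ _ _ fun x _ hx => demandBefore_congr fun s hs =>
      hDE s ⟨hs.1, hs.2.trans_le hx⟩
  · have h1 : demandBefore D (saleTime E k) ≤ k :=
      demandBefore_le fun s hs => by rw [hDE s hs]; exact hbef s hs
    have h2 : (demandBefore D (saleTime E k) : ℝ) + 1 ≤ ⌊I⌋₊ := by
      exact_mod_cast Nat.succ_le_of_lt (h1.trans_lt hkI)
    have := Nat.floor_le hI
    linarith

/-- The revenue from the first units depends on the demand before the possible times of price
changes only. -/
lemma cumRevenue_congr {q : Policy} {B : Finset ℝ} (hq : IsStepwise q B) {T : ℝ} (hT : 0 ≤ T)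
    {E E' : ℝ → ℕ} (hE : Monotone E) (hE' : Monotone E') {c : ℕ} (hc : c ≤ E T) (hc' : c ≤ E' T)
    (h : ∀ x ∈ B, demandBefore E x = demandBefore E' x) :
    cumRevenue q E c = cumRevenue q E' c := by
  refine Finset.sum_congr rfl fun k hk => ?_
  rw [Finset.mem_range] at hk
  have hkE := hk.trans_le hc
  have hkE' := hk.trans_le hc'
  rw [hq.adapted E E' _ fun x hx _ => h x hx]
  -- No breakpoint separates the two sale times, so both see the same constant price.
  have key : ∀ x ∈ B, saleTime E k < x ↔ saleTime E' k < x := by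
    intro x hx
    rw [saleTime_lt_iff hT hkE (hE.monotoneOn _), saleTime_lt_iff hT hkE' (hE'.monotoneOn _),
      h x hx]
  rcases le_total (saleTime E k) (saleTime E' k) with h1 | h1
  · refine hq.const _ _ _ (saleTime_nonneg _ _) h1 fun x hx hx' => ?_
    exact absurd ((key x hx).1 hx'.1) (not_lt.2 hx'.2)
  · refine (hq.const _ _ _ (saleTime_nonneg _ _) h1 fun x hx hx' => ?_).symm
    exact absurd ((key x hx).2 hx'.1) (not_lt.2 hx'.2)

/-! ### Measurability -/

section measurability

variable {Ω : Type*} [MeasurableSpace Ω]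

/-- Splitting along the countably many values of the random time reduces to fixed times, so joint
measurability of `N` is not required. -/
lemma measurable_comp_of_countable_range {N : ℝ≥0 → Ω → ℕ} (hN : ∀ t, Measurable (N t))
    {X : Ω → ℝ} (hX : Measurable X) (hc : (range X).Countable) :
    Measurable fun ω => N (X ω).toNNReal ω := by
  intro S hS
  have : (fun ω => N (X ω).toNNReal ω) ⁻¹' S =
      ⋃ x ∈ range X, X ⁻¹' {x} ∩ N x.toNNReal ⁻¹' S := by
    ext ω
    simp only [mem_preimage, mem_range, iUnion_exists, iUnion_iUnion_eq', mem_iUnion, mem_inter_iff,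
      mem_singleton_iff]
    exact ⟨fun h => ⟨ω, rfl, h⟩, by rintro ⟨i, h1, h2⟩; rwa [h1]⟩
  rw [this]
  exact MeasurableSet.biUnion hc fun x _ => (hX (measurableSet_singleton x)).inter (hN _ hS)

/-- By monotonicity the supremum over `[0, t)` can be tested at rational times. -/
lemma measurable_demandBefore {D : Ω → ℝ → ℕ} (hm : ∀ ω, Monotone (D ω))
    (hD : ∀ t, Measurable fun ω => D ω t) (t : ℝ) : Measurable fun ω => demandBefore (D ω) t := by
  refine measurable_of_Ioi fun c => ?_
  have : (fun ω => demandBefore (D ω) t) ⁻¹' Ioi c =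
      ⋃ r : ℚ, {ω | 0 ≤ (r : ℝ) ∧ (r : ℝ) < t ∧ c < D ω r} := by
    ext ω
    simp only [mem_preimage, mem_Ioi, mem_iUnion, mem_ofPred_eq]
    rw [lt_demandBefore_iff ((hm ω).monotoneOn _)]
    constructor
    · rintro ⟨s, hs, h⟩
      obtain ⟨r, hr1, hr2⟩ := exists_rat_btwn hs.2
      exact ⟨r, hs.1.trans hr1.le, hr2, h.trans_le (hm ω hr1.le)⟩
    · rintro ⟨r, h0, h1, h2⟩
      exact ⟨r, ⟨h0, h1⟩, h2⟩
  rw [this]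
  refine MeasurableSet.iUnion fun r => ?_
  refine (MeasurableSet.const _).inter ((MeasurableSet.const _).inter ?_)
  exact hD r measurableSet_Ioi

/-- A function of a measurable map into a countable space is measurable. -/
lemma measurable_of_factorsThrough {α β : Type*} [Countable α] [MeasurableSpace α]
    [MeasurableSingletonClass α] [MeasurableSpace β] [Nonempty β] {V : Ω → α} (hV : Measurable V)
    {f : Ω → β} (hf : ∀ ω ω', V ω = V ω' → f ω = f ω') :
    Measurable f ∧ (range f).Countable := by
  classical
  have h : f = Function.extend V f (fun _ => Classical.arbitrary β) ∘ V :=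
    (Function.FactorsThrough.extend_comp (fun _ => Classical.arbitrary β)
      (fun a b hab => hf a b hab)).symm
  rw [h]
  exact ⟨(measurable_of_countable _).comp hV, (countable_range _).mono (range_comp_subset_range _ _)⟩

/-- The demand before the given times. -/
noncomputable def observations (B : Finset ℝ) (D : ℝ → ℕ) : B → ℕ := fun x => demandBefore D x

lemma measurable_observations (B : Finset ℝ) {D : Ω → ℝ → ℕ} (hm : ∀ ω, Monotone (D ω))
    (hD : ∀ t, Measurable fun ω => D ω t) : Measurable fun ω => observations B (D ω) :=
  measurable_pi_lambda _ fun x => measurable_demandBefore hm hD x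

/-- The uncensored policy has an intensity, which depends measurably on the sample point. -/
lemma exists_intensity {N : ℝ≥0 → Ω → ℕ} (hN : ∀ t, Measurable (N t))
    (hmono : ∀ ω, Monotone fun t => N t ω) {q : Policy} {B : Finset ℝ} (hq : IsStepwise q B)
    {lam : ℝ → ℝ} (h0 : ∀ D t, 0 ≤ t → 0 ≤ lam (q D t)) {T : ℝ} (hT : 0 < T) :
    ∃ G : Ω → ℝ → ℝ, (∀ ω, Monotone (G ω) ∧ Continuous (G ω) ∧ G ω 0 = 0 ∧
      ∀ t ∈ Icc 0 T,
        IntervalIntegrable (fun s => lam (q (demandPath (N · ω) (G ω)) s)) volume 0 t ∧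
        G ω t = ∫ s in (0 : ℝ)..t, lam (q (demandPath (N · ω) (G ω)) s)) ∧
      ∀ t, Measurable fun ω => demandPath (N · ω) (G ω) t := by
  obtain ⟨K, b, hb, hb00, hbK, hB⟩ := exists_breakpoints B hT
  have hb0 : ∀ i, 0 ≤ b i := fun i => hb00 ▸ hb (Nat.zero_le i)
  -- Countability of the range is carried along with measurability: the price at `b i` is a function
  -- of finitely many integer observations, so each stage takes only countably many values at a
  -- given time.
  have hmeas : ∀ i t, Measurable (fun ω => intensity lam q b (N · ω) i t) ∧
      (range fun ω => intensity lam q b (N · ω) i t).Countable := by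
    intro i
    induction i with
    | zero =>
      intro t
      exact ⟨measurable_const, (countable_singleton 0).mono (by rintro _ ⟨ω, rfl⟩; rfl)⟩
    | succ i ih =>
      intro t
      have hDm : ∀ t, Measurable fun ω =>
          demandPath (N · ω) (intensity lam q b (N · ω) i) t := fun t =>
        measurable_comp_of_countable_range hN (ih t).1 (ih t).2
      have hV := measurable_observations B
        (fun ω => demandPath_mono (hmono ω) (intensity_mono h0 hb0 i)) hDm
      obtain ⟨h1, h2⟩ := measurable_of_factorsThrough hV
        (f := fun ω => lam (q (demandPath (N · ω) (intensity lam q b (N · ω) i)) (b i)))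
        fun ω ω' h => congrArg lam (hq.adapted _ _ _ fun x hx _ => congrFun h ⟨x, hx⟩)
      refine ⟨(ih _).1.add (h1.mul_const _), ?_⟩
      refine ((ih (min t (b i))).2.image2 h2 fun x y => x + y * max 0 (t - b i)).mono ?_
      rintro _ ⟨ω, rfl⟩
      exact ⟨_, ⟨ω, rfl⟩, _, ⟨ω, rfl⟩, rfl⟩
  refine ⟨fun ω => intensity lam q b (N · ω) K, fun ω => ⟨intensity_mono h0 hb0 K,
    intensity_continuous K, intensity_zero hb0 K, ?_⟩, fun t =>
      measurable_comp_of_countable_range hN (hmeas K t).1 (hmeas K t).2⟩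
  have := intensity_eq_integral (lam := lam) (ν := (N · ω)) hq hb hb00 hB K le_rfl
  rwa [hbK] at this

end measurability

/-! ### Admissibility -/

lemma nonAnticipating_censor {q : Policy} {B : Finset ℝ} (hq : IsStepwise q B) (I cut : ℝ) :
    NonAnticipating (censor I cut q) := by
  intro D D' t h
  have h1 : demandBefore D t = demandBefore D' t := demandBefore_congr h
  have h2 : q D t = q D' t := hq.adapted _ _ _ fun x _ hx => demandBefore_congr fun s hs =>
    h s ⟨hs.1, hs.2.trans_le hx⟩
  simp only [censor, h1, h2]

/-- A stepwise policy with regular prices becomes admissible by censoring. Its revenue is almost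
surely that of the uncensored policy from the units that are in stock. -/
theorem censor_isAdmissible {Ω : Type*} [MeasurableSpace Ω] {P : Measure Ω} {N : ℝ≥0 → Ω → ℕ}
    (hN : IsUnitPoissonProcess N P) [IsProbabilityMeasure P]
    (hj : ∀ A : ℝ≥0, ∀ᵐ ω ∂P, ∀ u : ℝ≥0, 0 < u → u ≤ A → ∃ s < u, N u ω ≤ N s ω + 1)
    {m : Market} (hT : 0 < m.horizon) (hI : 0 ≤ m.inventory) (hlo : 0 ≤ m.lo)
    {q : Policy} {B : Finset ℝ} (hq : IsStepwise q B)
    (hprice : ∀ D t, 0 ≤ t → q D t ∈ Icc m.lo m.hi)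
    {lam : ℝ → ℝ} (hcut : lam m.cut = 0) {Λ : ℝ} (hlam : ∀ p ∈ Icc m.lo m.hi, 0 ≤ lam p)
    (hΛ : ∀ p ∈ Icc m.lo m.hi, lam p ≤ Λ) :
    IsAdmissible m (censor m.inventory m.cut q) lam N P ∧
    ∃ G : Ω → ℝ → ℝ, (∀ ω, Monotone (G ω) ∧ Continuous (G ω) ∧ G ω 0 = 0 ∧
      ∀ t ∈ Icc 0 m.horizon,
        IntervalIntegrable (fun s => lam (q (demandPath (N · ω) (G ω)) s)) volume 0 t ∧
        G ω t = ∫ s in (0 : ℝ)..t, lam (q (demandPath (N · ω) (G ω)) s)) ∧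
      ∀ᵐ ω ∂P, revenue (censor m.inventory m.cut q) m.horizon (fun t =>
          demandProcess (censor m.inventory m.cut q) lam m.horizon N t ω) =
        cumRevenue q (demandPath (N · ω) (G ω))
          (min (demandPath (N · ω) (G ω) m.horizon) ⌊m.inventory⌋₊) := by
  set T := m.horizon with hTdef
  set I := m.inventory with hIdef
  set π := censor I m.cut q with hπ
  have h0 : ∀ D t, 0 ≤ t → 0 ≤ lam (q D t) := fun D t ht => hlam _ (hprice D t ht)
  obtain ⟨G, hG, hGm⟩ := exists_intensity hN.measurable hN.monotone hq h0 hT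
  have hTT : T ∈ Icc 0 T := ⟨hT.le, le_rfl⟩
  have hGT : ∀ ω, G ω T ≤ Λ * T := by
    intro ω
    rw [((hG ω).2.2.2 T hTT).2]
    calc _ ≤ ∫ s in (0 : ℝ)..T, Λ := intervalIntegral.integral_mono_on hT.le
          ((hG ω).2.2.2 T hTT).1 intervalIntegrable_const fun s hs => hΛ _ (hprice _ _ hs.1)
      _ = Λ * T := by simp [mul_comm]
  have hGnn : ∀ ω t, 0 ≤ t → 0 ≤ G ω t := fun ω t ht => (hG ω).2.2.1 ▸ (hG ω).1 ht
  -- The level is fixed relative to the bound `Λ * T`, which holds for the intensity of every demand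
  -- process, so the same `σ` serves existence and uniqueness.
  choose σ hσ0 hσ using fun ω => exists_stockout (hN.monotone ω) (hN.right_continuous ω) I (Λ * T)
  have hσ' : ∀ ω, ∀ u : ℝ, 0 ≤ u → u ≤ G ω T → (I < N u.toNNReal ω + 1 ↔ σ ω ≤ u) :=
    fun ω u h h' => hσ ω u h (h'.trans (hGT ω))
  have hex : IsDemandProcess π lam T N fun t ω => demandPath (N · ω) (fun r => min (G ω r) (σ ω)) t := by
    intro ω
    obtain ⟨hm, hc, hz, hi⟩ := hG ω
    have := censored_exists (cut := m.cut) (hN.monotone ω) (hN.zero ω) hq hcut hm hc hz hi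
      (hσ0 ω) (hσ' ω)
    refine ⟨(this T hTT).1, fun t ht => ?_⟩
    rw [← (this t ht).2]
    rfl
  have huniq : ∀ D, IsDemandProcess π lam T N D → ∀ ω, ∀ t ∈ Icc 0 T,
      D t ω = N (min (G ω t) (σ ω)).toNNReal ω := by
    intro D hD ω t ht
    obtain ⟨hm, hc, hz, hi⟩ := hG ω
    obtain ⟨hDi, hD'⟩ := hD ω
    rw [hD' t ht]
    congr 2
    refine censored_unique (hN.monotone ω) hq hcut h0 hm hz hi hT hDi hD' (hσ0 ω) ?_ t ht
    intro u hu hu'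
    refine hσ ω u hu (hu'.trans (max_le (hGT ω) ?_))
    calc _ ≤ ∫ s in (0 : ℝ)..T, Λ := intervalIntegral.integral_mono_on hT.le
          hDi intervalIntegrable_const fun s hs => ?_
      _ = Λ * T := by simp [mul_comm]
    by_cases h : I < demandBefore (fun u => D u ω) s + 1
    · rw [hπ, censor_of_lt h, hcut]
      exact (hlam _ (hprice (fun _ => 0) 0 le_rfl)).trans (hΛ _ (hprice _ _ le_rfl))
    · rw [hπ, censor_of_not_lt h]
      exact hΛ _ (hprice _ _ hs.1)
  have hdp : IsDemandProcess π lam T N (demandProcess π lam T N) :=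
    Classical.epsilon_spec (p := IsDemandProcess π lam T N) ⟨_, hex⟩
  have hdp' := huniq _ hdp
  have hmin : ∀ᵐ ω ∂P, ∀ t ∈ Icc 0 T, demandProcess π lam T N t ω =
      min (demandPath (N · ω) (G ω) t) ⌊I⌋₊ := by
    filter_upwards [hj (Λ * T).toNNReal] with ω hω t ht
    rw [hdp' ω t ht]
    have hΛT : 0 ≤ Λ * T := (hGnn ω T hT.le).trans (hGT ω)
    exact stopped_eq_min (hN.monotone ω) (hN.zero ω) hI (hσ0 ω) (hσ ω)
      (fun u hu hu' => hω u hu (by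
        rw [← NNReal.coe_le_coe, Real.coe_toNNReal _ hΛT]; exact hu'))
      (hGnn ω t ht.1) (((hG ω).1 ht.2).trans (hGT ω))
  have hrev : ∀ᵐ ω ∂P, revenue π T (fun t => demandProcess π lam T N t ω) =
      cumRevenue q (demandPath (N · ω) (G ω)) (min (demandPath (N · ω) (G ω) T) ⌊I⌋₊) := by
    filter_upwards [hmin] with ω hω
    exact revenue_censor hq hI hT.le ((demandPath_mono (hN.monotone ω) (hG ω).1).monotoneOn _) hω
  refine ⟨⟨nonAnticipating_censor hq _ _, ?_, ⟨_, hex⟩, ?_, ?_, ?_⟩, G, hG, hrev⟩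
  · intro D t ht
    by_cases h : I < demandBefore D t + 1
    · exact Or.inr (by rw [hπ, censor_of_lt h]; rfl)
    · exact Or.inl (by rw [hπ, censor_of_not_lt h]; exact hprice D t ht.1)
  · intro D D' hD hD' t ht
    funext ω
    rw [huniq D hD ω t ht, huniq D' hD' ω t ht]
  · filter_upwards [hmin] with ω hω
    rw [hω T hTT]
    exact (Nat.cast_le.2 (min_le_right _ _)).trans (Nat.floor_le hI)
  · have hmono : ∀ ω, Monotone (demandPath (N · ω) (G ω)) := fun ω =>
      demandPath_mono (hN.monotone ω) (hG ω).1
    -- The revenue factors through finitely many integers: the demand before the breakpoints and at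
    -- the end of the season.
    have hV : Measurable fun ω => (observations B (demandPath (N · ω) (G ω)),
        demandPath (N · ω) (G ω) T) := (measurable_observations B hmono hGm).prodMk (hGm T)
    have hmeas := (measurable_of_factorsThrough hV (f := fun ω =>
      cumRevenue q (demandPath (N · ω) (G ω)) (min (demandPath (N · ω) (G ω) T) ⌊I⌋₊)) (by
        intro ω ω' h
        obtain ⟨h1, h2⟩ := Prod.ext_iff.1 h
        simp only at h1 h2
        rw [h2]
        exact cumRevenue_congr hq hT.le (hmono ω) (hmono ω') ((min_le_left _ _).trans h2.ge)
          (min_le_left _ _) fun x hx => congrFun h1 ⟨x, hx⟩)).1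
    refine (Integrable.congr ?_ (hrev.mono fun ω h => h.symm))
    refine Integrable.of_bound hmeas.aestronglyMeasurable (⌊I⌋₊ * m.hi) (Filter.Eventually.of_forall
      fun ω => ?_)
    rw [cumRevenue]
    refine (Finset.abs_sum_le_sum_abs _ _).trans ?_
    have hhi : 0 ≤ m.hi := hlo.trans ((hprice (fun _ => 0) 0 le_rfl).1.trans
      (hprice (fun _ => 0) 0 le_rfl).2)
    calc _ ≤ ∑ _k ∈ Finset.range (min (demandPath (N · ω) (G ω) T) ⌊I⌋₊), m.hi := by
          refine Finset.sum_le_sum fun k _ => ?_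
          have := hprice (demandPath (N · ω) (G ω)) _ (saleTime_nonneg (demandPath (N · ω) (G ω)) k)
          rw [abs_of_nonneg (hlo.trans this.1)]
          exact this.2
      _ ≤ ⌊I⌋₊ * m.hi := by
          rw [Finset.sum_const, Finset.card_range, nsmul_eq_mul]
          gcongr
          exact min_le_right _ _

/-! ### Indices -/

lemma sInf_nat_congr {p q : ℕ → Prop} {N : ℕ} (hN : ∃ k < N, p k) (h : ∀ k < N, p k ↔ q k) :
    sInf {k | p k} = sInf {k | q k} := by
  have key : ∀ p q : ℕ → Prop, (∃ k < N, p k) → (∀ k < N, p k ↔ q k) →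
      sInf {k | q k} ≤ sInf {k | p k} := by
    rintro p q ⟨k, hk, hpk⟩ h
    have h1 : sInf {k | p k} ∈ {k | p k} := Nat.sInf_mem ⟨k, hpk⟩
    have h2 : sInf {k | p k} ≤ k := Nat.sInf_le hpk
    exact Nat.sInf_le ((h _ (h2.trans_lt hk)).1 h1)
  obtain ⟨k, hk, hpk⟩ := hN
  exact le_antisymm (key q p ⟨k, hk, (h k hk).1 hpk⟩ fun k hk => (h k hk).symm)
    (key p q ⟨k, hk, hpk⟩ h)

lemma stepIndex_spec {f : ℕ → ℝ} {t : ℝ} {N : ℕ} (h0 : f 0 ≤ t) (hN : t < f N) :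
    sInf {k | t < f (k + 1)} < N ∧ f (sInf {k | t < f (k + 1)}) ≤ t ∧
      t < f (sInf {k | t < f (k + 1)} + 1) := by
  have hN0 : N ≠ 0 := by rintro rfl; exact absurd hN (not_lt.2 h0)
  obtain ⟨M, rfl⟩ := Nat.exists_eq_succ_of_ne_zero hN0
  have hmem : sInf {k | t < f (k + 1)} ∈ {k | t < f (k + 1)} := Nat.sInf_mem ⟨M, hN⟩
  refine ⟨Nat.lt_succ_of_le (Nat.sInf_le hN), ?_, hmem⟩
  rcases Nat.eq_zero_or_eq_succ_pred (sInf {k | t < f (k + 1)}) with h | h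
  · rw [h]; exact h0
  · by_contra! hcon
    rw [h] at hcon
    have : sInf {k | t < f (k + 1)} ≤ (sInf {k | t < f (k + 1)}).pred := Nat.sInf_le hcon
    omega

lemma stepIndex_eq {f : ℕ → ℝ} (hf : Monotone f) {t : ℝ} {k : ℕ} (h : t ∈ Ico (f k) (f (k + 1))) :
    sInf {k | t < f (k + 1)} = k := by
  refine le_antisymm (Nat.sInf_le h.2) ?_
  by_contra! hcon
  have hmem : sInf {k | t < f (k + 1)} ∈ {k | t < f (k + 1)} := Nat.sInf_mem ⟨k, h.2⟩
  exact absurd (hmem.trans_le (hf (Nat.succ_le_of_lt hcon))) (not_lt.2 h.1)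

lemma argminIndex_spec (f : ℕ → ℝ) {k : ℕ} (hk : 0 < k) :
    argminIndex f k < k ∧ ∀ i < k, f (argminIndex f k) ≤ f i := by
  obtain ⟨j, hj, hj'⟩ := Finset.exists_min_image (Finset.range k) f ⟨0, by simpa using hk⟩
  exact Nat.sInf_mem (s := {j : ℕ | j < k ∧ ∀ i < k, f j ≤ f i})
    ⟨j, by simpa using hj, fun i hi => hj' i (by simpa using hi)⟩

lemma argminIndex_congr {f g : ℕ → ℝ} {k : ℕ} (h : ∀ j < k, f j = g j) :
    argminIndex f k = argminIndex g k := by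
  unfold argminIndex
  congr 1
  ext j
  simp only [mem_ofPred_eq]
  refine and_congr_right fun hj => forall₂_congr fun i hi => ?_
  rw [h j hj, h i hi]

/-! ### Periods -/

namespace Period

/-- The price interval lies in `[lo, hi]`, and length and grid size are positive. -/
structure Regular (m : Market) (q : Period) : Prop where
  lo_le : m.lo ≤ q.a
  a_le : q.a ≤ q.b
  le_hi : q.b ≤ m.hi
  grid_pos : 0 < q.grid
  length_pos : 0 < q.length

variable {m : Market} {q : Period}

lemma time_zero (q : Period) : q.time 0 = q.start := by simp [time]

lemma time_grid (h : 0 < q.grid) : q.time q.grid = q.start + q.length := by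
  have : (q.grid : ℝ) ≠ 0 := by positivity
  simp only [time, step]
  field_simp

lemma time_mono (h : 0 ≤ q.length) : Monotone q.time := by
  intro i j hij
  simp only [time, step]
  gcongr

lemma time_add_one (q : Period) (j : ℕ) : q.time (j + 1) = q.time j + q.step := by
  simp only [time]; push_cast; ring

lemma Regular.mesh_nonneg (h : q.Regular m) : 0 ≤ q.mesh := by
  have := h.a_le
  exact div_nonneg (by linarith) (Nat.cast_nonneg _)

lemma Regular.grid_mul_mesh (h : q.Regular m) : q.grid * q.mesh = q.b - q.a := by
  have : (q.grid : ℝ) ≠ 0 := by have := h.grid_pos; positivity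
  simp only [mesh]
  field_simp

lemma Regular.price_mem (h : q.Regular m) {j : ℕ} (hj : j < q.grid) : q.price j ∈ Icc q.a q.b := by
  have h1 := h.mesh_nonneg
  have h2 := h.grid_mul_mesh
  have h3 : (j : ℝ) ≤ q.grid := by exact_mod_cast hj.le
  refine ⟨?_, ?_⟩ <;> simp only [price]
  · have : 0 ≤ j * q.mesh := by positivity
    linarith
  · have : j * q.mesh ≤ q.grid * q.mesh := by gcongr
    linarith

lemma Regular.mem_of_mem (h : q.Regular m) {p : ℝ} (hp : p ∈ Icc q.a q.b) : p ∈ Icc m.lo m.hi :=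
  ⟨h.lo_le.trans hp.1, hp.2.trans h.le_hi⟩

lemma Regular.hatU_mem (h : q.Regular m) (D : ℝ → ℕ) : q.hatU D ∈ Icc q.a q.b :=
  h.price_mem (argminIndex_spec _ h.grid_pos).1

lemma Regular.hatC_mem (h : q.Regular m) (c : ℝ) (D : ℝ → ℕ) : q.hatC c D ∈ Icc q.a q.b :=
  h.price_mem (argminIndex_spec _ h.grid_pos).1

lemma Regular.priceAt_mem (h : q.Regular m) {t : ℝ} (h1 : q.start ≤ t)
    (h2 : t < q.start + q.length) : q.priceAt t ∈ Icc q.a q.b :=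
  h.price_mem (stepIndex_spec (f := q.time) (by rwa [time_zero])
    (by rwa [time_grid h.grid_pos])).1

lemma rate_congr {D D' : ℝ → ℕ} (h : ∀ j ≤ q.grid,
    demandBefore D (q.time j) = demandBefore D' (q.time j)) {j : ℕ} (hj : j < q.grid) :
    q.rate D j = q.rate D' j := by
  simp only [rate, h j hj.le, h (j + 1) hj]

lemma hatU_congr {D D' : ℝ → ℕ} (h : ∀ j ≤ q.grid,
    demandBefore D (q.time j) = demandBefore D' (q.time j)) : q.hatU D = q.hatU D' := by
  simp only [hatU]
  rw [argminIndex_congr fun j hj => by rw [rate_congr h hj]]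

lemma hatC_congr {D D' : ℝ → ℕ} (c : ℝ) (h : ∀ j ≤ q.grid,
    demandBefore D (q.time j) = demandBefore D' (q.time j)) : q.hatC c D = q.hatC c D' := by
  simp only [hatC]
  rw [argminIndex_congr fun j hj => by rw [rate_congr h hj]]

end Period

/-! ### The periods of the algorithm -/

section

variable {m : Market} {n : ℕ} {d : ℝ}

lemma periodU_start (D : ℝ → ℕ) (k : ℕ) : (periodU m n d D k).start = startU m n d k := by
  cases k <;> rfl

lemma periodU_length (D : ℝ → ℕ) (k : ℕ) :
    (periodU m n d D k).length = m.horizon * tauU n d k := by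
  cases k <;> rfl

lemma periodU_grid (D : ℝ → ℕ) (k : ℕ) : (periodU m n d D k).grid = ⌈kappaU n d k⌉₊ := by
  cases k <;> rfl

lemma periodC_start (s : ℝ) (D : ℝ → ℕ) (k : ℕ) :
    (periodC m n d s D k).start = s + startC m n d k := by
  cases k <;> rfl

lemma periodC_length (s : ℝ) (D : ℝ → ℕ) (k : ℕ) :
    (periodC m n d s D k).length = m.horizon * tauC n d k := by
  cases k <;> rfl

lemma periodC_grid (s : ℝ) (D : ℝ → ℕ) (k : ℕ) :
    (periodC m n d s D k).grid = ⌈kappaC n d k⌉₊ := by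
  cases k <;> rfl

lemma startU_succ (k : ℕ) : startU m n d (k + 1) = startU m n d k + m.horizon * tauU n d k := by
  simp [startU, Finset.sum_range_succ]

lemma startC_succ (k : ℕ) : startC m n d (k + 1) = startC m n d k + m.horizon * tauC n d k := by
  simp [startC, Finset.sum_range_succ]

lemma startU_zero : startU m n d 0 = 0 := by simp [startU]

lemma startC_zero : startC m n d 0 = 0 := by simp [startC]

lemma log_natCast_pos (hn : 2 ≤ n) : 0 < Real.log n :=
  Real.log_pos (by exact_mod_cast hn)

lemma natCast_pos_of_two_le (hn : 2 ≤ n) : (0 : ℝ) < n := by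
  exact_mod_cast (by omega : 0 < n)

lemma tauU_pos (hn : 2 ≤ n) (k : ℕ) : 0 < tauU n d k :=
  mul_pos (Real.rpow_pos_of_pos (natCast_pos_of_two_le hn) _) (pow_pos (log_natCast_pos hn) _)

lemma tauC_pos (hn : 2 ≤ n) (k : ℕ) : 0 < tauC n d k :=
  mul_pos (Real.rpow_pos_of_pos (natCast_pos_of_two_le hn) _) (pow_pos (log_natCast_pos hn) _)

lemma kappaU_pos (hn : 2 ≤ n) (k : ℕ) : 0 < kappaU n d k :=
  mul_pos (Real.rpow_pos_of_pos (natCast_pos_of_two_le hn) _) (log_natCast_pos hn)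

lemma kappaC_pos (hn : 2 ≤ n) (k : ℕ) : 0 < kappaC n d k :=
  mul_pos (Real.rpow_pos_of_pos (natCast_pos_of_two_le hn) _) (log_natCast_pos hn)

lemma startU_mono (hn : 2 ≤ n) (hT : 0 < m.horizon) : Monotone (startU m n d) :=
  monotone_nat_of_le_succ fun k => by
    rw [startU_succ]
    have := mul_pos hT (tauU_pos (d := d) hn k)
    linarith

lemma startC_mono (hn : 2 ≤ n) (hT : 0 < m.horizon) : Monotone (startC m n d) :=
  monotone_nat_of_le_succ fun k => by
    rw [startC_succ]
    have := mul_pos hT (tauC_pos (d := d) hn k)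
    linarith

/-- The truncated intervals never become empty, because each is cut around an empirical price that
lies in `[lo, hi]`. -/
lemma periodU_regular (hn : 2 ≤ n) (hT : 0 < m.horizon) (hlh : m.lo ≤ m.hi) (D : ℝ → ℕ) (k : ℕ) :
    (periodU m n d D k).Regular m := by
  have hlog := (log_natCast_pos hn).le
  have hg : ∀ k, 0 < (periodU m n d D k).grid := fun k => by
    rw [periodU_grid]; exact Nat.ceil_pos.2 (kappaU_pos hn k)
  have hl : ∀ k, 0 < (periodU m n d D k).length := fun k => by
    rw [periodU_length]; exact mul_pos hT (tauU_pos hn k)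
  induction k with
  | zero => exact ⟨le_rfl, hlh, le_rfl, hg 0, hl 0⟩
  | succ k ih =>
    have hC := ih.mem_of_mem (ih.hatC_mem (m.inventory / m.horizon) D)
    have hU := ih.mem_of_mem (ih.hatU_mem D)
    have hmesh := ih.mesh_nonneg
    set p := max ((periodU m n d D k).hatC (m.inventory / m.horizon) D)
      ((periodU m n d D k).hatU D) with hp
    have h1 : 0 ≤ Real.log n / 3 * (periodU m n d D k).mesh := by positivity
    have h2 : 0 ≤ 2 * Real.log n / 3 * (periodU m n d D k).mesh := by positivity
    have hplo : m.lo ≤ p := hC.1.trans (le_max_left _ _)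
    have hphi : p ≤ m.hi := max_le hC.2 hU.2
    refine ⟨le_max_left _ _, ?_, min_le_left _ _, hg _, hl _⟩
    change max m.lo (p - Real.log n / 3 * (periodU m n d D k).mesh) ≤
      min m.hi (p + 2 * Real.log n / 3 * (periodU m n d D k).mesh)
    exact max_le (le_min hlh (by linarith)) (le_min (by linarith) (by linarith))

lemma periodC_regular (hn : 2 ≤ n) (hT : 0 < m.horizon) (hlh : m.lo ≤ m.hi) (s : ℝ) (D : ℝ → ℕ)
    (k : ℕ) : (periodC m n d s D k).Regular m := by
  have hlog := (log_natCast_pos hn).le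
  have hg : ∀ k, 0 < (periodC m n d s D k).grid := fun k => by
    rw [periodC_grid]; exact Nat.ceil_pos.2 (kappaC_pos hn k)
  have hl : ∀ k, 0 < (periodC m n d s D k).length := fun k => by
    rw [periodC_length]; exact mul_pos hT (tauC_pos hn k)
  induction k with
  | zero => exact ⟨le_rfl, hlh, le_rfl, hg 0, hl 0⟩
  | succ k ih =>
    have hC := ih.mem_of_mem (ih.hatC_mem (m.inventory / m.horizon) D)
    have hmesh := ih.mesh_nonneg
    set p := (periodC m n d s D k).hatC (m.inventory / m.horizon) D with hp
    have h1 : 0 ≤ Real.log n / 2 * (periodC m n d s D k).mesh := by positivity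
    refine ⟨le_max_left _ _, ?_, min_le_left _ _, hg _, hl _⟩
    change max m.lo (p - Real.log n / 2 * (periodC m n d s D k).mesh) ≤
      min m.hi (p + Real.log n / 2 * (periodC m n d s D k).mesh)
    exact max_le (le_min hlh (by linarith [hC.1])) (le_min (by linarith [hC.2]) (by linarith))

lemma periodsU_pos : 0 < periodsU n d := lt_of_lt_of_le one_pos (le_max_left _ _)

lemma periodsC_pos : 0 < periodsC n d := lt_of_lt_of_le one_pos (le_max_left _ _)

/-! ### The algorithm before the stock-out -/

open Classical in
/-- The policy of the algorithm as long as there is inventory. -/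
noncomputable def uncensoredDpa (m : Market) (n : ℕ) (d : ℝ) : Policy := fun D t =>
  if ∃ k < periodsU n d, startU m n d (k + 1) ≤ t ∧ transition m n d D k then
    priceC m n d (startU m n d (transitionIndex m n d D + 1)) D t
  else priceU m n d D t

lemma dpa_eq_censor : dpa m n d = censor m.inventory m.cut (uncensoredDpa m n d) := by
  funext D t
  simp [dpa, censor, uncensoredDpa]

lemma transitionIndex_spec {D : ℝ → ℕ} (h : ∃ k < periodsU n d, transition m n d D k) :
    transitionIndex m n d D < periodsU n d ∧ transition m n d D (transitionIndex m n d D) := by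
  have : transitionIndex m n d D ∈ {k : ℕ | k < periodsU n d ∧ transition m n d D k} :=
    Nat.sInf_mem h
  exact this

/-- The times at which the algorithm may change the price. -/
noncomputable def breakpoints (m : Market) (n : ℕ) (d : ℝ) : Finset ℝ := by
  classical exact
  (Finset.range (periodsU n d + 1)).image (startU m n d) ∪
  (Finset.range (periodsU n d)).biUnion (fun k =>
    (Finset.range (⌈kappaU n d k⌉₊ + 1)).image ((periodU m n d (fun _ => 0) k).time)) ∪
  (Finset.range (periodsU n d + 1)).biUnion (fun i =>
    (Finset.range (periodsC n d + 1)).image fun k => startU m n d i + startC m n d k) ∪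
  (Finset.range (periodsU n d + 1)).biUnion (fun i => (Finset.range (periodsC n d)).biUnion fun k =>
    (Finset.range (⌈kappaC n d k⌉₊ + 1)).image
      ((periodC m n d (startU m n d i) (fun _ => 0) k).time))

/-- Only the prices of a period depend on the demand. The grid times are deterministic, so the
breakpoints can be read off the zero path. -/
lemma periodU_time_eq (D D' : ℝ → ℕ) (k j : ℕ) :
    (periodU m n d D k).time j = (periodU m n d D' k).time j := by
  simp only [Period.time, Period.step, periodU_start, periodU_length, periodU_grid]

lemma periodC_time_eq (s : ℝ) (D D' : ℝ → ℕ) (k j : ℕ) :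
    (periodC m n d s D k).time j = (periodC m n d s D' k).time j := by
  simp only [Period.time, Period.step, periodC_start, periodC_length, periodC_grid]

lemma startU_mem_breakpoints {k : ℕ} (hk : k ≤ periodsU n d) :
    startU m n d k ∈ breakpoints m n d := by
  classical
  simp only [breakpoints, Finset.mem_union]
  exact Or.inl (Or.inl (Or.inl (Finset.mem_image_of_mem _ (by simpa using Nat.lt_succ_of_le hk))))

lemma timeU_mem_breakpoints (D : ℝ → ℕ) {k j : ℕ} (hk : k < periodsU n d)
    (hj : j ≤ (periodU m n d D k).grid) : (periodU m n d D k).time j ∈ breakpoints m n d := by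
  classical
  rw [periodU_grid] at hj
  simp only [breakpoints, Finset.mem_union, Finset.mem_biUnion]
  refine Or.inl (Or.inl (Or.inr ⟨k, by simpa using hk, ?_⟩))
  rw [periodU_time_eq D (fun _ => 0)]
  exact Finset.mem_image_of_mem _ (by simpa using Nat.lt_succ_of_le hj)

lemma startC_mem_breakpoints {i k : ℕ} (hi : i ≤ periodsU n d) (hk : k ≤ periodsC n d) :
    startU m n d i + startC m n d k ∈ breakpoints m n d := by
  classical
  simp only [breakpoints, Finset.mem_union, Finset.mem_biUnion]
  refine Or.inl (Or.inr ⟨i, by simpa using Nat.lt_succ_of_le hi, ?_⟩)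
  exact Finset.mem_image_of_mem (fun k => startU m n d i + startC m n d k)
    (by simpa using Nat.lt_succ_of_le hk)

lemma timeC_mem_breakpoints (D : ℝ → ℕ) {i k j : ℕ} (hi : i ≤ periodsU n d)
    (hk : k < periodsC n d) (hj : j ≤ (periodC m n d (startU m n d i) D k).grid) :
    (periodC m n d (startU m n d i) D k).time j ∈ breakpoints m n d := by
  classical
  rw [periodC_grid] at hj
  simp only [breakpoints, Finset.mem_union, Finset.mem_biUnion]
  refine Or.inr ⟨i, by simpa using Nat.lt_succ_of_le hi, k, by simpa using hk, ?_⟩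
  rw [periodC_time_eq _ D (fun _ => 0)]
  exact Finset.mem_image_of_mem _ (by simpa using Nat.lt_succ_of_le hj)

/-- The price in a period depends only on the grid times that have passed. -/
lemma Period.priceAt_congr {q : Period} (hg : 0 < q.grid) {t t' : ℝ}
    (h2 : t < q.start + q.length)
    (h : ∀ j ≤ q.grid, t < q.time j ↔ t' < q.time j) : q.priceAt t = q.priceAt t' := by
  simp only [priceAt]
  rw [sInf_nat_congr (N := q.grid) ⟨q.grid - 1, by omega, by
    rwa [Nat.sub_add_cancel hg, q.time_grid hg]⟩ fun j hj => h (j + 1) hj]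

variable (hn : 2 ≤ n) (hT : 0 < m.horizon) (hlh : m.lo ≤ m.hi)
include hn hT hlh

lemma priceU_mem (D : ℝ → ℕ) {t : ℝ} (ht : 0 ≤ t) : priceU m n d D t ∈ Icc m.lo m.hi := by
  have hr := periodU_regular (d := d) hn hT hlh D
  unfold priceU
  split_ifs with h
  · obtain ⟨-, h1, h2⟩ := stepIndex_spec (f := startU m n d) (by rwa [startU_zero]) h
    refine (hr _).mem_of_mem ((hr _).priceAt_mem (by rwa [periodU_start]) ?_)
    rwa [periodU_start, periodU_length, ← startU_succ]
  · have hC := (hr (periodsU n d - 1)).mem_of_mem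
      ((hr (periodsU n d - 1)).hatC_mem (m.inventory / m.horizon) D)
    have hmesh := (hr (periodsU n d - 1)).mesh_nonneg
    refine ⟨le_min hlh (hC.1.trans ((le_max_left _ _).trans (le_add_of_nonneg_right ?_))),
      min_le_left _ _⟩
    positivity

lemma priceC_mem {s : ℝ} (D : ℝ → ℕ) {t : ℝ} (ht : s ≤ t) :
    priceC m n d s D t ∈ Icc m.lo m.hi := by
  have hr := periodC_regular (d := d) hn hT hlh s D
  unfold priceC
  split_ifs with h
  · obtain ⟨-, h1, h2⟩ := stepIndex_spec (f := fun k => s + startC m n d k)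
      (by simpa [startC_zero] using ht) h
    refine (hr _).mem_of_mem ((hr _).priceAt_mem (by rwa [periodC_start]) ?_)
    rw [periodC_start, periodC_length, add_assoc, ← startC_succ]
    exact h2
  · exact (hr _).mem_of_mem ((hr _).hatC_mem _ D)

lemma uncensoredDpa_mem (D : ℝ → ℕ) {t : ℝ} (ht : 0 ≤ t) :
    uncensoredDpa m n d D t ∈ Icc m.lo m.hi := by
  unfold uncensoredDpa
  split_ifs with h
  · obtain ⟨k, hk, hkt, htr⟩ := h
    refine priceC_mem hn hT hlh D (le_trans (startU_mono hn hT ?_) hkt)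
    have : transitionIndex m n d D ≤ k :=
      Nat.sInf_le (s := {k : ℕ | k < periodsU n d ∧ transition m n d D k}) ⟨hk, htr⟩
    omega
  · exact priceU_mem hn hT hlh D ht

/-- Period `k` is computed from the demand before grid times of earlier periods, all of which are
breakpoints not later than its start. -/
lemma periodU_congr {D D' : ℝ → ℕ} {t : ℝ}
    (h : ∀ b ∈ breakpoints m n d, b ≤ t → demandBefore D b = demandBefore D' b) {k : ℕ}
    (hk : k < periodsU n d) (hkt : startU m n d k ≤ t) :
    periodU m n d D k = periodU m n d D' k := by
  induction k with
  | zero => rfl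
  | succ k ih =>
    have h1 := ih (by omega) ((startU_mono hn hT (Nat.le_succ k)).trans hkt)
    have hr := periodU_regular (d := d) hn hT hlh D k
    have h2 : ∀ j ≤ (periodU m n d D k).grid,
        demandBefore D ((periodU m n d D k).time j) =
          demandBefore D' ((periodU m n d D k).time j) := by
      intro j hj
      refine h _ (timeU_mem_breakpoints D (by omega) hj) ?_
      refine (Period.time_mono hr.length_pos.le hj).trans ?_
      rwa [Period.time_grid hr.grid_pos, periodU_start, periodU_length, ← startU_succ]
    simp only [periodU]
    rw [← h1, Period.hatC_congr _ h2, Period.hatU_congr h2]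

lemma hat_congr {D D' : ℝ → ℕ} {t : ℝ}
    (h : ∀ b ∈ breakpoints m n d, b ≤ t → demandBefore D b = demandBefore D' b) {k : ℕ}
    (hk : k < periodsU n d) (hkt : startU m n d (k + 1) ≤ t) :
    ((periodU m n d D k).hatC (m.inventory / m.horizon) D =
      (periodU m n d D' k).hatC (m.inventory / m.horizon) D') ∧
    (periodU m n d D k).hatU D = (periodU m n d D' k).hatU D' ∧
    (periodU m n d D k).mesh = (periodU m n d D' k).mesh := by
  have h1 := periodU_congr hn hT hlh h hk ((startU_mono hn hT (Nat.le_succ k)).trans hkt)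
  have hr := periodU_regular (d := d) hn hT hlh D k
  have h2 : ∀ j ≤ (periodU m n d D k).grid,
      demandBefore D ((periodU m n d D k).time j) =
        demandBefore D' ((periodU m n d D k).time j) := by
    intro j hj
    refine h _ (timeU_mem_breakpoints D hk hj) ?_
    refine (Period.time_mono hr.length_pos.le hj).trans ?_
    rwa [Period.time_grid hr.grid_pos, periodU_start, periodU_length, ← startU_succ]
  rw [← h1, Period.hatC_congr _ h2, Period.hatU_congr h2]
  exact ⟨rfl, rfl, rfl⟩

lemma periodC_hat_congr {D D' : ℝ → ℕ} {t : ℝ}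
    (h : ∀ b ∈ breakpoints m n d, b ≤ t → demandBefore D b = demandBefore D' b) {i k : ℕ}
    (hi : i ≤ periodsU n d) (hk : k < periodsC n d) (hkt : startU m n d i + startC m n d (k + 1) ≤ t)
    (hp : periodC m n d (startU m n d i) D k = periodC m n d (startU m n d i) D' k) :
    (periodC m n d (startU m n d i) D k).hatC (m.inventory / m.horizon) D =
      (periodC m n d (startU m n d i) D' k).hatC (m.inventory / m.horizon) D' := by
  have hr := periodC_regular (d := d) hn hT hlh (startU m n d i) D k
  rw [← hp]
  refine Period.hatC_congr _ fun j hj => h _ (timeC_mem_breakpoints D hi hk hj) ?_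
  refine (Period.time_mono hr.length_pos.le hj).trans ?_
  rwa [Period.time_grid hr.grid_pos, periodC_start, periodC_length, add_assoc, ← startC_succ]

lemma periodC_congr {D D' : ℝ → ℕ} {t : ℝ}
    (h : ∀ b ∈ breakpoints m n d, b ≤ t → demandBefore D b = demandBefore D' b) {i k : ℕ}
    (hi : i ≤ periodsU n d) (hk : k < periodsC n d)
    (hkt : startU m n d i + startC m n d k ≤ t) :
    periodC m n d (startU m n d i) D k = periodC m n d (startU m n d i) D' k := by
  induction k with
  | zero => rfl
  | succ k ih =>
    have h1 := ih (by omega) (le_trans (by gcongr; exact startC_mono hn hT (Nat.le_succ k)) hkt)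
    simp only [periodC]
    rw [periodC_hat_congr hn hT hlh h hi (by omega) hkt h1, h1]

/-- This brings the algorithm under the theory of stepwise policies. The argument compares indices
period by period: every comparison of `t` with a time that matters is a comparison with a
breakpoint. -/
lemma isStepwise_uncensoredDpa : IsStepwise (uncensoredDpa m n d) (breakpoints m n d) where
  const := by
    intro D t t' ht htt' hB
    have key : ∀ b ∈ breakpoints m n d, t < b ↔ t' < b := by
      intro b hb
      refine ⟨fun h => ?_, fun h => htt'.trans_lt h⟩
      by_contra! hcon
      exact hB b hb ⟨h, hcon⟩
    have hcond : (∃ k < periodsU n d, startU m n d (k + 1) ≤ t ∧ transition m n d D k) ↔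
        (∃ k < periodsU n d, startU m n d (k + 1) ≤ t' ∧ transition m n d D k) := by
      refine exists_congr fun k => and_congr_right fun hk => and_congr_left fun _ => ?_
      have := key _ (startU_mem_breakpoints (m := m) (Nat.succ_le_of_lt hk))
      rw [← not_lt, ← not_lt, this]
    unfold uncensoredDpa
    by_cases h : ∃ k < periodsU n d, startU m n d (k + 1) ≤ t ∧ transition m n d D k
    · rw [if_pos h, if_pos (hcond.1 h)]
      obtain ⟨k, hk, hkt, htr⟩ := h
      have hi := (transitionIndex_spec ⟨k, hk, htr⟩).1
      have hik : transitionIndex m n d D ≤ k :=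
        Nat.sInf_le (s := {k : ℕ | k < periodsU n d ∧ transition m n d D k}) ⟨hk, htr⟩
      set i := transitionIndex m n d D + 1 with hidef
      have his : startU m n d i ≤ t := (startU_mono hn hT (by omega)).trans hkt
      unfold priceC
      have h1 := key _ (startC_mem_breakpoints (m := m) (i := i) hi (le_refl (periodsC n d)))
      simp only [← h1]
      split_ifs with h2
      · rw [← sInf_nat_congr (p := fun k => t < startU m n d i + startC m n d (k + 1))
          (q := fun k => t' < startU m n d i + startC m n d (k + 1))
          ⟨periodsC n d - 1, by have := periodsC_pos (n := n) (d := d); omega, by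
            rwa [Nat.sub_add_cancel periodsC_pos]⟩
          fun k hk => key _ (startC_mem_breakpoints hi (Nat.succ_le_of_lt hk))]
        obtain ⟨h3, h4, h5⟩ := stepIndex_spec (f := fun k => startU m n d i + startC m n d k)
          (by simpa [startC_zero] using his) h2
        refine Period.priceAt_congr (periodC_regular hn hT hlh _ D _).grid_pos ?_
          fun j hj => key _ (timeC_mem_breakpoints D hi h3 hj)
        rw [periodC_start, periodC_length, add_assoc, ← startC_succ]
        exact h5
      · rfl
    · rw [if_neg h, if_neg fun h' => h (hcond.2 h')]
      unfold priceU
      have h1 := key _ (startU_mem_breakpoints (m := m) (le_refl (periodsU n d)))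
      simp only [← h1]
      split_ifs with h2
      · rw [← sInf_nat_congr (p := fun k => t < startU m n d (k + 1))
          (q := fun k => t' < startU m n d (k + 1))
          ⟨periodsU n d - 1, by have := periodsU_pos (n := n) (d := d); omega, by
            rwa [Nat.sub_add_cancel periodsU_pos]⟩
          fun k hk => key _ (startU_mem_breakpoints (Nat.succ_le_of_lt hk))]
        obtain ⟨h3, h4, h5⟩ := stepIndex_spec (f := startU m n d) (by rwa [startU_zero]) h2
        refine Period.priceAt_congr (periodU_regular hn hT hlh D _).grid_pos ?_
          fun j hj => key _ (timeU_mem_breakpoints D h3 hj)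
        rwa [periodU_start, periodU_length, ← startU_succ]
      · rfl
  adapted := by
    intro D D' t h
    have htr : ∀ k < periodsU n d, startU m n d (k + 1) ≤ t →
        (transition m n d D k ↔ transition m n d D' k) := by
      intro k hk hkt
      obtain ⟨h1, h2, h3⟩ := hat_congr hn hT hlh h hk hkt
      simp only [transition, h1, h2, h3]
    have hcond : (∃ k < periodsU n d, startU m n d (k + 1) ≤ t ∧ transition m n d D k) ↔
        (∃ k < periodsU n d, startU m n d (k + 1) ≤ t ∧ transition m n d D' k) :=
      exists_congr fun k => and_congr_right fun hk => and_congr_right fun hkt => htr k hk hkt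
    unfold uncensoredDpa
    by_cases hc : ∃ k < periodsU n d, startU m n d (k + 1) ≤ t ∧ transition m n d D k
    · rw [if_pos hc, if_pos (hcond.1 hc)]
      obtain ⟨k, hk, hkt, hk'⟩ := hc
      -- Some transition has been observed by time `t`, so the first one is decided by periods that
      -- are over by then.
      have hidx : transitionIndex m n d D = transitionIndex m n d D' :=
        sInf_nat_congr (N := k + 1) ⟨k, Nat.lt_succ_self k, hk, hk'⟩ fun l hl =>
          and_congr_right fun hlN => htr l hlN ((startU_mono hn hT (by omega)).trans hkt)
      have hi := (transitionIndex_spec ⟨k, hk, hk'⟩).1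
      have hik : transitionIndex m n d D ≤ k :=
        Nat.sInf_le (s := {k : ℕ | k < periodsU n d ∧ transition m n d D k}) ⟨hk, hk'⟩
      rw [← hidx]
      set i := transitionIndex m n d D + 1 with hidef
      have his : startU m n d i ≤ t := (startU_mono hn hT (by omega)).trans hkt
      unfold priceC
      split_ifs with h2
      · obtain ⟨h3, h4, h5⟩ := stepIndex_spec (f := fun k => startU m n d i + startC m n d k)
          (by simpa [startC_zero] using his) h2
        rw [periodC_congr hn hT hlh h hi h3 h4]
      · unfold finalPriceC
        have hN := periodsC_pos (n := n) (d := d)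
        push Not at h2
        refine periodC_hat_congr hn hT hlh h hi (by omega) ?_ ?_
        · rwa [Nat.sub_add_cancel hN]
        · exact periodC_congr hn hT hlh h hi (by omega)
            (le_trans (by gcongr; exact startC_mono hn hT (Nat.sub_le _ _)) h2)
    · rw [if_neg hc, if_neg fun h' => hc (hcond.2 h')]
      unfold priceU
      split_ifs with h2
      · rcases lt_or_ge t 0 with h0 | h0
        · have : sInf {k | t < startU m n d (k + 1)} = 0 := by
            refine Nat.le_zero.1 (Nat.sInf_le ?_)
            exact h0.trans_le (by
              have := startU_mono (d := d) hn hT (Nat.zero_le 1)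
              rwa [startU_zero] at this)
          rw [this]
          rfl
        · obtain ⟨h3, h4, h5⟩ := stepIndex_spec (f := startU m n d) (by rwa [startU_zero]) h2
          rw [periodU_congr hn hT hlh h h3 h4]
      · unfold finalPriceU
        have hN := periodsU_pos (n := n) (d := d)
        push Not at h2
        obtain ⟨h3, h4, h5⟩ := hat_congr hn hT hlh h (k := periodsU n d - 1) (by omega)
          (by rwa [Nat.sub_add_cancel hN])
        simp only [h3, h4, h5]

end

/-! ### Poisson tails -/

/-- The probability is `1 - exp (-h) * (1 + h)`, and `exp (-h) ≥ 1 - h`. The quadratic order is what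
excludes double jumps. -/
lemma poissonMeasure_two_le (h : ℝ≥0) : (poissonMeasure h).real {k | 2 ≤ k} ≤ (h : ℝ) ^ 2 := by
  have h1 : ({k | 2 ≤ k} : Set ℕ) = ({0, 1} : Set ℕ)ᶜ := by
    ext k
    simp only [mem_ofPred_eq, mem_compl_iff, mem_insert_iff, mem_singleton_iff]
    omega
  have h2 : (poissonMeasure h).real ({0, 1} : Set ℕ) = Real.exp (-h) + Real.exp (-h) * h := by
    rw [← Set.singleton_union, measureReal_union (by simp) (by simp),
      poissonMeasure_real_singleton, poissonMeasure_real_singleton]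
    simp
  rw [h1, probReal_compl_eq_one_sub (by simp), h2]
  have h3 : (-h : ℝ) + 1 ≤ Real.exp (-h) := Real.add_one_le_exp _
  nlinarith [h.2]

lemma integrable_exp_poisson (r : ℝ≥0) (θ : ℝ) :
    Integrable (fun k : ℕ => Real.exp (θ * k)) (poissonMeasure r) ∧
    ∫ k : ℕ, Real.exp (θ * k) ∂poissonMeasure r = Real.exp (r * (Real.exp θ - 1)) := by
  have hterm : ∀ k : ℕ, (Real.exp (-r) * (r : ℝ) ^ k / (k.factorial : ℝ)) * Real.exp (θ * k) =
      Real.exp (-r) * ((r * Real.exp θ) ^ k / (k.factorial : ℝ)) := by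
    intro k
    rw [mul_pow, ← Real.exp_nat_mul, mul_comm (k : ℝ) θ]
    ring
  have hs : HasSum (fun k : ℕ => Real.exp (-r) * ((r * Real.exp θ) ^ k / (k.factorial : ℝ)))
      (Real.exp (-r) * Real.exp (r * Real.exp θ)) := by
    refine HasSum.mul_left _ ?_
    have := NormedSpace.expSeries_div_hasSum_exp (r * Real.exp θ : ℝ)
    rwa [← Real.exp_eq_exp_ℝ] at this
  constructor
  · rw [integrable_poissonMeasure_iff]
    refine hs.summable.congr fun k => ?_
    rw [← hterm, Real.norm_of_nonneg (Real.exp_pos _).le]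
  · rw [integral_poissonMeasure]
    simp only [smul_eq_mul, hterm]
    rw [hs.tsum_eq, ← Real.exp_add]
    congr 1
    ring

/-- Chernoff's bound with `θ = L / S`, where `S = √(L (r + L))`. Then `θ S = L`, `θ ≤ 1` and `r θ² ≤
L`, so `exp t - 1 ≤ t + t²` for `t = ±θ` leaves the exponent `-5 L + L = -4 L` in either direction.
-/
lemma poisson_tail (r : ℝ≥0) {L : ℝ} (hL : 0 < L) :
    (poissonMeasure r).real {k : ℕ | 5 * √(L * (r + L)) ≤ |(k : ℝ) - r|} ≤ 2 * Real.exp (-4 * L) := by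
  set S := √(L * (r + L)) with hS
  have hrL : 0 < (r : ℝ) + L := by have := r.2; positivity
  have hS0 : 0 < S := Real.sqrt_pos.2 (by positivity)
  have hS2 : S ^ 2 = L * (r + L) := Real.sq_sqrt (by positivity)
  set θ := L / S with hθ
  have hθ0 : 0 < θ := by positivity
  have hθS : θ * S = L := by rw [hθ]; field_simp
  have hLS : L ≤ S := by
    refine Real.le_sqrt_of_sq_le ?_
    nlinarith [r.2, mul_nonneg hL.le r.2]
  have hθ1 : θ ≤ 1 := by rw [hθ, div_le_one hS0]; exact hLS
  have hrθ : r * θ ^ 2 ≤ L := by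
    have : θ ^ 2 * (r + L) = L := by
      have h1 : (θ * S) ^ 2 = L ^ 2 := by rw [hθS]
      rw [mul_pow, hS2] at h1
      have : L * (θ ^ 2 * (r + L)) = L * L := by linarith
      exact mul_left_cancel₀ hL.ne' this
    nlinarith [sq_nonneg θ]
  have hmgf : ∀ t : ℝ, |t| ≤ 1 → t ^ 2 = θ ^ 2 → r * (Real.exp t - 1) ≤ r * t + L := by
    intro t ht ht2
    have h1 := (abs_le.1 (Real.abs_exp_sub_one_sub_id_le ht)).2
    have h2 : (r : ℝ) * (Real.exp t - 1) ≤ r * (t + t ^ 2) :=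
      mul_le_mul_of_nonneg_left (by linarith) r.2
    rw [ht2] at h2
    linarith
  have hup : (poissonMeasure r).real {k : ℕ | r + 5 * S ≤ (k : ℝ)} ≤ Real.exp (-4 * L) := by
    refine (measure_ge_le_exp_mul_mgf (X := fun k : ℕ => (k : ℝ)) _ hθ0.le
      (integrable_exp_poisson r θ).1).trans ?_
    rw [mgf, (integrable_exp_poisson r θ).2]
    calc _ ≤ Real.exp (-θ * (r + 5 * S)) * Real.exp (r * θ + L) := by
          gcongr
          exact hmgf θ (by rwa [abs_of_pos hθ0]) rfl
      _ = Real.exp (-4 * L) := by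
          rw [← Real.exp_add]
          congr 1
          linear_combination (-5) * hθS
  have hdown : (poissonMeasure r).real {k : ℕ | (k : ℝ) ≤ r - 5 * S} ≤ Real.exp (-4 * L) := by
    refine (measure_le_le_exp_mul_mgf (X := fun k : ℕ => (k : ℝ)) (t := -θ) _ (by linarith)
      (integrable_exp_poisson r (-θ)).1).trans ?_
    rw [mgf, (integrable_exp_poisson r (-θ)).2]
    calc _ ≤ Real.exp (-(-θ) * (r - 5 * S)) * Real.exp (r * (-θ) + L) := by
          gcongr
          exact hmgf (-θ) (by rwa [abs_neg, abs_of_pos hθ0]) (neg_sq θ)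
      _ = Real.exp (-4 * L) := by
          rw [← Real.exp_add]
          congr 1
          linear_combination (-5) * hθS
  calc _ ≤ (poissonMeasure r).real ({k : ℕ | r + 5 * S ≤ (k : ℝ)} ∪
        {k : ℕ | (k : ℝ) ≤ r - 5 * S}) := by
        refine measureReal_mono ?_
        intro k hk
        simp only [mem_ofPred_eq, mem_union] at hk ⊢
        rcases le_abs.1 hk with h | h
        · left; linarith
        · right; linarith
    _ ≤ _ := measureReal_union_le _ _
    _ ≤ _ := by linarith

/-! ### Paths of the Poisson process -/

section

variable {Ω : Type*} [MeasurableSpace Ω] {P : Measure Ω} {N : ℝ≥0 → Ω → ℕ}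

lemma IsUnitPoissonProcess.isProbabilityMeasure (hN : IsUnitPoissonProcess N P) :
    IsProbabilityMeasure P := by
  have h := hN.poisson 0 0 le_rfl
  have h1 : P.map (fun ω => N 0 ω - N 0 ω) univ = 1 := by rw [h.map_eq]; simp
  rw [Measure.map_apply_of_aemeasurable h.aemeasurable MeasurableSet.univ] at h1
  exact ⟨by simpa using h1⟩

lemma IsUnitPoissonProcess.real_eq (hN : IsUnitPoissonProcess N P) {s t : ℝ≥0} (hst : s ≤ t)
    (S : Set ℕ) : P.real {ω | N t ω - N s ω ∈ S} = (poissonMeasure (t - s)).real S := by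
  have h := hN.poisson s t hst
  rw [measureReal_def, measureReal_def, ← h.map_eq,
    Measure.map_apply_of_aemeasurable h.aemeasurable (by measurability)]
  rfl

/-- Almost surely, the Poisson process has only jumps of size one. -/
lemma IsUnitPoissonProcess.ae_jump (hN : IsUnitPoissonProcess N P) (A : ℝ≥0) :
    ∀ᵐ ω ∂P, ∀ u : ℝ≥0, 0 < u → u ≤ A → ∃ s < u, N u ω ≤ N s ω + 1 := by
  have := hN.isProbabilityMeasure
  rcases eq_zero_or_pos A with rfl | hA
  · exact Filter.Eventually.of_forall fun ω u hu hu' => absurd hu (not_lt.2 hu')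
  set bad : Set Ω := {ω | ¬∀ u : ℝ≥0, 0 < u → u ≤ A → ∃ s < u, N u ω ≤ N s ω + 1} with hbad
  -- Cut `[0, A]` into `M` equal pieces. A jump of size two or more forces an increment of at least
  -- two over its piece, and the union bound gives `M * (A / M)²`, which tends to 0.
  have key : ∀ M : ℕ, 0 < M → P.real bad ≤ (A : ℝ) ^ 2 / M := by
    intro M hM
    have hMR : (0 : ℝ) < M := by exact_mod_cast hM
    set g : ℕ → ℝ≥0 := fun i => i * A / M with hg
    have hgle : ∀ i, g i ≤ g (i + 1) := fun i => by simp only [hg]; gcongr; simp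
    have hsub : bad ⊆ ⋃ i ∈ Finset.range M, {ω | N (g (i + 1)) ω - N (g i) ω ∈ {k | 2 ≤ k}} := by
      intro ω hω
      simp only [hbad, mem_ofPred_eq] at hω
      push Not at hω
      obtain ⟨u, hu, huA, h⟩ := hω
      have hex : ∃ i, u ≤ g (i + 1) := ⟨M, huA.trans (by
        rw [← NNReal.coe_le_coe]
        simp only [hg]
        push_cast
        rw [le_div_iff₀ hMR]
        nlinarith [A.2])⟩
      classical
      set i := Nat.find hex with hi
      have hi1 : u ≤ g (i + 1) := Nat.find_spec hex
      have hi2 : g i < u := by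
        rcases Nat.eq_zero_or_eq_succ_pred i with h0 | h0
        · rw [h0]; simpa [hg] using hu
        · have := Nat.find_min hex (m := i.pred) (by omega)
          rw [h0]
          push Not at this
          exact this
      have hiM : i < M := by
        have h1 : g i < A := hi2.trans_le huA
        rw [← NNReal.coe_lt_coe] at h1
        simp only [hg] at h1
        push_cast at h1
        rw [div_lt_iff₀ hMR, mul_comm (A : ℝ)] at h1
        have := lt_of_mul_lt_mul_right h1 A.2
        exact_mod_cast this
      simp only [mem_iUnion, Finset.mem_range, mem_ofPred_eq]
      refine ⟨i, hiM, ?_⟩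
      have h1 := h _ hi2
      have h2 : N u ω ≤ N (g (i + 1)) ω := hN.monotone ω hi1
      omega
    calc P.real bad ≤ P.real (⋃ i ∈ Finset.range M,
          {ω | N (g (i + 1)) ω - N (g i) ω ∈ {k | 2 ≤ k}}) := measureReal_mono hsub (measure_ne_top _ _)
      _ ≤ ∑ i ∈ Finset.range M, P.real {ω | N (g (i + 1)) ω - N (g i) ω ∈ {k | 2 ≤ k}} :=
          measureReal_biUnion_finset_le _ _
      _ ≤ ∑ _i ∈ Finset.range M, ((A : ℝ) / M) ^ 2 := by
          refine Finset.sum_le_sum fun i _ => ?_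
          rw [hN.real_eq (hgle i)]
          refine (poissonMeasure_two_le _).trans (le_of_eq ?_)
          rw [NNReal.coe_sub (hgle i)]
          simp only [hg]
          push_cast
          congr 1
          field_simp
          ring
      _ = (A : ℝ) ^ 2 / M := by
          rw [Finset.sum_const, Finset.card_range, nsmul_eq_mul]
          field_simp
  have h0 : P.real bad ≤ 0 := by
    refine ge_of_tendsto' (f := fun M : ℕ => (A : ℝ) ^ 2 / ((M + 1 : ℕ) : ℝ)) (x := Filter.atTop)
      ?_ fun M => key (M + 1) (Nat.succ_pos M)
    exact (tendsto_const_div_atTop_nhds_zero_nat ((A : ℝ) ^ 2)).comp (Filter.tendsto_add_atTop_nat 1)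
  have h1 : P bad = 0 := by
    have := le_antisymm h0 measureReal_nonneg
    rwa [measureReal_eq_zero_iff] at this
  exact h1

/-- The event that the increments of the Poisson process between integer times up to `A` are close
to their means. -/
def concentrationEvent (N : ℝ≥0 → Ω → ℕ) (L : ℝ) (A : ℕ) : Set Ω :=
  {ω | ∀ j ≤ A, ∀ i ≤ j, |(N j ω : ℝ) - N i ω - (j - i)| < 5 * √(L * ((j - i) + L))}

lemma measurableSet_concentrationEvent (hN : IsUnitPoissonProcess N P) (L : ℝ) (A : ℕ) :
    MeasurableSet (concentrationEvent N L A) := by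
  have : concentrationEvent N L A = ⋂ j ∈ Finset.range (A + 1), ⋂ i ∈ Finset.range (j + 1),
      {ω | |(N j ω : ℝ) - N i ω - (j - i)| < 5 * √(L * ((j - i) + L))} := by
    ext ω
    simp [concentrationEvent]
  rw [this]
  refine Finset.measurableSet_biInter _ fun j _ => Finset.measurableSet_biInter _ fun i _ => ?_
  have hm : ∀ t, Measurable fun ω => (N t ω : ℝ) := fun t =>
    (measurable_of_countable (fun k : ℕ => (k : ℝ))).comp (hN.measurable t)
  exact measurableSet_lt ((((hm j).sub (hm i)).sub_const _).abs) measurable_const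

/-- A union bound over pairs of integers. For `L = log n` and `A` of order `n`, the bound is of
order `n^(-2)`. -/
lemma real_compl_concentrationEvent (hN : IsUnitPoissonProcess N P) {L : ℝ} (hL : 0 < L) (A : ℕ) :
    P.real (concentrationEvent N L A)ᶜ ≤ 2 * (A + 1) ^ 2 * Real.exp (-4 * L) := by
  have := hN.isProbabilityMeasure
  set F : ℕ → ℕ → Set Ω := fun j i =>
    {ω | N (j : ℝ≥0) ω - N (i : ℝ≥0) ω ∈
      {k : ℕ | 5 * √(L * (((j - i : ℝ≥0) : ℝ) + L)) ≤ |(k : ℝ) - ((j - i : ℝ≥0) : ℝ)|}} with hF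
  have hFle : ∀ j i, i ≤ j → P.real (F j i) ≤ 2 * Real.exp (-4 * L) := fun j i hij => by
    simp only [hF]
    rw [hN.real_eq (show (i : ℝ≥0) ≤ j by exact_mod_cast hij)]
    exact poisson_tail _ hL
  have hsub : (concentrationEvent N L A)ᶜ ⊆
      ⋃ j ∈ Finset.range (A + 1), ⋃ i ∈ Finset.range (j + 1), F j i := by
    intro ω hω
    simp only [concentrationEvent, mem_compl_iff, mem_ofPred_eq] at hω
    push Not at hω
    obtain ⟨j, hj, i, hi, h⟩ := hω
    simp only [mem_iUnion, Finset.mem_range, hF, mem_ofPred_eq]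
    refine ⟨j, by omega, i, by omega, ?_⟩
    have h1 : (i : ℝ≥0) ≤ j := by exact_mod_cast hi
    rw [NNReal.coe_sub h1, Nat.cast_sub (hN.monotone ω h1)]
    simpa using h
  have hin : ∀ j, P.real (⋃ i ∈ Finset.range (j + 1), F j i) ≤
      (j + 1) * (2 * Real.exp (-4 * L)) := fun j => by
    refine (measureReal_biUnion_finset_le _ _).trans ?_
    refine (Finset.sum_le_sum fun i hi => hFle j i ?_).trans (le_of_eq ?_)
    · have := Finset.mem_range.1 hi; omega
    · rw [Finset.sum_const, Finset.card_range, nsmul_eq_mul]; push_cast; ring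
  refine (measureReal_mono hsub (measure_ne_top _ _)).trans ((measureReal_biUnion_finset_le _ _).trans ?_)
  calc _ ≤ ∑ _j ∈ Finset.range (A + 1), ((A : ℝ) + 1) * (2 * Real.exp (-4 * L)) := by
        refine Finset.sum_le_sum fun j hj => (hin j).trans ?_
        have : (j : ℝ) ≤ A := by exact_mod_cast Nat.lt_succ_iff.1 (Finset.mem_range.1 hj)
        gcongr
    _ = _ := by
        rw [Finset.sum_const, Finset.card_range, nsmul_eq_mul]; push_cast; ring

/-- The bound for the deviation of an increment from its mean `y`. -/
noncomputable def noise (L y : ℝ) : ℝ := 5 * √(L * y) + 12 * L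

lemma noise_mono {L : ℝ} (hL : 0 ≤ L) : Monotone (noise L) := fun y z h => by
  unfold noise
  gcongr

/-- Monotone paths allow rounding to integer times: inwards for the lower bound, outwards for the
upper one. Rounding changes the length by at most 2; this and the extra `L` under the root cost `5 *
2 L + 2 ≤ 12 L`. If inward rounding leaves nothing, then `v - u < 1` and the bound is trivial. -/
lemma increment_bound (hN : IsUnitPoissonProcess N P) {L : ℝ} (hL : 1 ≤ L) {A : ℕ} {ω : Ω}
    (hω : ω ∈ concentrationEvent N L A) {u v : ℝ} (hu : 0 ≤ u) (huv : u ≤ v) (hv : v ≤ A) :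
    |(N v.toNNReal ω : ℝ) - N u.toNNReal ω - (v - u)| ≤ noise L (v - u) := by
  have hv0 : 0 ≤ v := hu.trans huv
  have hmon : ∀ {s t : ℝ≥0}, s ≤ t → (N s ω : ℝ) ≤ N t ω := fun h => by
    exact_mod_cast hN.monotone ω h
  have hL0 : 0 < L := by linarith
  have hsq : ∀ w, 0 ≤ w → w ≤ v - u + 2 → √(L * (w + L)) ≤ √(L * (v - u)) + 2 * L := by
    intro w hw hw2
    refine Real.sqrt_le_iff.2 ⟨by positivity, ?_⟩
    have h1 : √(L * (v - u)) ^ 2 = L * (v - u) := Real.sq_sqrt (mul_nonneg hL0.le (by linarith))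
    have h2 := Real.sqrt_nonneg (L * (v - u))
    nlinarith [mul_nonneg h2 hL0.le]
  unfold noise
  rw [abs_le]
  constructor
  · rcases le_or_gt ⌈u⌉₊ ⌊v⌋₊ with h | h
    · have h1 := (abs_lt.1 (hω ⌊v⌋₊ (Nat.floor_le_of_le hv) ⌈u⌉₊ h)).1
      have h2 := Nat.lt_floor_add_one v
      have h3 := Nat.ceil_lt_add_one hu
      have h4 := Nat.floor_le hv0
      have h5 := Nat.le_ceil u
      have h6 : (⌈u⌉₊ : ℝ) ≤ ⌊v⌋₊ := by exact_mod_cast h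
      have h7 := hsq ((⌊v⌋₊ : ℝ) - ⌈u⌉₊) (by linarith) (by linarith)
      have h8 := hmon (show ((⌊v⌋₊ : ℕ) : ℝ≥0) ≤ v.toNNReal by
        rw [Real.le_toNNReal_iff_coe_le hv0]; simpa using h4)
      have h9 := hmon (show u.toNNReal ≤ ((⌈u⌉₊ : ℕ) : ℝ≥0) by
        rw [Real.toNNReal_le_iff_le_coe]; simpa using h5)
      linarith
    · have h1 := hmon (Real.toNNReal_le_toNNReal huv)
      have h2 := Nat.lt_floor_add_one v
      have h3 := Nat.ceil_lt_add_one hu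
      have h6 : (⌊v⌋₊ : ℝ) + 1 ≤ ⌈u⌉₊ := by exact_mod_cast h
      have := Real.sqrt_nonneg (L * (v - u))
      linarith
  · have hceil : ⌈v⌉₊ ≤ A := Nat.ceil_le.2 hv
    have hfc : ⌊u⌋₊ ≤ ⌈v⌉₊ := (Nat.floor_le_ceil u).trans (Nat.ceil_mono huv)
    have h1 := (abs_lt.1 (hω ⌈v⌉₊ hceil ⌊u⌋₊ hfc)).2
    have h2 := Nat.lt_floor_add_one u
    have h3 := Nat.ceil_lt_add_one hv0
    have h4 := Nat.floor_le hu
    have h5 := Nat.le_ceil v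
    have h6 : (⌊u⌋₊ : ℝ) ≤ ⌈v⌉₊ := by exact_mod_cast hfc
    have h7 := hsq ((⌈v⌉₊ : ℝ) - ⌊u⌋₊) (by linarith) (by linarith)
    have h8 := hmon (show ((⌊u⌋₊ : ℕ) : ℝ≥0) ≤ u.toNNReal by
      rw [Real.le_toNNReal_iff_coe_le hu]; simpa using h4)
    have h9 := hmon (show v.toNNReal ≤ ((⌈v⌉₊ : ℕ) : ℝ≥0) by
      rw [Real.toNNReal_le_iff_le_coe]; simpa using h5)
    linarith

end

/-! ### Consequences of the assumptions on the demand function -/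

/-- Properties of the demand rate `lam p` and the revenue rate `p * lam p` as functions of the
price, with the unconstrained and the constrained optimal prices `pu` and `pc`. -/
structure PriceFacts (m : Market) (lam : ℝ → ℝ) (M K ε R growth curv bend pu pc : ℝ) : Prop where
  nonneg : ∀ p ∈ Icc m.lo m.hi, 0 ≤ lam p
  le_bound : ∀ p ∈ Icc m.lo m.hi, lam p ≤ M
  anti : StrictAntiOn lam (Icc m.lo m.hi)
  lip : ∀ p ∈ Icc m.lo m.hi, ∀ q ∈ Icc m.lo m.hi, |lam p - lam q| ≤ K * |p - q|
  inv_lip : ∀ p ∈ Icc m.lo m.hi, ∀ q ∈ Icc m.lo m.hi, |p - q| ≤ K * |lam p - lam q|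
  rev_lip : ∀ p ∈ Icc m.lo m.hi, ∀ q ∈ Icc m.lo m.hi, |p * lam p - q * lam q| ≤ K * |p - q|
  hi_le : m.hi ≤ R
  width_le : m.hi - m.lo ≤ K * M
  pu_mem : pu ∈ Icc m.lo m.hi
  pc_mem : pc ∈ Icc m.lo m.hi
  best_mem : max pu pc ∈ Icc (m.lo + ε) (m.hi - ε)
  le_opt : ∀ p ∈ Icc m.lo m.hi, p * lam p ≤ pu * lam pu
  growth_le : ∀ a ∈ Icc m.lo m.hi, ∀ p ∈ Icc a m.hi,
    growth * (p - max a pu) ^ 2 ≤ max a pu * lam (max a pu) - p * lam p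
  le_curv : m.lo < pu → ∀ p ∈ Icc m.lo m.hi, pu * lam pu - p * lam p ≤ curv * (p - pu) ^ 2
  pc_le : lam pc ≤ m.inventory / m.horizon
  pc_eq : m.lo < pc → lam pc = m.inventory / m.horizon
  slope : ∃ s, 0 ≤ s ∧ ∀ p ∈ Icc m.lo m.hi,
    lam p - lam (max pu pc) ≤ -s * (p - max pu pc) + bend * (p - max pu pc) ^ 2
  value_pos : ε ^ 2 / K ≤ max pu pc * lam (max pu pc)
  multiplier : ∃ s, 0 ≤ s ∧
    (∀ p ∈ Icc m.lo m.hi, p * lam p ≤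
      max pu pc * lam (max pu pc) + s * (lam p - m.inventory / m.horizon)) ∧
    0 ≤ max pu pc * lam (max pu pc) - s * (m.inventory / m.horizon)

lemma revenueRate_apply {m : Market} {lam : ℝ → ℝ} (h : StrictAntiOn lam (Icc m.lo m.hi)) {p : ℝ}
    (hp : p ∈ Icc m.lo m.hi) : revenueRate m lam (lam p) = p * lam p := by
  rw [revenueRate, inverseDemand, h.injOn.leftInvOn_invFunOn hp, mul_comm]

lemma inverseDemand_apply {m : Market} {lam : ℝ → ℝ} (h : StrictAntiOn lam (Icc m.lo m.hi)) {p : ℝ}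
    (hp : p ∈ Icc m.lo m.hi) : inverseDemand m lam (lam p) = p := by
  rw [inverseDemand, h.injOn.leftInvOn_invFunOn hp]

lemma demandRange_eq {m : Market} {lam : ℝ → ℝ} (hlh : m.lo ≤ m.hi)
    (h : StrictAntiOn lam (Icc m.lo m.hi)) (hc : ContinuousOn lam (Icc m.lo m.hi)) :
    demandRange m lam = Icc (lam m.hi) (lam m.lo) := by
  refine Subset.antisymm ?_ (intermediate_value_Icc' hlh hc)
  rintro _ ⟨p, hp, rfl⟩
  exact ⟨h.antitoneOn hp ⟨hlh, le_rfl⟩ hp.2, h.antitoneOn ⟨le_rfl, hlh⟩ hp hp.1⟩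

/-- Bounds on the second derivative give strong concavity and a convex majorant. -/
lemma quadratic_bounds {r : ℝ → ℝ} {D : Set ℝ} (hD : Convex ℝ D)
    (h1 : DifferentiableOn ℝ r D) (h2 : DifferentiableOn ℝ (derivWithin r D) D) {mL mU : ℝ}
    (h3 : ∀ l ∈ D, -mL ≤ derivWithin (derivWithin r D) D l ∧
      derivWithin (derivWithin r D) D l ≤ -mU) :
    ConcaveOn ℝ D (fun l => r l + mU / 2 * l ^ 2) ∧ ConvexOn ℝ D (fun l => r l + mL / 2 * l ^ 2) := by
  have hd : ∀ c : ℝ, ∀ x ∈ interior D,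
      HasDerivWithinAt (fun l => r l + c / 2 * l ^ 2) (derivWithin r D x + c * x) (interior D) x := by
    intro c x hx
    have hq : HasDerivWithinAt (fun l : ℝ => c / 2 * l ^ 2) (c * x) (interior D) x := by
      have := ((hasDerivAt_pow 2 x).const_mul (c / 2)).hasDerivWithinAt (s := interior D)
      refine this.congr_deriv ?_
      norm_num
      ring
    exact ((h1 x (interior_subset hx)).hasDerivWithinAt.mono interior_subset).add hq
  have hd2 : ∀ c : ℝ, ∀ x ∈ interior D,
      HasDerivWithinAt (fun l => derivWithin r D l + c * l)
        (derivWithin (derivWithin r D) D x + c) (interior D) x := by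
    intro c x hx
    have hq : HasDerivWithinAt (fun l : ℝ => c * l) c (interior D) x := by
      simpa using ((hasDerivAt_id x).const_mul c).hasDerivWithinAt (s := interior D)
    exact ((h2 x (interior_subset hx)).hasDerivWithinAt.mono interior_subset).add hq
  have hc : ∀ c : ℝ, ContinuousOn (fun l => r l + c / 2 * l ^ 2) D := fun c =>
    h1.continuousOn.add (by fun_prop)
  refine ⟨concaveOn_of_hasDerivWithinAt2_nonpos hD (hc _) (hd mU) (hd2 mU) fun x hx => ?_,
    convexOn_of_hasDerivWithinAt2_nonneg hD (hc _) (hd mL) (hd2 mL) fun x hx => ?_⟩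
  · linarith [(h3 x (interior_subset hx)).2]
  · linarith [(h3 x (interior_subset hx)).1]

lemma tangent_le {r : ℝ → ℝ} {D : Set ℝ} (hr : ConcaveOn ℝ D r) (hd : DifferentiableOn ℝ r D)
    {x y : ℝ} (hx : x ∈ D) (hy : y ∈ D) : r y ≤ r x + derivWithin r D x * (y - x) := by
  rcases lt_trichotomy x y with h | rfl | h
  · have := hr.slope_le_derivWithin hx hy h (hd x hx)
    rw [slope_def_field, div_le_iff₀ (by linarith)] at this
    linarith
  · simp
  · have := hr.derivWithin_le_slope hy hx h (hd x hx)
    rw [slope_def_field, le_div_iff₀ (by linarith)] at this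
    linarith

/-- Quadratic growth below a maximum over an interval (at an end or in the interior). -/
lemma growth_of_strongConcave {r : ℝ → ℝ} {D : Set ℝ} {mU : ℝ} (hmU : 0 < mU)
    (h : ConcaveOn ℝ D (fun l => r l + mU / 2 * l ^ 2)) {lu : ℝ} (hlu : lu ∈ D)
    (hmax : ∀ l ∈ D, r l ≤ r lu) {la lp : ℝ} (hla : la ∈ D) (hlp : lp ∈ D)
    (hcase : la = lu ∨ lp ≤ la ∧ la < lu) : mU / 4 * (lp - la) ^ 2 ≤ r la - r lp := by
  rcases hcase with rfl | ⟨h1, h2⟩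
  -- At the midpoint, strong concavity gains `mU / 8` times the squared distance over the average of
  -- the end values, while the maximum bounds the value from above.
  · have h3 := h.2 hlu hlp (show (0 : ℝ) ≤ 1 / 2 by norm_num) (show (0 : ℝ) ≤ 1 / 2 by norm_num)
      (by norm_num)
    have h4 := hmax _ (h.1 hlu hlp (show (0 : ℝ) ≤ 1 / 2 by norm_num)
      (show (0 : ℝ) ≤ 1 / 2 by norm_num) (by norm_num))
    simp only [smul_eq_mul] at h3 h4
    nlinarith
  · rcases h1.eq_or_lt with rfl | h1
    · simp
    have hpos : 0 < lu - lp := by linarith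
    -- Here `la` lies between `lp` and the maximizer `lu`, with weight `t` on `lu`. Strong concavity
    -- together with `r la ≤ r lu` gives the growth.
    set t := (la - lp) / (lu - lp) with ht
    have ht0 : 0 < t := div_pos (by linarith) hpos
    have ht1 : t < 1 := by rw [ht, div_lt_one hpos]; linarith
    have hta : t * (lu - lp) = la - lp := by rw [ht]; field_simp
    have h3 := h.2 hlp hlu (show 0 ≤ 1 - t by linarith) ht0.le (by ring)
    have h4 : (1 - t) • lp + t • lu = la := by simp only [smul_eq_mul]; linarith
    rw [h4] at h3
    simp only [smul_eq_mul] at h3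
    have h5 : (1 - t) * lp ^ 2 + t * lu ^ 2 - la ^ 2 = t * (1 - t) * (lu - lp) ^ 2 := by
      have : la = lp + t * (lu - lp) := by linarith
      rw [this]; ring
    have h6 := hmax la hla
    have h7 : (1 - t) * (r la - r lp) ≥ (1 - t) * (mU / 2 * (t * (lu - lp) ^ 2)) := by
      have : t * r la ≤ t * r lu := by gcongr
      nlinarith
    have h8 := le_of_mul_le_mul_left h7 (by linarith)
    have h9 : t * (lu - lp) ^ 2 ≥ (lp - la) ^ 2 := by
      have : t * (lu - lp) ^ 2 = (la - lp) * (lu - lp) := by rw [sq, ← mul_assoc, hta]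
      rw [this]
      nlinarith
    nlinarith

/-- Quadratic loss near a maximum in the interior. -/
lemma loss_of_convex {r : ℝ → ℝ} {l0 l1 mL : ℝ} (hmL : 0 < mL)
    (h : ConvexOn ℝ (Icc l0 l1) (fun l => r l + mL / 2 * l ^ 2)) {lu : ℝ} (hlu : lu ∈ Ioo l0 l1)
    (hmax : ∀ l ∈ Icc l0 l1, r l ≤ r lu) {lp : ℝ} (hlp : lp ∈ Icc l0 l1) :
    r lu - r lp ≤ mL * (lp - lu) ^ 2 := by
  have hW : 0 < l1 - l0 := by linarith [hlu.1, hlu.2]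
  set δ := min (lu - l0) (l1 - lu) with hδ
  have hδ0 : 0 < δ := lt_min (by linarith [hlu.1]) (by linarith [hlu.2])
  have hδl : δ ≤ lu - l0 := min_le_left _ _
  have hδr : δ ≤ l1 - lu := min_le_right _ _
  -- The point `lp` is reflected through `lu` and shrunk by `t` so as to stay in the range. Then
  -- `lu` is a convex combination of `lp` and the reflected point, where `r` is at most `r lu`; no
  -- derivative at the maximum is needed.
  set t := δ / (l1 - l0) with ht
  have ht0 : 0 < t := by positivity
  have ht1 : t ≤ 1 := by rw [ht, div_le_one hW]; linarith [hlu.2]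
  have htW : t * (l1 - l0) = δ := by rw [ht]; field_simp
  have habs : |t * (lp - lu)| ≤ δ := by
    rw [abs_mul, abs_of_pos ht0, ← htW]
    gcongr
    rw [abs_le]
    constructor <;> linarith [hlp.1, hlp.2, hlu.1, hlu.2]
  obtain ⟨ha1, ha2⟩ := abs_le.1 habs
  have hl' : lu - t * (lp - lu) ∈ Icc l0 l1 := ⟨by linarith, by linarith⟩
  have h1t : (0 : ℝ) < 1 + t := by linarith
  have h3 := h.2 hlp hl' (show 0 ≤ t / (1 + t) by positivity) (show 0 ≤ 1 / (1 + t) by positivity)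
    (by field_simp; ring)
  have h4 : (t / (1 + t)) • lp + (1 / (1 + t)) • (lu - t * (lp - lu)) = lu := by
    simp only [smul_eq_mul]; field_simp; ring
  rw [h4] at h3
  simp only [smul_eq_mul] at h3
  have h5 := hmax _ hl'
  have h6 : (1 + t) * (r lu + mL / 2 * lu ^ 2) ≤ t * (r lp + mL / 2 * lp ^ 2) +
      (r (lu - t * (lp - lu)) + mL / 2 * (lu - t * (lp - lu)) ^ 2) := by
    have := mul_le_mul_of_nonneg_left h3 h1t.le
    refine this.trans (le_of_eq ?_)
    field_simp
  have h7 : t * (r lu - r lp) ≤ t * (mL / 2 * (1 + t) * (lp - lu) ^ 2) := by nlinarith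
  have h8 := le_of_mul_le_mul_left h7 ht0
  have h9 : mL / 2 * (1 + t) * (lp - lu) ^ 2 ≤ mL * (lp - lu) ^ 2 := by
    gcongr
    nlinarith
  linarith

/-- If the rate missed the target on one side and the price could still move, a small move would
bring the rate nearer; the Lipschitz bound keeps it from overshooting. -/
lemma constrainedPrice_facts {m : Market} {lam : ℝ → ℝ} {K pc : ℝ} (hK : 0 < K)
    (hanti : StrictAntiOn lam (Icc m.lo m.hi))
    (hlip : ∀ p ∈ Icc m.lo m.hi, ∀ q ∈ Icc m.lo m.hi, |lam p - lam q| ≤ K * |p - q|)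
    (hpc : IsConstrainedPrice m lam pc) :
    (pc < m.hi → lam pc ≤ m.inventory / m.horizon) ∧
    (m.lo < pc → m.inventory / m.horizon ≤ lam pc) := by
  obtain ⟨hmem, hmin⟩ := hpc
  set c := m.inventory / m.horizon with hc
  constructor
  · intro hlt
    by_contra! hcon
    set q := min m.hi (pc + (lam pc - c) / K) with hq
    have hq1 : pc < q := lt_min hlt (by have := div_pos (sub_pos.2 hcon) hK; linarith)
    have hqm : q ∈ Icc m.lo m.hi := ⟨hmem.1.trans hq1.le, min_le_left _ _⟩
    have h1 := hanti hmem hqm hq1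
    have h2 := (abs_le.1 (hlip pc hmem q hqm)).2
    have h3 : K * |pc - q| ≤ lam pc - c := by
      rw [abs_of_neg (by linarith)]
      have : q - pc ≤ (lam pc - c) / K := by have := min_le_right m.hi (pc + (lam pc - c) / K); linarith
      rw [le_div_iff₀ hK] at this
      linarith
    have h4 : |lam pc - c| ≤ |lam q - c| := hmin hqm
    rw [abs_of_pos (by linarith), abs_of_nonneg (by linarith)] at h4
    linarith
  · intro hlt
    by_contra! hcon
    set q := max m.lo (pc - (c - lam pc) / K) with hq
    have hq1 : q < pc := max_lt hlt (by have := div_pos (sub_pos.2 hcon) hK; linarith)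
    have hqm : q ∈ Icc m.lo m.hi := ⟨le_max_left _ _, hq1.le.trans hmem.2⟩
    have h1 := hanti hqm hmem hq1
    have h2 := (abs_le.1 (hlip q hqm pc hmem)).2
    have h3 : K * |q - pc| ≤ c - lam pc := by
      rw [abs_of_neg (by linarith)]
      have : pc - q ≤ (c - lam pc) / K := by have := le_max_right m.lo (pc - (c - lam pc) / K); linarith
      rw [le_div_iff₀ hK] at this
      linarith
    have h4 : |lam pc - c| ≤ |lam q - c| := hmin hqm
    rw [abs_of_neg (by linarith), abs_of_nonpos (by linarith)] at h4
    linarith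

/-- Every constant produced here depends only on the constants of the assumptions and not on the
price interval, which is what makes the final bound uniform. Strong concavity and the quadratic loss
hold in the demand rate; the Lipschitz bounds for `lam` and its inverse carry them over to prices,
at the cost of factors `K²`. -/
theorem exists_priceFacts {m : Market} {lam : ℝ → ℝ} {M K mL mU ε : ℝ} (hK : 0 < K)
    (hmL : 0 < mL) (hmU : 0 < mU) (hε : 0 < ε) (hlo : 0 ≤ m.lo) (hlh : m.lo < m.hi)
    (hA : AssumptionA m M K mL mU lam) (hB : AssumptionB m ε lam) :
    ∃ pu pc, PriceFacts m lam M K ε (K * (K + M)) (mU / (4 * K ^ 2)) (mL * K ^ 2) (2 * K ^ 3 / ε)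
      pu pc := by
  obtain ⟨pu, pc, ⟨hpu, hpumax⟩, hpc, hbest⟩ := hB
  have hanti := hA.regular.strictAnti
  have hlom : m.lo ∈ Icc m.lo m.hi := ⟨le_rfl, hlh.le⟩
  have hhim : m.hi ∈ Icc m.lo m.hi := ⟨hlh.le, le_rfl⟩
  have hcont : ContinuousOn lam (Icc m.lo m.hi) := by
    have : LipschitzOnWith K.toNNReal lam (Icc m.lo m.hi) :=
      LipschitzOnWith.of_dist_le_mul fun p hp q hq => by
        rw [Real.dist_eq, Real.dist_eq, Real.coe_toNNReal _ hK.le]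
        exact hA.lipschitz_demand p hp q hq
    exact this.continuousOn
  have hrange := demandRange_eq hlh.le hanti hcont
  have hmemR : ∀ p ∈ Icc m.lo m.hi, lam p ∈ demandRange m lam := fun p hp => ⟨p, hp, rfl⟩
  have hconvR : Convex ℝ (demandRange m lam) := hrange ▸ convex_Icc _ _
  have hrev : ∀ p ∈ Icc m.lo m.hi, revenueRate m lam (lam p) = p * lam p := fun p hp =>
    revenueRate_apply hanti hp
  obtain ⟨hconc, hconv⟩ := quadratic_bounds hconvR hA.differentiable hA.differentiable_deriv
    hA.second_deriv
  have hnn := hA.regular.nonneg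
  have hleM : ∀ p ∈ Icc m.lo m.hi, lam p ≤ M := fun p hp =>
    (le_abs_self _).trans (hA.bounded p hp)
  have hlip := hA.lipschitz_demand
  have hinv : ∀ p ∈ Icc m.lo m.hi, ∀ q ∈ Icc m.lo m.hi, |p - q| ≤ K * |lam p - lam q| := by
    intro p hp q hq
    have := hA.lipschitz_inverse _ (hmemR p hp) _ (hmemR q hq)
    rwa [inverseDemand_apply hanti hp, inverseDemand_apply hanti hq] at this
  have hrlip : ∀ p ∈ Icc m.lo m.hi, ∀ q ∈ Icc m.lo m.hi,
      |p * lam p - q * lam q| ≤ K * |p - q| := by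
    intro p hp q hq
    rw [← hrev p hp, ← hrev q hq]
    exact hA.lipschitz_revenue p hp q hq
  have hopt : ∀ p ∈ Icc m.lo m.hi, p * lam p ≤ pu * lam pu := by
    intro p hp
    rw [← hrev p hp, ← hrev pu hpu]
    exact hpumax hp
  have hmaxR : ∀ l ∈ demandRange m lam, revenueRate m lam l ≤ revenueRate m lam (lam pu) := by
    rintro _ ⟨p, hp, rfl⟩
    exact hpumax hp
  -- the best price
  set pD := max pu pc with hpD
  have hpDm : pD ∈ Icc m.lo m.hi := ⟨by linarith [hbest.1], by linarith [hbest.2]⟩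
  have hpDhi : pD < m.hi := by linarith [hbest.2]
  obtain ⟨hc1, hc2⟩ := constrainedPrice_facts hK hanti hlip hpc
  have hpcle := hc1 ((le_max_right pu pc).trans_lt hpDhi)
  have hpceq : m.lo < pc → lam pc = m.inventory / m.horizon := fun h => le_antisymm hpcle (hc2 h)
  set l0 := lam pD with hl0
  -- The best price is at least `ε` below `hi`, so the inverse Lipschitz bound keeps the demand rate
  -- there away from 0.
  have hl0ge : ε / K ≤ l0 := by
    have h1 := hinv m.hi hhim pD hpDm
    have h2 := hanti hpDm hhim hpDhi
    rw [abs_of_pos (by linarith), abs_of_neg (by linarith)] at h1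
    have h3 : ε ≤ K * l0 := by nlinarith [hbest.2, hnn m.hi hhim]
    rw [div_le_iff₀ hK]
    linarith
  have hl0pos : 0 < l0 := lt_of_lt_of_le (by positivity) hl0ge
  -- the tangent to the revenue rate at the best price
  set s0 := derivWithin (revenueRate m lam) (demandRange m lam) l0 with hs0
  have htan : ∀ p ∈ Icc m.lo m.hi, p * lam p ≤ pD * l0 + s0 * (lam p - l0) := by
    intro p hp
    have := tangent_le hA.regular.concave hA.differentiable (hmemR pD hpDm) (hmemR p hp)
    rwa [hrev p hp, hrev pD hpDm] at this
  -- A finite-difference form of `γ - r' = -l γ'(l) ≥ l / K`, up to the factor 2. The tangent is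
  -- tested at a price `q` slightly above `pD`, near enough that `lam q ≥ l0 / 2`; it yields `(q -
  -- pD) * lam q ≤ (pD - s0) * (l0 - lam q)`.
  have hs0le : l0 / (2 * K) ≤ pD - s0 := by
    set q := min (pD + l0 / (2 * K)) m.hi with hq
    have hpos : 0 < l0 / (2 * K) := by positivity
    have hq1 : pD < q := lt_min (by linarith) hpDhi
    have hqm : q ∈ Icc m.lo m.hi := ⟨hpDm.1.trans hq1.le, min_le_right _ _⟩
    have h1 := hanti hpDm hqm hq1
    have h2 : q - pD ≤ K * (l0 - lam q) := by
      have h := hinv q hqm pD hpDm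
      rw [abs_of_pos (sub_pos.2 hq1), abs_of_neg (sub_neg.2 h1)] at h
      rw [hl0]
      linarith
    have h3 : l0 - lam q ≤ K * (q - pD) := by
      have h := hlip q hqm pD hpDm
      rw [abs_of_pos (sub_pos.2 hq1), abs_of_neg (sub_neg.2 h1)] at h
      rw [hl0]
      linarith
    have h4 : q - pD ≤ l0 / (2 * K) := by have := min_le_left (pD + l0 / (2 * K)) m.hi; linarith
    have h5 : K * (q - pD) ≤ l0 / 2 := by
      calc K * (q - pD) ≤ K * (l0 / (2 * K)) := by gcongr
        _ = l0 / 2 := by field_simp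
    have h6 := htan q hqm
    have h7 : 0 < l0 - lam q := by linarith
    have h8 : (l0 - lam q) / K ≤ q - pD := by rw [div_le_iff₀ hK]; linarith
    have h9 : (l0 - lam q) / K * (l0 / 2) ≤ (q - pD) * lam q := by
      gcongr
      · linarith
    have h10 : (l0 - lam q) * (l0 / (2 * K)) ≤ (l0 - lam q) * (pD - s0) := by
      have : (l0 - lam q) / K * (l0 / 2) = (l0 - lam q) * (l0 / (2 * K)) := by field_simp
      nlinarith
    exact le_of_mul_le_mul_left h10 h7
  have hgap : 0 < pD - s0 := lt_of_lt_of_le (by positivity) hs0le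
  refine ⟨pu, pc, ⟨hnn, hleM, hanti, hlip, hinv, hrlip, ?_, ?_, hpu, hpc.1, hbest, hopt, ?_, ?_,
    hpcle, hpceq, ?_, ?_, ?_⟩⟩
  -- The Lipschitz bound for the revenue gives `hi * (lam lo - lam hi) ≤ (K + M) * (hi - lo)`, and
  -- `hi - lo ≤ K * (lam lo - lam hi)`; together they bound `hi` itself.
  · have h1 := (abs_le.1 (hrlip m.hi hhim m.lo hlom)).1
    have h2 := hinv m.hi hhim m.lo hlom
    have h3 := hanti hlom hhim hlh
    rw [abs_of_pos (by linarith)] at h1 h2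
    rw [abs_of_neg (by linarith)] at h2
    have h4 := hleM m.lo hlom
    have h5 : 0 < m.hi - m.lo := by linarith
    have h6 : m.hi * (lam m.lo - lam m.hi) ≤ (K + M) * (m.hi - m.lo) := by nlinarith
    have h7 : m.hi * (m.hi - m.lo) ≤ K * (K + M) * (m.hi - m.lo) := by
      calc m.hi * (m.hi - m.lo) ≤ m.hi * (K * (lam m.lo - lam m.hi)) := by
            gcongr
            · linarith
            · linarith
        _ = K * (m.hi * (lam m.lo - lam m.hi)) := by ring
        _ ≤ K * ((K + M) * (m.hi - m.lo)) := by gcongr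
        _ = _ := by ring
    exact le_of_mul_le_mul_right h7 h5
  · have h2 := hinv m.hi hhim m.lo hlom
    have h3 := hanti hlom hhim hlh
    rw [abs_of_pos (by linarith), abs_of_neg (by linarith)] at h2
    have h4 := hleM m.lo hlom
    have h5 := hnn m.hi hhim
    nlinarith
  · intro a ha p hp
    have hpm : p ∈ Icc m.lo m.hi := ⟨ha.1.trans hp.1, hp.2⟩
    have ham : max a pu ∈ Icc m.lo m.hi := ⟨ha.1.trans (le_max_left _ _), max_le ha.2 hpu.2⟩
    have h1 := growth_of_strongConcave hmU hconc (hmemR pu hpu) hmaxR (hmemR _ ham) (hmemR p hpm) (by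
      rcases le_or_gt a pu with h | h
      · left; rw [max_eq_right h]
      · right
        rw [max_eq_left h.le]
        exact ⟨hanti.antitoneOn ha hpm hp.1, hanti hpu ha h⟩)
    rw [hrev _ ham, hrev p hpm] at h1
    refine le_trans ?_ h1
    have h2 := hinv p hpm _ ham
    have h3 : (p - max a pu) ^ 2 ≤ K ^ 2 * (lam p - lam (max a pu)) ^ 2 := by
      rw [← mul_pow, ← sq_abs (p - max a pu), ← sq_abs (K * _), abs_mul, abs_of_pos hK]
      gcongr
    calc mU / (4 * K ^ 2) * (p - max a pu) ^ 2 ≤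
          mU / (4 * K ^ 2) * (K ^ 2 * (lam p - lam (max a pu)) ^ 2) := by gcongr
      _ = _ := by field_simp
  · intro hlt p hp
    have hpuhi : pu < m.hi := (le_max_left pu pc).trans_lt hpDhi
    rw [hrange] at hconv hmaxR
    have h1 := loss_of_convex hmL hconv (lu := lam pu) ⟨hanti hpu hhim hpuhi, hanti hlom hpu hlt⟩
      hmaxR (hrange ▸ hmemR p hp)
    rw [hrev pu hpu, hrev p hp] at h1
    refine h1.trans ?_
    have h3 : (lam p - lam pu) ^ 2 ≤ K ^ 2 * (p - pu) ^ 2 := by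
      rw [← mul_pow, ← sq_abs (lam p - lam pu), ← sq_abs (K * _), abs_mul, abs_of_pos hK]
      gcongr
      exact hlip p hp pu hpu
    calc mL * (lam p - lam pu) ^ 2 ≤ mL * (K ^ 2 * (p - pu) ^ 2) := by gcongr
      _ = _ := by ring
  -- Expanding the tangent inequality in `p - pD` and `lam p - l0` leaves the product of the two as
  -- a remainder, which is quadratic in `p - pD`. Division by the gap `pD - s0 ≥ ε / (2 K²)` gives
  -- `bend`.
  · refine ⟨l0 / (pD - s0), by positivity, fun p hp => ?_⟩
    have h1 := htan p hp
    have h2 : -((p - pD) * (lam p - l0)) ≤ K * (p - pD) ^ 2 := by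
      calc -((p - pD) * (lam p - l0)) ≤ |(p - pD) * (lam p - l0)| := neg_le_abs _
        _ = |p - pD| * |lam p - l0| := abs_mul _ _
        _ ≤ |p - pD| * (K * |p - pD|) := by gcongr; exact hlip p hp pD hpDm
        _ = K * (p - pD) ^ 2 := by rw [← sq_abs (p - pD)]; ring
    have h3 : (pD - s0) * (lam p - l0) ≤ -(p - pD) * l0 + K * (p - pD) ^ 2 := by nlinarith
    have h4 : lam p - l0 ≤ (-(p - pD) * l0 + K * (p - pD) ^ 2) / (pD - s0) := by
      rw [le_div_iff₀ hgap]; linarith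
    refine h4.trans ?_
    have h5 : K / (pD - s0) ≤ 2 * K ^ 3 / ε := by
      rw [div_le_div_iff₀ hgap hε]
      have h6 : ε / K / (2 * K) ≤ pD - s0 := le_trans (by gcongr) hs0le
      have h7 : ε ≤ (pD - s0) * (2 * K ^ 2) := by
        rw [div_div, div_le_iff₀ (by positivity)] at h6
        linarith
      nlinarith
    calc (-(p - pD) * l0 + K * (p - pD) ^ 2) / (pD - s0)
        = -(l0 / (pD - s0)) * (p - pD) + K / (pD - s0) * (p - pD) ^ 2 := by field_simp
      _ ≤ _ := by gcongr
  · have h1 : ε ≤ pD := by linarith [hbest.1]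
    calc ε ^ 2 / K = ε * (ε / K) := by ring
      _ ≤ pD * l0 := mul_le_mul h1 hl0ge (by positivity) (hlo.trans hpDm.1)
  -- If `pc ≤ pu` the capacity constraint has multiplier 0. Otherwise the multiplier is the slope
  -- `s0` of the tangent, which is nonnegative because `pu` has both a higher demand rate and at
  -- least as high a revenue rate.
  · rcases le_or_gt pc pu with h | h
    · refine ⟨0, le_rfl, fun p hp => ?_, ?_⟩
      · have := hopt p hp
        rw [max_eq_left h]
        linarith
      · have : 0 ≤ pD * l0 := mul_nonneg (hlo.trans hpDm.1) hl0pos.le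
        linarith
    · have hpDc : pD = pc := max_eq_right h.le
      have hl0c : l0 = m.inventory / m.horizon := by
        rw [hl0, hpDc]
        exact hpceq (hpu.1.trans_lt h)
      refine ⟨s0, ?_, fun p hp => ?_, ?_⟩
      · have h1 := htan pu hpu
        have h2 := hopt pD hpDm
        have h3 : l0 < lam pu := hanti hpu hpDm (by rw [hpDc]; exact h)
        by_contra! hcon
        nlinarith
      · rw [← hl0c]; exact htan p hp
      · rw [← hl0c]
        nlinarith

namespace PriceFacts

variable {m : Market} {lam : ℝ → ℝ} {M K ε R growth curv bend pu pc : ℝ}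

lemma best_mem_Icc (h : PriceFacts m lam M K ε R growth curv bend pu pc) :
    max pu pc ∈ Icc m.lo m.hi :=
  ⟨h.pu_mem.1.trans (le_max_left _ _), max_le h.pu_mem.2 h.pc_mem.2⟩

lemma lam_best_le (h : PriceFacts m lam M K ε R growth curv bend pu pc) :
    lam (max pu pc) ≤ m.inventory / m.horizon :=
  (h.anti.antitoneOn h.pc_mem h.best_mem_Icc (le_max_right _ _)).trans h.pc_le

lemma continuousOn (h : PriceFacts m lam M K ε R growth curv bend pu pc) (hK : 0 ≤ K) :
    ContinuousOn lam (Icc m.lo m.hi) := by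
  have : LipschitzOnWith K.toNNReal lam (Icc m.lo m.hi) :=
    LipschitzOnWith.of_dist_le_mul fun p hp q hq => by
      rw [Real.dist_eq, Real.dist_eq, Real.coe_toNNReal _ hK]
      exact h.lip p hp q hq
  exact this.continuousOn

/-- The demand rate along a measurable feasible price path is integrable. -/
lemma integrable_rate (h : PriceFacts m lam M K ε R growth curv bend pu pc) (hK : 0 ≤ K)
    (hlh : m.lo ≤ m.hi) (hcut : lam m.cut = 0) (hT : 0 ≤ m.horizon) {p : ℝ → ℝ}
    (hp : Measurable p) (hf : ∀ s ∈ Icc 0 m.horizon, p s ∈ m.feasible) :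
    IntervalIntegrable (fun s => lam (p s)) volume 0 m.horizon := by
  classical
  -- Nothing is known about `lam` at infeasible prices, so it is replaced by a Borel function that
  -- agrees with it at feasible ones.
  set g : ℝ → ℝ := fun q => if q = m.cut then 0 else
    IccExtend hlh (domRestrict (Icc m.lo m.hi) lam) q with hg
  have hgm : Measurable g := Measurable.ite (measurableSet_eq) measurable_const
    (continuousOn_iff_continuous_domRestrict.1 (h.continuousOn hK)).Icc_extend'.measurable
  have heq : ∀ s ∈ Ioo 0 m.horizon, lam (p s) = g (p s) := by
    intro s hs
    rcases hf s ⟨hs.1.le, hs.2.le⟩ with h1 | h1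
    · by_cases hc : p s = m.cut
      · simp [hg, hc, hcut]
      · simp only [hg, if_neg hc]
        rw [IccExtend_of_mem _ _ h1]
        rfl
    · have hc : p s = m.cut := h1
      simp [hg, hc, hcut]
  refine (intervalIntegral_congr_Ioo hT heq ?_).1
  rw [intervalIntegrable_iff, uIoc_of_le hT]
  refine Measure.integrableOn_of_bounded (M := |M|) (by simp)
    (hgm.comp hp).aestronglyMeasurable (Filter.Eventually.of_forall fun s => ?_)
  simp only [hg]
  split_ifs
  · simp
  · have hmem : (projIcc m.lo m.hi hlh (p s) : ℝ) ∈ Icc m.lo m.hi := (projIcc m.lo m.hi hlh (p s)).2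
    have h1 := h.nonneg _ hmem
    have h2 := h.le_bound _ hmem
    change ‖lam (projIcc m.lo m.hi hlh (p s) : ℝ)‖ ≤ |M|
    rw [Real.norm_eq_abs, abs_of_nonneg h1]
    exact h2.trans (le_abs_self M)

/-- Weak duality: the multiplier bounds the revenue rate pointwise, and integration uses up the
capacity constraint. The last clause of `multiplier` covers the cut-off price. The constant price
`max pu pc` attains the bound. -/
theorem deterministicValue_scale (h : PriceFacts m lam M K ε R growth curv bend pu pc)
    (hK : 0 < K) (hlh : m.lo ≤ m.hi) (hcut : lam m.cut = 0) (hT : 0 < m.horizon)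
    (hx : 0 ≤ m.inventory) {n : ℕ} (hn : 0 < n) :
    deterministicValue (m.scale n) (scaleDemand n lam) =
      n * (m.horizon * (max pu pc * lam (max pu pc))) := by
  have hnR : (0 : ℝ) < n := by exact_mod_cast hn
  set T := m.horizon with hTdef
  set V := max pu pc * lam (max pu pc) with hV
  have hV0 : 0 ≤ V := le_trans (by positivity) h.value_pos
  have hub : ∀ v ∈ {v : ℝ | ∃ p : ℝ → ℝ, Measurable p ∧
      (∀ s ∈ Icc 0 (m.scale n).horizon, p s ∈ (m.scale n).feasible) ∧
      ∫ s in (0 : ℝ)..(m.scale n).horizon, scaleDemand n lam (p s) ≤ (m.scale n).inventory ∧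
      v = ∫ s in (0 : ℝ)..(m.scale n).horizon, p s * scaleDemand n lam (p s)}, v ≤ n * (T * V) := by
    rintro v ⟨p, hp, hfeas, hcon, rfl⟩
    have hint := h.integrable_rate hK.le hlh hcut hT.le hp hfeas
    change ∫ s in (0 : ℝ)..T, n * lam (p s) ≤ n * m.inventory at hcon
    rw [intervalIntegral.integral_const_mul] at hcon
    have hcon' := le_of_mul_le_mul_left hcon hnR
    have hre : ∀ s, p s * scaleDemand n lam (p s) = n * (p s * lam (p s)) := fun s => by
      simp only [scaleDemand]; ring
    simp only [hre]
    change ∫ s in (0 : ℝ)..T, n * (p s * lam (p s)) ≤ _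
    rw [intervalIntegral.integral_const_mul]
    refine mul_le_mul_of_nonneg_left ?_ hnR.le
    -- A path whose revenue rate is not integrable contributes the default value 0.
    by_cases hi : IntervalIntegrable (fun s => p s * lam (p s)) volume 0 T
    swap
    · rw [intervalIntegral.integral_undef hi]
      positivity
    obtain ⟨s0, hs0, hm1, hm2⟩ := h.multiplier
    have hpt : ∀ s ∈ Icc 0 T, p s * lam (p s) ≤ V + s0 * (lam (p s) - m.inventory / T) := by
      intro s hs
      rcases hfeas s hs with h1 | h1
      · exact hm1 _ h1
      · have hc : p s = m.cut := h1
        rw [hc, hcut]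
        linarith
    have hint2 : IntervalIntegrable (fun s => V + s0 * (lam (p s) - m.inventory / T)) volume 0 T :=
      intervalIntegrable_const.add ((hint.sub intervalIntegrable_const).const_mul s0)
    refine (intervalIntegral.integral_mono_on hT.le hi hint2 hpt).trans ?_
    rw [intervalIntegral.integral_add intervalIntegrable_const
      ((hint.sub intervalIntegrable_const).const_mul s0), intervalIntegral.integral_const_mul s0,
      intervalIntegral.integral_sub hint intervalIntegrable_const]
    simp only [intervalIntegral.integral_const, smul_eq_mul, sub_zero]
    have h3 : T * (m.inventory / T) = m.inventory := by field_simp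
    rw [h3]
    nlinarith
  refine le_antisymm (csSup_le ⟨0, ?_⟩ hub) (le_csSup ⟨n * (T * V), hub⟩ ?_)
  · refine ⟨fun _ => m.cut, measurable_const, fun s _ => Or.inr rfl, ?_, ?_⟩
    · simpa [scaleDemand, hcut, Market.scale] using mul_nonneg hnR.le hx
    · simp [scaleDemand, hcut]
  · refine ⟨fun _ => max pu pc, measurable_const, fun s _ => Or.inl h.best_mem_Icc, ?_, ?_⟩
    · simp only [intervalIntegral.integral_const, smul_eq_mul, sub_zero, scaleDemand, Market.scale]
      have h1 := h.lam_best_le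
      rw [le_div_iff₀ hT] at h1
      calc T * (n * lam (max pu pc)) = n * (lam (max pu pc) * T) := by ring
        _ ≤ n * m.inventory := by gcongr
    · simp only [intervalIntegral.integral_const, smul_eq_mul, sub_zero, scaleDemand, Market.scale, hV]
      ring

end PriceFacts

/-! ### Paths on which the demand is close to its intensity -/

/-- The demand path `D` under the policy `q` and its cumulative intensity `G` for the demand
function `n * lam`, such that the increments of the demand are close to those of `G`. -/
structure GoodPath (q : Policy) (lam : ℝ → ℝ) (n M L T : ℝ) (D : ℝ → ℕ) (G : ℝ → ℝ) : Prop where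
  mono : Monotone D
  intensity : ∀ t ∈ Icc 0 T, IntervalIntegrable (fun s => n * lam (q D s)) volume 0 t ∧
    G t = ∫ s in (0 : ℝ)..t, n * lam (q D s)
  close : ∀ u v, 0 ≤ u → u ≤ v → v ≤ T →
    |(demandBefore D v : ℝ) - demandBefore D u - (G v - G u)| ≤ noise L (n * M * (v - u))

/-- Increments of the demand strictly before given times are limits of increments of the demand. -/
lemma demandBefore_close {D : ℝ → ℕ} {G : ℝ → ℝ} {L A T : ℝ} (hL : 0 ≤ L) (hA : 0 ≤ A)
    (hD : Monotone D) (hD0 : D 0 = 0)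
    (hG : ∀ u v, 0 ≤ u → u ≤ v → v ≤ T → 0 ≤ G v - G u ∧ G v - G u ≤ A * (v - u))
    (h : ∀ u v, 0 ≤ u → u ≤ v → v ≤ T → |(D v : ℝ) - D u - (G v - G u)| ≤ noise L (G v - G u))
    {u v : ℝ} (hu : 0 ≤ u) (huv : u ≤ v) (hv : v ≤ T) :
    |(demandBefore D v : ℝ) - demandBefore D u - (G v - G u)| ≤ noise L (A * (v - u)) := by
  have hnn : ∀ y, 0 ≤ noise L y := fun y => by unfold noise; positivity
  rcases huv.eq_or_lt with rfl | huv'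
  · simpa using hnn _
  have hv0 : 0 < v := hu.trans_lt huv'
  obtain ⟨s1, hs1, hs1'⟩ := exists_demandBefore_eq (hD.monotoneOn _) hv0
  refine le_of_forall_pos_le_add fun η hη => ?_
  obtain ⟨δ, hδ, hδη⟩ : ∃ δ, 0 < δ ∧ 2 * (A * δ) ≤ η := by
    refine ⟨η / (2 * (A + 1)), by positivity, ?_⟩
    have : 2 * (A * (η / (2 * (A + 1)))) = η * (A / (A + 1)) := by field_simp
    rw [this]
    have h1 : A / (A + 1) ≤ 1 := by rw [div_le_one (by linarith)]; linarith
    nlinarith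
  -- Times slightly before `u` and `v` at which the left limits are attained, chosen with `s' - s ≤
  -- v - u` so that the noise term does not grow. For `u = 0` there is no earlier time, and `D 0 =
  -- 0` is used.
  obtain ⟨s, hs0, hsu, hsδ, hDs, hss1⟩ : ∃ s, 0 ≤ s ∧ s ≤ u ∧ u - s ≤ δ ∧ D s = demandBefore D u ∧
      ∃ s', s1 ≤ s' ∧ s' < v ∧ v - s' ≤ δ ∧ s ≤ s' ∧ s' - s ≤ v - u := by
    rcases hu.eq_or_lt with rfl | hu0
    · refine ⟨0, le_rfl, le_rfl, by linarith, by rw [demandBefore_zero, hD0], max s1 (v - δ), le_max_left _ _,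
        max_lt hs1.2 (by linarith), ?_, hs1.1.trans (le_max_left _ _), ?_⟩
      · have := le_max_right s1 (v - δ); linarith
      · have := max_lt hs1.2 (show v - δ < v by linarith); linarith
    · obtain ⟨s2, hs2, hs2'⟩ := exists_demandBefore_eq (hD.monotoneOn _) hu0
      set s := max s2 (max (u - δ) (s1 - (v - u))) with hs
      have h1 : s < u := max_lt hs2.2 (max_lt (by linarith) (by linarith [hs1.2]))
      have h2 : s2 ≤ s := le_max_left _ _
      have h3 : u - δ ≤ s := (le_max_left _ _).trans (le_max_right _ _)
      have h4 : s1 - (v - u) ≤ s := (le_max_right _ _).trans (le_max_right _ _)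
      exact ⟨s, hs2.1.trans h2, h1.le, by linarith, hs2' s ⟨h2, h1⟩, s + (v - u), by linarith,
        by linarith, by linarith, by linarith, by linarith⟩
  obtain ⟨s', h1, h2, h3, h4, h5⟩ := hss1
  have hDs' : D s' = demandBefore D v := hs1' s' ⟨h1, h2⟩
  have hc := h s s' hs0 h4 (h2.le.trans hv)
  rw [hDs, hDs'] at hc
  have hn : noise L (G s' - G s) ≤ noise L (A * (v - u)) := by
    refine noise_mono hL (((hG s s' hs0 h4 (h2.le.trans hv)).2).trans ?_)
    gcongr
  obtain ⟨g1, g2⟩ := hG s u hs0 hsu (huv.trans hv)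
  obtain ⟨g3, g4⟩ := hG s' v (hs0.trans h4) h2.le hv
  have g5 : A * (u - s) ≤ A * δ := by gcongr
  have g6 : A * (v - s') ≤ A * δ := by gcongr
  rw [abs_le] at hc ⊢
  constructor <;> linarith [hc.1, hc.2]

/-- The revenue and the intensity of a time window are, up to the error `n * e`, at least as good
as for the revenue rate `n * ρ` and the demand rate `n * c`. -/
def Window (n ρ c : ℝ) (F G : ℝ → ℝ) (u v e : ℝ) : Prop :=
  n * ((v - u) * ρ - e) ≤ F v - F u ∧ G v - G u ≤ n * ((v - u) * c + e)

lemma Window.trans {n ρ c : ℝ} {F G : ℝ → ℝ} {u v w e e' : ℝ} (h : Window n ρ c F G u v e)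
    (h' : Window n ρ c F G v w e') : Window n ρ c F G u w (e + e') := by
  obtain ⟨h1, h2⟩ := h
  obtain ⟨h3, h4⟩ := h'
  exact ⟨by linarith, by linarith⟩

lemma Window.refl (n ρ c : ℝ) (F G : ℝ → ℝ) (u : ℝ) : Window n ρ c F G u u 0 := by
  simp [Window]

namespace GoodPath

variable {q : Policy} {lam : ℝ → ℝ} {n M L T : ℝ} {D : ℝ → ℕ} {G : ℝ → ℝ}

/-- The revenue before time `t`. -/
noncomputable def revenueBefore (q : Policy) (D : ℝ → ℕ) (t : ℝ) : ℝ :=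
  cumRevenue q D (demandBefore D t)

/-- Revenue and intensity while a price is fixed. -/
lemma const_price (h : GoodPath q lam n M L T D G) {u v p : ℝ} (hu : 0 ≤ u) (huv : u ≤ v)
    (hv : v ≤ T) (hp : ∀ s ∈ Ico u v, q D s = p) :
    revenueBefore q D v - revenueBefore q D u = p * ((demandBefore D v : ℝ) - demandBefore D u) ∧
    G v - G u = n * ((v - u) * lam p) := by
  have hT : 0 ≤ T := hu.trans (huv.trans hv)
  have hm := demandBefore_mono (h.mono.monotoneOn (Icc 0 v)) huv
  constructor
  · simp only [revenueBefore, cumRevenue]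
    rw [← Finset.sum_Ico_eq_sub _ hm, Finset.sum_congr rfl fun k hk => ?_]
    · rw [Finset.sum_const, Nat.card_Ico, nsmul_eq_mul, Nat.cast_sub hm, mul_comm]
    · rw [Finset.mem_Ico] at hk
      have hkT : k < D T := hk.2.trans_le (demandBefore_le fun s hs => h.mono (hs.2.le.trans hv))
      refine hp _ ⟨?_, (saleTime_lt_iff hT hkT (h.mono.monotoneOn _)).2 hk.2⟩
      by_contra! hcon
      exact absurd ((saleTime_lt_iff hT hkT (h.mono.monotoneOn _)).1 hcon) (by omega)
  · obtain ⟨h1, h2⟩ := h.intensity v ⟨hu.trans huv, hv⟩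
    obtain ⟨h3, h4⟩ := h.intensity u ⟨hu, huv.trans hv⟩
    obtain ⟨h5, h6⟩ := intervalIntegral_of_Ioo_const (f := fun s => n * lam (q D s))
      (c := n * lam p) huv fun s hs => by rw [hp s ⟨hs.1.le, hs.2⟩]
    rw [h2, h4, ← intervalIntegral.integral_add_adjacent_intervals h3 h5, h6]
    ring

/-- Revenue while a price `p ≤ R` is fixed. -/
lemma const_price_revenue (h : GoodPath q lam n M L T D G) {u v p R : ℝ} (hu : 0 ≤ u) (huv : u ≤ v)
    (hv : v ≤ T) (hp : ∀ s ∈ Ico u v, q D s = p) (hp0 : 0 ≤ p) (hpR : p ≤ R) :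
    n * ((v - u) * (p * lam p)) - R * noise L (n * M * (v - u)) ≤
      revenueBefore q D v - revenueBefore q D u := by
  obtain ⟨h1, h2⟩ := h.const_price hu huv hv hp
  have h3 := h.close u v hu huv hv
  rw [h2] at h3
  have h4 := (abs_le.1 h3).1
  have h5 : 0 ≤ noise L (n * M * (v - u)) := (abs_nonneg _).trans h3
  rw [h1]
  have h6 : p * noise L (n * M * (v - u)) ≤ R * noise L (n * M * (v - u)) := by gcongr
  have h7 : p * (n * ((v - u) * lam p) - noise L (n * M * (v - u))) ≤
      p * ((demandBefore D v : ℝ) - demandBefore D u) :=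
    mul_le_mul_of_nonneg_left (by linarith) hp0
  linarith

lemma final_window (h : GoodPath q lam n M L T D G) (hn : 0 < n) {u p R ρ c e₁ e₂ : ℝ} (hu : 0 ≤ u)
    (huT : u ≤ T) (hp : ∀ s ∈ Ico u T, q D s = p) (hp0 : 0 ≤ p) (hpR : p ≤ R)
    (h1 : ρ - p * lam p ≤ e₁) (h2 : lam p - c ≤ e₁) (he : 0 ≤ e₁)
    (h3 : R * noise L (n * M * (T - u)) ≤ n * e₂) (he2 : 0 ≤ e₂) :
    Window n ρ c (revenueBefore q D) G u T (T * e₁ + e₂) := by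
  have h4 := h.const_price_revenue hu huT le_rfl hp hp0 hpR
  have h5 := (h.const_price hu huT le_rfl hp).2
  have h6 : (T - u) * (ρ - p * lam p) ≤ T * e₁ :=
    (mul_le_mul_of_nonneg_left h1 (by linarith)).trans (by gcongr; linarith)
  have h7 : (T - u) * (lam p - c) ≤ T * e₁ :=
    (mul_le_mul_of_nonneg_left h2 (by linarith)).trans (by gcongr; linarith)
  constructor
  · have := mul_le_mul_of_nonneg_left h6 hn.le
    linarith
  · rw [h5]
    have := mul_le_mul_of_nonneg_left h7 hn.le
    have := mul_nonneg hn.le he2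
    linarith

end GoodPath

/-! ### Learning periods -/

namespace Period

variable {pol : Policy} {lam : ℝ → ℝ} {n M L T : ℝ} {D : ℝ → ℕ} {G : ℝ → ℝ} {m : Market}
  {q : Period}

lemma Regular.step_pos (h : q.Regular m) : 0 < q.step :=
  div_pos h.length_pos (by exact_mod_cast h.grid_pos)

lemma Regular.grid_mul_step (h : q.Regular m) : q.grid * q.step = q.length := by
  have : (q.grid : ℝ) ≠ 0 := by have := h.grid_pos; positivity
  simp only [step]
  field_simp

lemma Regular.time_le (h : q.Regular m) {j : ℕ} (hj : j ≤ q.grid) :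
    q.time j ≤ q.start + q.length := by
  rw [← time_grid h.grid_pos]
  exact time_mono h.length_pos.le hj

lemma Regular.priceAt_eq (h : q.Regular m) {j : ℕ} {t : ℝ}
    (ht : t ∈ Ico (q.time j) (q.time (j + 1))) : q.priceAt t = q.price j := by
  rw [priceAt, stepIndex_eq (time_mono h.length_pos.le) ht]

lemma start_le_time (h : 0 ≤ q.step) (j : ℕ) : q.start ≤ q.time j := by
  have : 0 ≤ j * q.step := by positivity
  simp only [time]
  linarith

/-- What is observed and earned in a learning period. -/
lemma Regular.outcome (h : q.Regular m) (hG : GoodPath pol lam n M L T D G) (hlo : 0 ≤ m.lo)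
    (hs : 0 ≤ q.start) (he : q.start + q.length ≤ T)
    (hpol : ∀ t ∈ Ico q.start (q.start + q.length), pol D t = q.priceAt t)
    {ν R : ℝ} (hν : noise L (n * M * q.step) ≤ n * q.step * ν) (hR : m.hi ≤ R) :
    (∀ j < q.grid, |q.rate D j - n * lam (q.price j)| ≤ n * ν) ∧
    n * q.step * ∑ j ∈ Finset.range q.grid, (q.price j * lam (q.price j) - R * ν) ≤
      GoodPath.revenueBefore pol D (q.start + q.length) -
        GoodPath.revenueBefore pol D q.start ∧
    G (q.start + q.length) - G q.start =
      n * q.step * ∑ j ∈ Finset.range q.grid, lam (q.price j) := by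
  have hst := h.step_pos
  have hj0 : ∀ j, 0 ≤ q.time j := fun j => hs.trans (start_le_time hst.le j)
  have hjj : ∀ j, q.time j ≤ q.time (j + 1) := fun j => time_mono h.length_pos.le (Nat.le_succ j)
  have hjT : ∀ j < q.grid, q.time (j + 1) ≤ T := fun j hj => (h.time_le hj).trans he
  have hdiff : ∀ j, q.time (j + 1) - q.time j = q.step := fun j => by rw [time_add_one]; ring
  have hprice : ∀ j < q.grid, ∀ s ∈ Ico (q.time j) (q.time (j + 1)), pol D s = q.price j := by
    intro j hj s hsj
    rw [hpol s ⟨(start_le_time hst.le j).trans hsj.1, hsj.2.trans_le (h.time_le hj)⟩,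
      h.priceAt_eq hsj]
  have hcp := fun j hj => hG.const_price (hj0 j) (hjj j) (hjT j hj) (hprice j hj)
  have hmem : ∀ j < q.grid, q.price j ∈ Icc m.lo m.hi := fun j hj =>
    h.mem_of_mem (h.price_mem hj)
  refine ⟨fun j hj => ?_, ?_, ?_⟩
  · have h1 := hG.close _ _ (hj0 j) (hjj j) (hjT j hj)
    rw [(hcp j hj).2, hdiff] at h1
    have h2 := h1.trans hν
    have h3 : q.rate D j - n * lam (q.price j) =
        ((demandBefore D (q.time (j + 1)) : ℝ) - demandBefore D (q.time j) -
          n * (q.step * lam (q.price j))) / q.step := by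
      simp only [rate]
      field_simp
    rw [h3, abs_div, abs_of_pos hst, div_le_iff₀ hst]
    linarith
  · have h1 : ∀ j < q.grid, n * q.step * (q.price j * lam (q.price j) - R * ν) ≤
        GoodPath.revenueBefore pol D (q.time (j + 1)) -
          GoodPath.revenueBefore pol D (q.time j) := by
      intro j hj
      have h2 := hG.const_price_revenue (hj0 j) (hjj j) (hjT j hj) (hprice j hj)
        (hlo.trans (hmem j hj).1) ((hmem j hj).2.trans hR)
      rw [hdiff] at h2
      have h3 : R * noise L (n * M * q.step) ≤ R * (n * q.step * ν) := by
        have : 0 ≤ R := hlo.trans ((hmem j hj).1.trans ((hmem j hj).2.trans hR))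
        gcongr
      linarith
    rw [Finset.mul_sum]
    refine (Finset.sum_le_sum fun j hj => h1 j (Finset.mem_range.1 hj)).trans (le_of_eq ?_)
    rw [Finset.sum_range_sub (fun j => GoodPath.revenueBefore pol D (q.time j)),
      time_grid h.grid_pos, time_zero]
  · rw [Finset.mul_sum, ← time_grid h.grid_pos, ← time_zero,
      ← Finset.sum_range_sub (fun j => G (q.time j))]
    refine Finset.sum_congr rfl fun j hj => ?_
    rw [(hcp j (Finset.mem_range.1 hj)).2, hdiff]
    ring

/-- A learning period whose prices are good on the average. -/
lemma Regular.window (h : q.Regular m) (hG : GoodPath pol lam n M L T D G) (hn : 0 < n)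
    (hlo : 0 ≤ m.lo) (hs : 0 ≤ q.start) (he : q.start + q.length ≤ T)
    (hpol : ∀ t ∈ Ico q.start (q.start + q.length), pol D t = q.priceAt t)
    {ν R : ℝ} (hν : noise L (n * M * q.step) ≤ n * q.step * ν) (hR : m.hi ≤ R)
    {ρ c e : ℝ} (h1 : ∀ j < q.grid, ρ - q.price j * lam (q.price j) + R * ν ≤ e)
    (h2 : ∑ j ∈ Finset.range q.grid, (lam (q.price j) - c) ≤ q.grid * e) :
    Window n ρ c (GoodPath.revenueBefore pol D) G q.start (q.start + q.length)
      (q.length * e) := by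
  obtain ⟨-, ho1, ho2⟩ := h.outcome hG hlo hs he hpol hν hR
  have hst := h.step_pos
  have hns : 0 ≤ n * q.step := by positivity
  constructor
  · refine le_trans ?_ ho1
    have h3 : (q.grid : ℝ) * (ρ - e) ≤
        ∑ j ∈ Finset.range q.grid, (q.price j * lam (q.price j) - R * ν) := by
      calc (q.grid : ℝ) * (ρ - e) = ∑ _j ∈ Finset.range q.grid, (ρ - e) := by
            rw [Finset.sum_const, Finset.card_range, nsmul_eq_mul]
        _ ≤ _ := Finset.sum_le_sum fun j hj => by
            have := h1 j (Finset.mem_range.1 hj); linarith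
    calc n * ((q.start + q.length - q.start) * ρ - q.length * e)
        = n * q.step * (q.grid * (ρ - e)) := by rw [← h.grid_mul_step]; ring
      _ ≤ _ := by gcongr
  · rw [ho2]
    rw [Finset.sum_sub_distrib, Finset.sum_const, Finset.card_range, nsmul_eq_mul] at h2
    calc n * q.step * ∑ j ∈ Finset.range q.grid, lam (q.price j)
        ≤ n * q.step * (q.grid * c + q.grid * e) := by gcongr; linarith
      _ = _ := by rw [← h.grid_mul_step]; ring

/-- Every price of the interval is near to a grid price. -/
lemma Regular.exists_near (h : q.Regular m) {p : ℝ} (hp : p ∈ Icc q.a q.b) :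
    ∃ i < q.grid, |q.price i - p| ≤ q.mesh := by
  have hg := h.grid_pos
  rcases h.mesh_nonneg.eq_or_lt with h0 | h0
  · refine ⟨0, hg, ?_⟩
    have h1 := h.grid_mul_mesh
    rw [← h0, mul_zero] at h1
    simp only [price, ← h0]
    have : p = q.a := le_antisymm (by linarith [hp.2]) hp.1
    simp [this]
  · have h1 := h.grid_mul_mesh
    have hx : 0 ≤ (p - q.a) / q.mesh := div_nonneg (by linarith [hp.1]) h0.le
    have hxm : (p - q.a) / q.mesh * q.mesh = p - q.a := by field_simp
    rcases lt_or_ge ⌊(p - q.a) / q.mesh⌋₊ q.grid with h2 | h2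
    · refine ⟨_, h2, ?_⟩
      have h3 := Nat.floor_le hx
      have h4 := (Nat.lt_floor_add_one ((p - q.a) / q.mesh)).le
      have h5 := mul_le_mul_of_nonneg_right h3 h0.le
      have h6 := mul_le_mul_of_nonneg_right h4 h0.le
      rw [hxm] at h5 h6
      simp only [price]
      rw [abs_le]
      constructor <;> linarith
    -- The right end `b` is not a grid price; the last left endpoint is one mesh away from it.
    · refine ⟨q.grid - 1, by omega, ?_⟩
      have h3 : (q.grid : ℝ) ≤ (p - q.a) / q.mesh :=
        (Nat.cast_le.2 h2).trans (Nat.floor_le hx)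
      have h5 := mul_le_mul_of_nonneg_right h3 h0.le
      rw [hxm] at h5
      have h6 : ((q.grid - 1 : ℕ) : ℝ) = q.grid - 1 := by
        rw [Nat.cast_sub hg]; simp
      simp only [price, h6]
      rw [abs_le]
      constructor <;> linarith [hp.2]

lemma price_zero (q : Period) : q.price 0 = q.a := by simp [price]

/-- Using left endpoints shifts the mean price half a mesh below the midpoint; the asymmetric
intervals of Step 2 have to make up for it. -/
lemma Regular.sum_price (h : q.Regular m) :
    ∑ j ∈ Finset.range q.grid, q.price j = q.grid * ((q.a + q.b) / 2 - q.mesh / 2) := by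
  have h1 : ∀ k : ℕ, ∑ j ∈ Finset.range k, q.price j =
      k * q.a + (k * (k - 1) / 2 : ℝ) * q.mesh := by
    intro k
    induction k with
    | zero => simp
    | succ k ih =>
      rw [Finset.sum_range_succ, ih]
      simp only [price]
      push_cast
      ring
  rw [h1]
  have h2 := h.grid_mul_mesh
  have h3 : q.b = q.grid * q.mesh + q.a := by linarith
  rw [h3]
  ring

end Period

/-! ### Identities between the parameters of the learning periods -/

section Parameters

variable {n : ℕ} {d : ℝ}

lemma widthU_pos (hn : 2 ≤ n) (k : ℕ) : 0 < widthU n d k :=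
  Real.rpow_pos_of_pos (natCast_pos_of_two_le hn) _

lemma widthC_pos (hn : 2 ≤ n) (k : ℕ) : 0 < widthC n d k :=
  Real.rpow_pos_of_pos (natCast_pos_of_two_le hn) _

lemma widthU_zero : widthU n d 0 = 1 := by simp [widthU]

lemma widthC_zero : widthC n d 0 = 1 := by simp [widthC]

lemma widthU_antitone (hn : 2 ≤ n) (hd : d ≤ 1) : Antitone (widthU n d) := by
  intro i j hij
  refine Real.rpow_le_rpow_of_exponent_le (by exact_mod_cast (by omega : 1 ≤ n)) ?_
  have h1 : (3 / 5 : ℝ) ^ j ≤ (3 / 5 : ℝ) ^ i :=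
    pow_le_pow_of_le_one (by norm_num) (by norm_num) hij
  nlinarith

lemma widthC_antitone (hn : 2 ≤ n) (hd : d ≤ 1) : Antitone (widthC n d) := by
  intro i j hij
  refine Real.rpow_le_rpow_of_exponent_le (by exact_mod_cast (by omega : 1 ≤ n)) ?_
  have h1 : (2 / 3 : ℝ) ^ j ≤ (2 / 3 : ℝ) ^ i :=
    pow_le_pow_of_le_one (by norm_num) (by norm_num) hij
  nlinarith

lemma log_le_kappaU (hn : 2 ≤ n) (hd : d ≤ 1) (k : ℕ) : Real.log n ≤ kappaU n d k := by
  have h1 : (1 : ℝ) ≤ (n : ℝ) ^ ((1 / 5 : ℝ) * (3 / 5 : ℝ) ^ k * (1 - d)) :=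
    Real.one_le_rpow (by exact_mod_cast (by omega : 1 ≤ n))
      (mul_nonneg (by positivity) (by linarith))
  have := mul_le_mul_of_nonneg_right h1 (log_natCast_pos hn).le
  rwa [one_mul] at this

lemma log_le_kappaC (hn : 2 ≤ n) (hd : d ≤ 1) (k : ℕ) : Real.log n ≤ kappaC n d k := by
  have h1 : (1 : ℝ) ≤ (n : ℝ) ^ ((1 / 3 : ℝ) * (2 / 3 : ℝ) ^ k * (1 - d)) :=
    Real.one_le_rpow (by exact_mod_cast (by omega : 1 ≤ n))
      (mul_nonneg (by positivity) (by linarith))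
  have := mul_le_mul_of_nonneg_right h1 (log_natCast_pos hn).le
  rwa [one_mul] at this

/-- The next interval is `log n` meshes wide. -/
lemma widthU_succ (hn : 2 ≤ n) (k : ℕ) :
    widthU n d (k + 1) * kappaU n d k = widthU n d k * Real.log n := by
  have h := natCast_pos_of_two_le hn
  rw [widthU, kappaU, ← mul_assoc, ← Real.rpow_add h, widthU]
  congr 2
  ring

lemma widthC_succ (hn : 2 ≤ n) (k : ℕ) :
    widthC n d (k + 1) * kappaC n d k = widthC n d k * Real.log n := by
  have h := natCast_pos_of_two_le hn
  rw [widthC, kappaC, ← mul_assoc, ← Real.rpow_add h, widthC]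
  congr 2
  ring

/-- The balance of losses: a loss rate quadratic in the width costs the same in every period. -/
lemma tauU_mul_sq (hn : 2 ≤ n) (k : ℕ) :
    tauU n d k * widthU n d k ^ 2 = (n : ℝ) ^ (-d) * Real.log n ^ 5 := by
  have h := natCast_pos_of_two_le hn
  rw [tauU, widthU, ← Real.rpow_natCast _ 2, ← Real.rpow_mul h.le, mul_right_comm, ← Real.rpow_add h]
  congr 2
  push_cast
  ring

/-- The same balance for a loss rate linear in the width. -/
lemma tauC_mul (hn : 2 ≤ n) (k : ℕ) :
    tauC n d k * widthC n d k = (n : ℝ) ^ (-d) * Real.log n ^ 3 := by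
  have h := natCast_pos_of_two_le hn
  rw [tauC, widthC, mul_right_comm, ← Real.rpow_add h]
  congr 2
  ring

/-- The balance of noise: before rounding, the scaled time `n * tauU / kappaU` per grid price is
`(log n / widthU (k + 1))^4`, so the error of a rate is of order `√L` times the squared mesh, as a
quadratic maximum demands. -/
lemma tauU_mul_pow (hn : 2 ≤ n) (k : ℕ) :
    n * tauU n d k * widthU n d (k + 1) ^ 4 = kappaU n d k * Real.log n ^ 4 := by
  have h := natCast_pos_of_two_le hn
  rw [tauU, widthU, kappaU, ← Real.rpow_natCast _ 4, ← Real.rpow_mul h.le]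
  calc (n : ℝ) * ((n : ℝ) ^ (1 - 2 * d - (1 - d) * (3 / 5 : ℝ) ^ k) * Real.log n ^ 5) *
        (n : ℝ) ^ (-(1 / 2 : ℝ) * (1 - d) * (1 - (3 / 5 : ℝ) ^ (k + 1)) * (4 : ℕ))
      = ((n : ℝ) ^ (1 : ℝ) * (n : ℝ) ^ (1 - 2 * d - (1 - d) * (3 / 5 : ℝ) ^ k) *
        (n : ℝ) ^ (-(1 / 2 : ℝ) * (1 - d) * (1 - (3 / 5 : ℝ) ^ (k + 1)) * (4 : ℕ))) *
        Real.log n ^ 5 := by rw [Real.rpow_one]; ring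
    _ = (n : ℝ) ^ ((1 / 5 : ℝ) * (3 / 5 : ℝ) ^ k * (1 - d)) * Real.log n ^ 5 := by
        rw [← Real.rpow_add h, ← Real.rpow_add h]
        congr 2
        push_cast
        ring
    _ = _ := by ring

/-- In Step 3 the demand is matched to first order, and an error of order `√L` times the mesh is
enough. -/
lemma tauC_mul_pow (hn : 2 ≤ n) (k : ℕ) :
    n * tauC n d k * widthC n d (k + 1) ^ 2 = kappaC n d k * Real.log n ^ 2 := by
  have h := natCast_pos_of_two_le hn
  rw [tauC, widthC, kappaC, ← Real.rpow_natCast _ 2, ← Real.rpow_mul h.le]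
  calc (n : ℝ) * ((n : ℝ) ^ (1 - 2 * d - (1 - d) * (2 / 3 : ℝ) ^ k) * Real.log n ^ 3) *
        (n : ℝ) ^ (-(1 - d) * (1 - (2 / 3 : ℝ) ^ (k + 1)) * (2 : ℕ))
      = ((n : ℝ) ^ (1 : ℝ) * (n : ℝ) ^ (1 - 2 * d - (1 - d) * (2 / 3 : ℝ) ^ k) *
        (n : ℝ) ^ (-(1 - d) * (1 - (2 / 3 : ℝ) ^ (k + 1)) * (2 : ℕ))) *
        Real.log n ^ 3 := by rw [Real.rpow_one]; ring
    _ = (n : ℝ) ^ ((1 / 3 : ℝ) * (2 / 3 : ℝ) ^ k * (1 - d)) * Real.log n ^ 3 := by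
        rw [← Real.rpow_add h, ← Real.rpow_add h]
        congr 2
        push_cast
        ring
    _ = _ := by ring

lemma natCeil_le_two_mul {κ : ℝ} (h : 1 ≤ κ) : (⌈κ⌉₊ : ℝ) ≤ 2 * κ := by
  have := Nat.ceil_lt_add_one (show (0 : ℝ) ≤ κ by linarith)
  linarith

/-- The noise over a long step is a small fraction of the mean. -/
lemma noise_le {L M y θ : ℝ} (hM : 0 ≤ M) (hy : 0 ≤ y) (h : L ≤ θ ^ 2 * y)
    (hθ : 0 ≤ θ) (hθ1 : θ ≤ 1) : noise L (M * y) ≤ y * ((5 * √M + 12) * θ) := by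
  have h1 : √(L * (M * y)) ≤ √M * (θ * y) := by
    rw [Real.sqrt_le_left (by positivity)]
    calc L * (M * y) ≤ θ ^ 2 * y * (M * y) := by gcongr
      _ = (√M * (θ * y)) ^ 2 := by rw [mul_pow, Real.sq_sqrt hM]; ring
  have h2 : θ ^ 2 * y ≤ θ * y := by gcongr; nlinarith
  unfold noise
  linarith

end Parameters

/-! ### Estimates of the optimal prices -/

namespace Period

variable {m : Market} {q : Period} {lam : ℝ → ℝ} {M K ε R growth curv bend pu pc : ℝ} {D : ℝ → ℕ}
  {n ν : ℝ}

/-- The empirical maximizer earns within `2 R ν` of every grid price, in particular of one next to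
`pu`, which loses at most `curv * mesh²`; quadratic growth turns revenue into distance. If `pu` lies
to the left of the interval, the true maximizer there is `a`, itself a grid price. -/
lemma Regular.hatU_estimate (h : q.Regular m)
    (hF : PriceFacts m lam M K ε R growth curv bend pu pc) (hlo : 0 ≤ m.lo) (hcurv : 0 ≤ curv)
    (hn : 0 < n) (hν : ∀ j < q.grid, |q.rate D j - n * lam (q.price j)| ≤ n * ν)
    (hb : pu ≤ q.b) :
    growth * (q.hatU D - max q.a pu) ^ 2 ≤ curv * q.mesh ^ 2 + 2 * (R * ν) := by
  obtain ⟨h1, h2⟩ := argminIndex_spec (fun j => -(q.price j * q.rate D j)) h.grid_pos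
  have hν0 : 0 ≤ ν := by
    have := (abs_nonneg _).trans (hν 0 h.grid_pos)
    exact nonneg_of_mul_nonneg_right this hn
  have hmem : ∀ j < q.grid, q.price j ∈ Icc m.lo m.hi := fun j hj =>
    h.mem_of_mem (h.price_mem hj)
  have herr : ∀ j < q.grid, |q.price j * q.rate D j - n * (q.price j * lam (q.price j))| ≤
      n * (R * ν) := by
    intro j hj
    have hp0 : 0 ≤ q.price j := hlo.trans (hmem j hj).1
    have hpR : q.price j ≤ R := (hmem j hj).2.trans hF.hi_le
    calc |q.price j * q.rate D j - n * (q.price j * lam (q.price j))|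
        = q.price j * |q.rate D j - n * lam (q.price j)| := by
          rw [← abs_of_nonneg hp0, ← abs_mul, abs_of_nonneg hp0]; ring_nf
      _ ≤ R * (n * ν) := mul_le_mul hpR (hν j hj) (abs_nonneg _) (hp0.trans hpR)
      _ = _ := by ring
  set j := argminIndex (fun j => -(q.price j * q.rate D j)) q.grid with hj
  have hhat : q.hatU D = q.price j := rfl
  have hcmp : ∀ i < q.grid, q.price i * lam (q.price i) - q.price j * lam (q.price j) ≤
      2 * (R * ν) := by
    intro i hi
    have e1 := abs_le.1 (herr i hi)
    have e2 := abs_le.1 (herr j h1)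
    have e3 := h2 i hi
    have e4 : n * (q.price i * lam (q.price i) - q.price j * lam (q.price j)) ≤
        n * (2 * (R * ν)) := by linarith [e1.1, e2.2]
    exact le_of_mul_le_mul_left e4 hn
  rw [hhat]
  have ha : q.a ∈ Icc m.lo m.hi := h.mem_of_mem ⟨le_rfl, h.a_le⟩
  have hg := hF.growth_le q.a ha (q.price j) ⟨(h.price_mem h1).1, (hmem j h1).2⟩
  rcases le_or_gt pu q.a with hpu | hpu
  · rw [max_eq_left hpu] at hg ⊢
    have e1 := hcmp 0 h.grid_pos
    rw [price_zero] at e1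
    have : 0 ≤ curv * q.mesh ^ 2 := by positivity
    linarith
  · rw [max_eq_right hpu.le] at hg ⊢
    obtain ⟨i, hi, hi'⟩ := h.exists_near (p := pu) ⟨hpu.le, hb⟩
    have e1 := hcmp i hi
    have e2 := hF.le_curv (h.lo_le.trans_lt hpu) _ (hmem i hi)
    have e3 : (q.price i - pu) ^ 2 ≤ q.mesh ^ 2 := by
      rw [← sq_abs]; gcongr
    have e4 := mul_le_mul_of_nonneg_left e3 hcurv
    linarith

/-- The same comparison for the distance of the rate from the target, where the inverse Lipschitz
bound gives a distance of first order. -/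
lemma Regular.hatC_estimate (h : q.Regular m)
    (hF : PriceFacts m lam M K ε R growth curv bend pu pc) (hK : 0 ≤ K)
    (hn : 0 < n) (hν : ∀ j < q.grid, |q.rate D j - n * lam (q.price j)| ≤ n * ν)
    (hb : pc ≤ q.b) :
    |q.hatC (n * (m.inventory / m.horizon)) D - max q.a pc| ≤ K ^ 2 * q.mesh + 2 * (K * ν) := by
  set c := m.inventory / m.horizon with hc
  obtain ⟨h1, h2⟩ := argminIndex_spec (fun j => |q.rate D j - n * c|) h.grid_pos
  have hmem : ∀ j < q.grid, q.price j ∈ Icc m.lo m.hi := fun j hj =>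
    h.mem_of_mem (h.price_mem hj)
  set j := argminIndex (fun j => |q.rate D j - n * c|) q.grid with hj
  have hhat : q.hatC (n * c) D = q.price j := rfl
  have hcmp : ∀ i < q.grid, |lam (q.price j) - c| ≤ |lam (q.price i) - c| + 2 * ν := by
    intro i hi
    have e1 := hν i hi
    have e2 := hν j h1
    have e3 := h2 i hi
    have e4 : |n * lam (q.price j) - n * c| ≤ |n * lam (q.price i) - n * c| + 2 * (n * ν) := by
      have t1 := abs_sub_le (n * lam (q.price j)) (q.rate D j) (n * c)
      have t2 := abs_sub_le (q.rate D i) (n * lam (q.price i)) (n * c)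
      rw [abs_sub_comm (n * lam (q.price j)) (q.rate D j)] at t1
      linarith
    rw [← mul_sub, ← mul_sub, abs_mul, abs_mul, abs_of_pos hn] at e4
    exact le_of_mul_le_mul_left (by linarith) hn
  rw [hhat]
  have ha : q.a ∈ Icc m.lo m.hi := h.mem_of_mem ⟨le_rfl, h.a_le⟩
  have hg := h.mesh_nonneg
  by_cases hcase : q.a ≤ pc ∧ m.lo < pc
  · rw [max_eq_right hcase.1]
    have hlc := hF.pc_eq hcase.2
    rw [← hc] at hlc
    obtain ⟨i, hi, hi'⟩ := h.exists_near (p := pc) ⟨hcase.1, hb⟩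
    have e1 := hcmp i hi
    have e2 := hF.lip _ (hmem i hi) _ hF.pc_mem
    have e3 := hF.inv_lip _ (hmem j h1) _ hF.pc_mem
    rw [hlc] at e2 e3
    have e4 : K * |q.price i - pc| ≤ K * q.mesh := by gcongr
    calc |q.price j - pc| ≤ K * |lam (q.price j) - c| := e3
      _ ≤ K * (K * q.mesh + 2 * ν) := by gcongr; linarith
      _ = _ := by ring
  · have hpc : pc ≤ q.a := by
      by_contra! hlt
      exact hcase ⟨hlt.le, h.lo_le.trans_lt hlt⟩
    rw [max_eq_left hpc]
    -- All rates on the interval are at most the target, so the leftmost grid price comes nearest.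
    -- This includes `pc = lo`, where the target itself may be out of reach.
    have hla : lam q.a ≤ c := (hF.anti.antitoneOn hF.pc_mem ha hpc).trans hF.pc_le
    have hlj : lam (q.price j) ≤ lam q.a := hF.anti.antitoneOn ha (hmem j h1) (h.price_mem h1).1
    have e1 := hcmp 0 h.grid_pos
    rw [price_zero, abs_of_nonpos (by linarith), abs_of_nonpos (by linarith)] at e1
    have e3 := hF.inv_lip _ (hmem j h1) _ ha
    calc |q.price j - q.a| ≤ K * |lam (q.price j) - lam q.a| := e3
      _ ≤ K * (2 * ν) := by
        gcongr
        rw [abs_of_nonpos (by linarith)]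
        linarith
      _ ≤ _ := by nlinarith [mul_nonneg (sq_nonneg K) hg]

end Period

/-! ### Problems of a large size -/

/-- The constant in the errors of the observed demand rates. -/
noncomputable def noiseConst (M T : ℝ) : ℝ := (5 * √M + 12) * √(2 / T)

/-- The constant in the losses of the learning periods. -/
def lossConst (M K curv bend : ℝ) : ℝ := K ^ 2 * M + M + (curv + bend) * (K * M) ^ 2

/-- The problem of size `n` is large enough for the learning periods to be informative and to fit
into the season. -/
structure Tuned (m : Market) (n : ℕ) (d : ℝ) (lam : ℝ → ℝ)
    (M K ε R growth curv bend pu pc η : ℝ) : Prop extends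
    PriceFacts m lam M K ε R growth curv bend pu pc where
  lo_nonneg : 0 ≤ m.lo
  lo_lt : m.lo < m.hi
  inventory_pos : 0 < m.inventory
  horizon_pos : 0 < m.horizon
  M_pos : 0 < M
  K_pos : 0 < K
  ε_pos : 0 < ε
  growth_pos : 0 < growth
  curv_nonneg : 0 ≤ curv
  bend_nonneg : 0 ≤ bend
  η_pos : 0 < η
  two_le : 2 ≤ n
  d_le : d ≤ 1 / 2
  log_ge : 100 ≤ Real.log n
  horizon_log : 2 / m.horizon ≤ Real.log n
  estimateU : 16 * (curv * (K * M) ^ 2 + 2 * (R * noiseConst M m.horizon) * √(Real.log n)) ≤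
    growth * Real.log n * η ^ 2
  sqrt_log_ge : 8 * K ^ 2 ≤ √(Real.log n)
  estimateC : 16 * (K * noiseConst M m.horizon) ≤ √(Real.log n) * η
  widthU_le : K * M * widthU n d 1 ≤ ε
  widthC_le : K * M * widthC n d 1 ≤ ε
  startU_le : startU m n d (periodsU n d) ≤ m.horizon / 2
  startC_le : startC m n d (periodsC n d) ≤ m.horizon / 2
  lastU : widthU n d (periodsU n d) ^ 2 ≤ (n : ℝ) ^ (-d) * Real.log n ^ 5
  lastC : widthC n d (periodsC n d) ≤ (n : ℝ) ^ (-d) * Real.log n ^ 3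
  η_leU : η * 2 ^ periodsU n d ≤ ε
  η_leC : η * 2 ^ periodsC n d ≤ ε

/-- Rounding the grid size up costs a factor of at most 2 per period, hence the powers of 2 in the
lower bounds of the mesh. -/
lemma div_natCeil_bounds {κ W W₁ W₂ : ℝ} (hκ : 1 ≤ κ) (h0 : 0 ≤ W) (h1 : W₁ ≤ W) (h2 : W ≤ W₂) :
    W₁ / 2 / κ ≤ W / ⌈κ⌉₊ ∧ W / ⌈κ⌉₊ ≤ W₂ / κ := by
  have h3 := Nat.le_ceil κ
  have h4 := natCeil_le_two_mul hκ
  have h5 : 0 < κ := by linarith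
  constructor
  · rw [div_div]
    exact div_le_div₀ h0 h1 (by linarith) h4
  · exact div_le_div₀ (h0.trans h2) h2 h5 h3

lemma noiseConst_nonneg (M T : ℝ) : 0 ≤ noiseConst M T := by unfold noiseConst; positivity

lemma Period.Regular.of_scale {m : Market} {n : ℕ} {q : Period} (h : q.Regular (m.scale n)) :
    q.Regular m :=
  ⟨h.lo_le, h.a_le, h.le_hi, h.grid_pos, h.length_pos⟩

/-- Period `k` of Step 2 has located the optimal price. -/
structure LocatedU (m : Market) (n : ℕ) (d : ℝ) (lam : ℝ → ℝ) (M K ε curv bend pu pc : ℝ)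
    (k : ℕ) (q : Period) : Prop where
  best_mem : max pu pc ∈ Icc q.a q.b
  le_mesh : ε / 2 ^ k * (widthU n d (k + 1) / Real.log n) ≤ q.mesh
  mesh_le : q.mesh ≤ K * M * (widthU n d (k + 1) / Real.log n)
  value : ∀ p ∈ Icc q.a q.b, max pu pc * lam (max pu pc) - p * lam p ≤
    lossConst M K curv bend * widthU n d k ^ 2
  demand : ∑ j ∈ Finset.range q.grid, (lam (q.price j) - m.inventory / m.horizon) ≤
    q.grid * (lossConst M K curv bend * widthU n d k ^ 2)
  left : q.a = m.lo ∨ q.a ≤ max pu pc - 3 * (√(Real.log n) * q.mesh)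

/-- Period `k` of Step 3 has located the constrained price. -/
structure LocatedC (n : ℕ) (d : ℝ) (M K ε pc : ℝ) (k : ℕ) (q : Period) : Prop where
  pc_mem : pc ∈ Icc q.a q.b
  le_mesh : ε / 2 ^ k * (widthC n d (k + 1) / Real.log n) ≤ q.mesh
  mesh_le : q.mesh ≤ K * M * (widthC n d (k + 1) / Real.log n)
  width_le : q.b - q.a ≤ K * M * widthC n d k

namespace Tuned

variable {m : Market} {n : ℕ} {d : ℝ} {lam : ℝ → ℝ} {M K ε R growth curv bend pu pc η : ℝ}
  {D : ℝ → ℕ}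

section

variable (h : Tuned m n d lam M K ε R growth curv bend pu pc η)
include h

lemma sqrt_log : 10 ≤ √(Real.log n) ∧ √(Real.log n) * √(Real.log n) = Real.log n :=
  ⟨Real.le_sqrt_of_sq_le (by linarith [h.log_ge]), Real.mul_self_sqrt (by linarith [h.log_ge])⟩

lemma kappaU_ge (k : ℕ) : Real.log n ≤ kappaU n d k :=
  log_le_kappaU h.two_le (by linarith [h.d_le]) k

lemma kappaC_ge (k : ℕ) : Real.log n ≤ kappaC n d k :=
  log_le_kappaC h.two_le (by linarith [h.d_le]) k

lemma R_nonneg : 0 ≤ R := h.lo_nonneg.trans (h.lo_lt.le.trans h.hi_le)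

lemma lossConst_nonneg : 0 ≤ lossConst M K curv bend := by
  have := h.M_pos; have := h.K_pos; have := h.curv_nonneg; have := h.bend_nonneg
  unfold lossConst
  positivity

lemma widthU_le_one (k : ℕ) : widthU n d k ≤ 1 := by
  rw [← widthU_zero (n := n) (d := d)]
  exact widthU_antitone h.two_le (by linarith [h.d_le]) (Nat.zero_le k)

lemma widthC_le_one (k : ℕ) : widthC n d k ≤ 1 := by
  rw [← widthC_zero (n := n) (d := d)]
  exact widthC_antitone h.two_le (by linarith [h.d_le]) (Nat.zero_le k)

lemma KM_widthU_le (k : ℕ) : K * M * widthU n d (k + 1) ≤ ε := by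
  have := h.M_pos; have := h.K_pos
  refine le_trans ?_ h.widthU_le
  gcongr
  exact widthU_antitone h.two_le (by linarith [h.d_le]) (by omega)

lemma KM_widthC_le (k : ℕ) : K * M * widthC n d (k + 1) ≤ ε := by
  have := h.M_pos; have := h.K_pos
  refine le_trans ?_ h.widthC_le
  gcongr
  exact widthC_antitone h.two_le (by linarith [h.d_le]) (by omega)

lemma regularU (D : ℝ → ℕ) (k : ℕ) : (periodU (m.scale n) n d D k).Regular m :=
  (periodU_regular (m := m.scale n) h.two_le h.horizon_pos h.lo_lt.le D k).of_scale

lemma regularC (s : ℝ) (D : ℝ → ℕ) (k : ℕ) : (periodC (m.scale n) n d s D k).Regular m :=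
  (periodC_regular (m := m.scale n) h.two_le h.horizon_pos h.lo_lt.le s D k).of_scale

lemma width_ge : 2 * ε ≤ m.hi - m.lo := by
  have := h.best_mem
  linarith [this.1, this.2]

lemma value_le {p : ℝ} (hp : p ∈ Icc m.lo m.hi) :
    max pu pc * lam (max pu pc) - p * lam p ≤ K ^ 2 * M := by
  have h1 := h.rev_lip _ h.best_mem_Icc p hp
  have h2 : |max pu pc - p| ≤ K * M := by
    refine le_trans ?_ h.width_le
    have := h.best_mem_Icc
    rw [abs_le]
    constructor <;> linarith [this.1, this.2, hp.1, hp.2]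
  have h3 := mul_le_mul_of_nonneg_left h2 h.K_pos.le
  have h4 := le_abs_self (max pu pc * lam (max pu pc) - p * lam p)
  linarith

/-- On the full price range only crude bounds hold: the summands `K² M` and `M` of `lossConst` pay
for revenue and demand. -/
lemma locatedU_zero : LocatedU m n d lam M K ε curv bend pu pc 0 (periodU (m.scale n) n d D 0) := by
  have hL := h.log_ge
  have hκ := h.kappaU_ge 0
  have hw := widthU_succ (d := d) h.two_le 0
  rw [widthU_zero, one_mul] at hw
  have hx : widthU n d (0 + 1) / Real.log n = 1 / kappaU n d 0 := by
    rw [← hw]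
    have := widthU_pos (d := d) h.two_le (0 + 1)
    have : kappaU n d 0 ≠ 0 := by linarith
    field_simp
  have hb := div_natCeil_bounds (κ := kappaU n d 0) (by linarith)
    (show 0 ≤ m.hi - m.lo by linarith [h.lo_lt]) h.width_ge h.width_le
  have hE : lossConst M K curv bend * widthU n d 0 ^ 2 = lossConst M K curv bend := by
    rw [widthU_zero]; ring
  have := h.M_pos; have := h.K_pos; have := h.curv_nonneg; have := h.bend_nonneg
  refine ⟨h.best_mem_Icc, ?_, ?_, fun p hp => ?_, ?_, Or.inl rfl⟩
  · rw [hx]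
    refine le_trans (le_of_eq ?_) hb.1
    ring
  · rw [hx]
    refine hb.2.trans (le_of_eq ?_)
    ring
  · rw [hE]
    refine (h.value_le hp).trans ?_
    unfold lossConst
    have : 0 ≤ M + (curv + bend) * (K * M) ^ 2 := by positivity
    linarith
  · rw [hE]
    have hreg := h.regularU D 0
    have hc : 0 ≤ m.inventory / m.horizon := (div_pos h.inventory_pos h.horizon_pos).le
    calc _ ≤ ∑ _j ∈ Finset.range (periodU (m.scale n) n d D 0).grid, lossConst M K curv bend := by
          refine Finset.sum_le_sum fun j hj => ?_
          have h1 := h.le_bound _ (hreg.mem_of_mem (hreg.price_mem (Finset.mem_range.1 hj)))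
          have : 0 ≤ K ^ 2 * M + (curv + bend) * (K * M) ^ 2 := by positivity
          unfold lossConst
          linarith
      _ = _ := by rw [Finset.sum_const, Finset.card_range, nsmul_eq_mul]

/-- The errors of the observed demand rates in period `k` of Step 2. -/
lemma noise_stepU (k : ℕ) :
    noise (Real.log n) (n * M * (periodU (m.scale n) n d D k).step) ≤
      n * (periodU (m.scale n) n d D k).step * (noiseConst M m.horizon * √(Real.log n) *
        (widthU n d (k + 1) / Real.log n) ^ 2) := by
  obtain ⟨hS, hSS⟩ := h.sqrt_log
  have hL := h.log_ge
  have hT := h.horizon_pos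
  have hn := natCast_pos_of_two_le h.two_le
  have hω := widthU_pos (d := d) h.two_le (k + 1)
  have hω1 := h.widthU_le_one (k + 1)
  have hκ := h.kappaU_ge k
  have hτ := tauU_pos (d := d) h.two_le k
  have hκ2 := natCeil_le_two_mul (κ := kappaU n d k) (by linarith)
  have hκ1 := Nat.le_ceil (kappaU n d k)
  set L := Real.log n with hLdef
  set ω := widthU n d (k + 1) with hωdef
  have hstep : (periodU (m.scale n) n d D k).step = m.horizon * tauU n d k / ⌈kappaU n d k⌉₊ := by
    rw [Period.step, periodU_length, periodU_grid]; rfl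
  set y := (n : ℝ) * (periodU (m.scale n) n d D k).step with hy
  have hy1 : m.horizon / 2 * L ^ 4 ≤ ω ^ 4 * y := by
    have e1 := tauU_mul_pow (d := d) h.two_le k
    rw [hy, hstep]
    have e2 : ω ^ 4 * (n * (m.horizon * tauU n d k / ⌈kappaU n d k⌉₊)) =
        m.horizon * (kappaU n d k * L ^ 4) / ⌈kappaU n d k⌉₊ := by
      rw [← e1]; ring
    rw [e2, le_div_iff₀ (by linarith)]
    calc m.horizon / 2 * L ^ 4 * ⌈kappaU n d k⌉₊ ≤
        m.horizon / 2 * L ^ 4 * (2 * kappaU n d k) := by gcongr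
      _ = _ := by ring
  have hy0 : 0 ≤ y := by rw [hy, hstep]; positivity
  -- This `θ` is the relative accuracy at which `θ² y ≥ L` for the scaled step `y`; the factor 2
  -- under the root accounts for the rounding of the grid size.
  have hθ : (√(2 / m.horizon) * √L * (ω / L) ^ 2) ^ 2 = 2 / m.horizon * L * (ω / L) ^ 4 := by
    rw [mul_pow, mul_pow, Real.sq_sqrt (by positivity), Real.sq_sqrt (by linarith)]
    ring
  have key := noise_le (L := L) (M := M) (y := y) (θ := √(2 / m.horizon) * √L * (ω / L) ^ 2)
    h.M_pos.le hy0 ?_ (by positivity) ?_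
  · rw [noiseConst]
    calc _ = noise L (M * y) := by rw [hy]; ring_nf
      _ ≤ _ := key
      _ = _ := by ring
  · rw [hθ]
    have e3 : L = 2 / m.horizon * L * (m.horizon / 2 * L ^ 4) / L ^ 4 := by
      field_simp
    calc L = 2 / m.horizon * L * (m.horizon / 2 * L ^ 4) / L ^ 4 := e3
      _ ≤ 2 / m.horizon * L * (ω ^ 4 * y) / L ^ 4 := by gcongr
      _ = _ := by rw [div_pow]; ring
  · have e4 : √(2 / m.horizon) ≤ √L := Real.sqrt_le_sqrt h.horizon_log
    have e5 : ω ^ 2 ≤ 1 := by nlinarith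
    calc √(2 / m.horizon) * √L * (ω / L) ^ 2 ≤ √L * √L * (ω / L) ^ 2 := by gcongr
      _ = ω ^ 2 / L := by rw [hSS]; field_simp
      _ ≤ 1 := by rw [div_le_one (by linarith)]; linarith

/-- The errors of the observed demand rates in period `k` of Step 3. -/
lemma noise_stepC (s : ℝ) (k : ℕ) :
    noise (Real.log n) (n * M * (periodC (m.scale n) n d s D k).step) ≤
      n * (periodC (m.scale n) n d s D k).step * (noiseConst M m.horizon * √(Real.log n) *
        (widthC n d (k + 1) / Real.log n)) := by
  obtain ⟨hS, hSS⟩ := h.sqrt_log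
  have hL := h.log_ge
  have hT := h.horizon_pos
  have hn := natCast_pos_of_two_le h.two_le
  have hω := widthC_pos (d := d) h.two_le (k + 1)
  have hω1 := h.widthC_le_one (k + 1)
  have hκ := h.kappaC_ge k
  have hτ := tauC_pos (d := d) h.two_le k
  have hκ2 := natCeil_le_two_mul (κ := kappaC n d k) (by linarith)
  have hκ1 := Nat.le_ceil (kappaC n d k)
  set L := Real.log n with hLdef
  set ω := widthC n d (k + 1) with hωdef
  have hstep : (periodC (m.scale n) n d s D k).step =
      m.horizon * tauC n d k / ⌈kappaC n d k⌉₊ := by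
    rw [Period.step, periodC_length, periodC_grid]; rfl
  set y := (n : ℝ) * (periodC (m.scale n) n d s D k).step with hy
  have hy1 : m.horizon / 2 * L ^ 2 ≤ ω ^ 2 * y := by
    have e1 := tauC_mul_pow (d := d) h.two_le k
    rw [hy, hstep]
    have e2 : ω ^ 2 * (n * (m.horizon * tauC n d k / ⌈kappaC n d k⌉₊)) =
        m.horizon * (kappaC n d k * L ^ 2) / ⌈kappaC n d k⌉₊ := by
      rw [← e1]; ring
    rw [e2, le_div_iff₀ (by linarith)]
    calc m.horizon / 2 * L ^ 2 * ⌈kappaC n d k⌉₊ ≤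
        m.horizon / 2 * L ^ 2 * (2 * kappaC n d k) := by gcongr
      _ = _ := by ring
  have hy0 : 0 ≤ y := by rw [hy, hstep]; positivity
  have hθ : (√(2 / m.horizon) * √L * (ω / L)) ^ 2 = 2 / m.horizon * L * (ω / L) ^ 2 := by
    rw [mul_pow, mul_pow, Real.sq_sqrt (by positivity), Real.sq_sqrt (by linarith)]
  have key := noise_le (L := L) (M := M) (y := y) (θ := √(2 / m.horizon) * √L * (ω / L))
    h.M_pos.le hy0 ?_ (by positivity) ?_
  · rw [noiseConst]
    calc _ = noise L (M * y) := by rw [hy]; ring_nf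
      _ ≤ _ := key
      _ = _ := by ring
  · rw [hθ]
    have e3 : L = 2 / m.horizon * L * (m.horizon / 2 * L ^ 2) / L ^ 2 := by
      field_simp
    calc L = 2 / m.horizon * L * (m.horizon / 2 * L ^ 2) / L ^ 2 := e3
      _ ≤ 2 / m.horizon * L * (ω ^ 2 * y) / L ^ 2 := by gcongr
      _ = _ := by rw [div_pow]; ring
  · have e4 : √(2 / m.horizon) ≤ √L := Real.sqrt_le_sqrt h.horizon_log
    calc √(2 / m.horizon) * √L * (ω / L) ≤ √L * √L * (ω / L) := by gcongr
      _ = ω := by rw [hSS]; field_simp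
      _ ≤ 1 := hω1

end

end Tuned

/-! ### Accuracy of the empirical prices and shrinking of the price intervals -/

namespace Tuned

variable {m : Market} {n : ℕ} {d : ℝ} {lam : ℝ → ℝ} {M K ε R growth curv bend pu pc η : ℝ}
  {D : ℝ → ℕ} {s : ℝ} {k : ℕ}

lemma target_eq (m : Market) (n : ℕ) :
    (m.scale n).inventory / (m.scale n).horizon = n * (m.inventory / m.horizon) :=
  mul_div_assoc _ _ _

section

variable (h : Tuned m n d lam M K ε R growth curv bend pu pc η)
include h

lemma η_le {N : ℕ} (hN : η * 2 ^ N ≤ ε) (hk : k ≤ N) : η ≤ ε / 2 ^ k := by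
  rw [le_div_iff₀ (by positivity)]
  refine le_trans ?_ hN
  have := h.η_pos
  gcongr
  norm_num

/-- The estimates at the end of period `k` of Step 2. -/
lemma estimatesU (hk : k ≤ periodsU n d)
    (hloc : LocatedU m n d lam M K ε curv bend pu pc k (periodU (m.scale n) n d D k))
    (hν : ∀ j < (periodU (m.scale n) n d D k).grid,
      |(periodU (m.scale n) n d D k).rate D j - n * lam ((periodU (m.scale n) n d D k).price j)| ≤
        n * (noiseConst M m.horizon * √(Real.log n) * (widthU n d (k + 1) / Real.log n) ^ 2)) :
    |(periodU (m.scale n) n d D k).hatU D - max (periodU (m.scale n) n d D k).a pu| ≤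
      √(Real.log n) * (periodU (m.scale n) n d D k).mesh / 4 ∧
    |(periodU (m.scale n) n d D k).hatC (n * (m.inventory / m.horizon)) D -
      max (periodU (m.scale n) n d D k).a pc| ≤
      √(Real.log n) * (periodU (m.scale n) n d D k).mesh / 4 := by
  obtain ⟨hS, hSS⟩ := h.sqrt_log
  have hL := h.log_ge
  have hn := natCast_pos_of_two_le h.two_le
  have hreg := h.regularU D k
  have hω := widthU_pos (d := d) h.two_le (k + 1)
  have hω1 := h.widthU_le_one (k + 1)
  have hA := noiseConst_nonneg M m.horizon
  have hη := h.η_le h.η_leU hk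
  have hR := h.R_nonneg
  have hη0 := h.η_pos
  have hest := h.estimateU
  have hestC := h.estimateC
  have hK2 := h.sqrt_log_ge
  have hle := hloc.le_mesh
  have hme := hloc.mesh_le
  have e1 := hreg.hatU_estimate h.toPriceFacts h.lo_nonneg h.curv_nonneg hn hν
    ((le_max_left _ _).trans hloc.best_mem.2)
  have e2 := hreg.hatC_estimate h.toPriceFacts h.K_pos.le hn hν
    ((le_max_right _ _).trans hloc.best_mem.2)
  set g := (periodU (m.scale n) n d D k).mesh
  set L := Real.log n
  set A := noiseConst M m.horizon
  set x := widthU n d (k + 1) / L with hx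
  have hx0 : 0 < x := by positivity
  have hLx : L * x ≤ 1 := by
    rw [hx]
    calc L * (widthU n d (k + 1) / L) = widthU n d (k + 1) := by field_simp
      _ ≤ 1 := hω1
  have hgx : η * x ≤ g := by
    refine le_trans ?_ hle
    gcongr
  have hg0 : 0 < g := (mul_pos hη0 hx0).trans_le hgx
  constructor
  -- Squares are compared. Mesh and noise are both measured in `x`, the nominal mesh; `η * x ≤ g`
  -- converts the bound back to the actual mesh, and the extra power of `√L` in `estimateU` beats
  -- the constants.
  · refine abs_le_of_sq_le_sq ?_ (by positivity)
    refine le_of_mul_le_mul_left (e1.trans ?_) h.growth_pos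
    calc curv * g ^ 2 + 2 * (R * (A * √L * x ^ 2))
        ≤ curv * (K * M * x) ^ 2 + 2 * (R * (A * √L * x ^ 2)) := by
          have := h.curv_nonneg
          gcongr
      _ = (16 * (curv * (K * M) ^ 2 + 2 * (R * A) * √L)) * x ^ 2 / 16 := by ring
      _ ≤ (growth * L * η ^ 2) * x ^ 2 / 16 := by gcongr
      _ = growth * (√L * √L) * (η * x) ^ 2 / 16 := by rw [hSS]; ring
      _ ≤ growth * (√L * √L) * g ^ 2 / 16 := by
          have := h.growth_pos
          gcongr
      _ = _ := by ring
  · refine e2.trans ?_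
    have e3 : K ^ 2 * g ≤ √L / 8 * g := by gcongr; linarith
    -- The noise is quadratic in `x` and hence negligible here, since `L * x ≤ 1`.
    have e4 : 2 * (K * (A * √L * x ^ 2)) ≤ √L * g / 8 := by
      calc 2 * (K * (A * √L * x ^ 2)) = (16 * (K * A)) * (√L * x ^ 2) / 8 := by ring
        _ ≤ (√L * η) * (√L * x ^ 2) / 8 := by gcongr
        _ = (√L * √L * x) * (η * x) / 8 := by ring
        _ = (L * x) * (η * x) / 8 := by rw [hSS]
        _ ≤ 1 * g / 8 := by gcongr
        _ ≤ √L * g / 8 := by gcongr; linarith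
    linarith

/-- The estimate at the end of period `k` of Step 3. -/
lemma estimateC_period (hk : k ≤ periodsC n d)
    (hloc : LocatedC n d M K ε pc k (periodC (m.scale n) n d s D k))
    (hν : ∀ j < (periodC (m.scale n) n d s D k).grid,
      |(periodC (m.scale n) n d s D k).rate D j -
        n * lam ((periodC (m.scale n) n d s D k).price j)| ≤
        n * (noiseConst M m.horizon * √(Real.log n) * (widthC n d (k + 1) / Real.log n))) :
    |(periodC (m.scale n) n d s D k).hatC (n * (m.inventory / m.horizon)) D - pc| ≤
      Real.log n * (periodC (m.scale n) n d s D k).mesh / 4 := by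
  obtain ⟨hS, hSS⟩ := h.sqrt_log
  have hL := h.log_ge
  have hn := natCast_pos_of_two_le h.two_le
  have hreg := h.regularC s D k
  have hω := widthC_pos (d := d) h.two_le (k + 1)
  have hA := noiseConst_nonneg M m.horizon
  have hη := h.η_le h.η_leC hk
  have hη0 := h.η_pos
  have hestC := h.estimateC
  have hK2 := h.sqrt_log_ge
  have hle := hloc.le_mesh
  have e2 := hreg.hatC_estimate h.toPriceFacts h.K_pos.le hn hν hloc.pc_mem.2
  rw [max_eq_right hloc.pc_mem.1] at e2
  set g := (periodC (m.scale n) n d s D k).mesh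
  set L := Real.log n
  set A := noiseConst M m.horizon
  set x := widthC n d (k + 1) / L with hx
  have hx0 : 0 < x := by positivity
  have hgx : η * x ≤ g := by
    refine le_trans ?_ hle
    gcongr
  have hg0 : 0 < g := (mul_pos hη0 hx0).trans_le hgx
  refine e2.trans ?_
  have e3 : K ^ 2 * g ≤ L / 8 * g := by
    gcongr
    nlinarith
  have e4 : 2 * (K * (A * √L * x)) ≤ L * g / 8 := by
    calc 2 * (K * (A * √L * x)) = (16 * (K * A)) * (√L * x) / 8 := by ring
      _ ≤ (√L * η) * (√L * x) / 8 := by gcongr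
      _ = √L * √L * (η * x) / 8 := by ring
      _ = L * (η * x) / 8 := by rw [hSS]
      _ ≤ L * g / 8 := by gcongr
  linarith

lemma mesh_pos_of_locatedU {q : Period}
    (hloc : LocatedU m n d lam M K ε curv bend pu pc k q) : 0 < q.mesh := by
  refine lt_of_lt_of_le ?_ hloc.le_mesh
  have := h.ε_pos
  have := widthU_pos (d := d) h.two_le (k + 1)
  have := h.log_ge
  positivity

/-- If Step 3 is entered, then the inventory is scarce. -/
lemma scarce_of_transition
    (hloc : LocatedU m n d lam M K ε curv bend pu pc k (periodU (m.scale n) n d D k))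
    (hU : |(periodU (m.scale n) n d D k).hatU D - max (periodU (m.scale n) n d D k).a pu| ≤
      √(Real.log n) * (periodU (m.scale n) n d D k).mesh / 4)
    (hC : |(periodU (m.scale n) n d D k).hatC (n * (m.inventory / m.horizon)) D -
      max (periodU (m.scale n) n d D k).a pc| ≤
      √(Real.log n) * (periodU (m.scale n) n d D k).mesh / 4)
    (ht : transition (m.scale n) n d D k) : pu < pc ∧ m.lo < pc := by
  have hg := h.mesh_pos_of_locatedU hloc
  obtain ⟨hS, hSS⟩ := h.sqrt_log
  have hlo := (h.regularU D k).lo_le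
  rw [transition, target_eq] at ht
  set g := (periodU (m.scale n) n d D k).mesh
  set a := (periodU (m.scale n) n d D k).a
  have hSg : 0 < √(Real.log n) * g := by positivity
  -- The margin `2 √L g` of the transition exceeds the two errors of `√L g / 4`.
  have h1 : max a pu < max a pc := by linarith [(abs_le.1 hU).1, (abs_le.1 hC).2]
  have h2 : a < pc := by
    by_contra! hcon
    rw [max_eq_left hcon] at h1
    exact absurd (le_max_left a pu) (not_le.2 h1)
  rw [max_eq_right h2.le] at h1
  exact ⟨(le_max_right _ _).trans_lt h1, hlo.trans_lt h2⟩

/-- If Step 2 goes on, then its next period has located the optimal price more accurately. -/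
lemma locatedU_succ
    (hloc : LocatedU m n d lam M K ε curv bend pu pc k (periodU (m.scale n) n d D k))
    (hU : |(periodU (m.scale n) n d D k).hatU D - max (periodU (m.scale n) n d D k).a pu| ≤
      √(Real.log n) * (periodU (m.scale n) n d D k).mesh / 4)
    (hC : |(periodU (m.scale n) n d D k).hatC (n * (m.inventory / m.horizon)) D -
      max (periodU (m.scale n) n d D k).a pc| ≤
      √(Real.log n) * (periodU (m.scale n) n d D k).mesh / 4)
    (ht : ¬ transition (m.scale n) n d D k) :
    |max ((periodU (m.scale n) n d D k).hatC (n * (m.inventory / m.horizon)) D)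
      ((periodU (m.scale n) n d D k).hatU D) - max pu pc| ≤
        √(Real.log n) * (periodU (m.scale n) n d D k).mesh / 4 ∧
    (periodU (m.scale n) n d D (k + 1)).a = max ((periodU (m.scale n) n d D k).hatC
      (n * (m.inventory / m.horizon)) D) ((periodU (m.scale n) n d D k).hatU D) -
        Real.log n / 3 * (periodU (m.scale n) n d D k).mesh ∧
    (periodU (m.scale n) n d D (k + 1)).b = max ((periodU (m.scale n) n d D k).hatC
      (n * (m.inventory / m.horizon)) D) ((periodU (m.scale n) n d D k).hatU D) +
        2 * Real.log n / 3 * (periodU (m.scale n) n d D k).mesh ∧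
    LocatedU m n d lam M K ε curv bend pu pc (k + 1) (periodU (m.scale n) n d D (k + 1)) := by
  have hg := h.mesh_pos_of_locatedU hloc
  obtain ⟨hS, hSS⟩ := h.sqrt_log
  have hL := h.log_ge
  have hreg := h.regularU D k
  have hreg' := h.regularU D (k + 1)
  have hbest := h.best_mem
  have hbm := hloc.best_mem
  have hle := hloc.le_mesh
  have hme := hloc.mesh_le
  have hleft := hloc.left
  have hκ := h.kappaU_ge (k + 1)
  have hws := widthU_succ (d := d) h.two_le (k + 1)
  have hKM := h.KM_widthU_le k
  have hω := widthU_pos (d := d) h.two_le (k + 1)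
  have ha' : (periodU (m.scale n) n d D (k + 1)).a = max m.lo
      (max ((periodU (m.scale n) n d D k).hatC ((m.scale n).inventory / (m.scale n).horizon) D)
        ((periodU (m.scale n) n d D k).hatU D) -
          Real.log n / 3 * (periodU (m.scale n) n d D k).mesh) := rfl
  have hb' : (periodU (m.scale n) n d D (k + 1)).b = min m.hi
      (max ((periodU (m.scale n) n d D k).hatC ((m.scale n).inventory / (m.scale n).horizon) D)
        ((periodU (m.scale n) n d D k).hatU D) +
          2 * Real.log n / 3 * (periodU (m.scale n) n d D k).mesh) := rfl
  rw [target_eq] at ha' hb'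
  rw [transition, target_eq, not_lt] at ht
  set q := periodU (m.scale n) n d D k
  set q' := periodU (m.scale n) n d D (k + 1)
  set L := Real.log n
  set pD := max pu pc with hpD
  set hC' := q.hatC (n * (m.inventory / m.horizon)) D
  set hU' := q.hatU D
  set ω := widthU n d (k + 1) with hωdef
  have hLg : √L * (√L * q.mesh) = L * q.mesh := by rw [← mul_assoc, hSS]
  have hSg : 10 * q.mesh ≤ √L * q.mesh := by gcongr
  have hLg' : 10 * (√L * q.mesh) ≤ L * q.mesh := by
    rw [← hLg]
    gcongr
  have hLgω : L * q.mesh ≤ K * M * ω := by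
    calc L * q.mesh ≤ L * (K * M * (ω / L)) := by gcongr
      _ = K * M * ω := by field_simp
  have hLgε : L * q.mesh ≤ ε := hLgω.trans hKM
  -- The maximum is 1-Lipschitz, and clipping at `q.a` does not matter because `q.a ≤ pD`.
  have hp : |max hC' hU' - pD| ≤ √L * q.mesh / 4 := by
    have h1 := abs_max_sub_max_le_max hC' hU' (max q.a pc) (max q.a pu)
    rw [show max (max q.a pc) (max q.a pu) = pD by
      rw [max_max_max_comm, max_self, max_comm pc pu, ← hpD, max_eq_right hbm.1]] at h1
    exact h1.trans (max_le hC hU)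
  obtain ⟨hp1, hp2⟩ := abs_le.1 hp
  -- Without a transition `pc` exceeds `pu`, both clipped at `q.a`, by at most `2 + 1/4 + 1/4 = 5/2`
  -- units of `√L * mesh`.
  have hnear : pD ≤ max q.a pu + 5 / 2 * (√L * q.mesh) := by
    have h1 : max q.a pc ≤ max q.a pu + 5 / 2 * (√L * q.mesh) := by
      linarith [(abs_le.1 hU).2, (abs_le.1 hC).1]
    have hSg0 : 0 ≤ √L * q.mesh := by positivity
    refine max_le ?_ ((le_max_right _ _).trans h1)
    linarith [le_max_right q.a pu]
  -- Otherwise `pD` would be within `5/2 √L g` of the left end, whereas `left` guarantees a distance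
  -- of `3 √L g` unless the interval starts at `lo`.
  have hpua : q.a ≤ pu := by
    by_contra! hcon
    rw [max_eq_left hcon.le] at hnear
    rcases hleft with hl | hl
    · exact absurd h.pu_mem.1 (by rw [← hl]; exact not_le.2 hcon)
    · linarith
  rw [max_eq_right hpua] at hnear
  have hpupD : pu ≤ pD := le_max_left _ _
  have hpulo : m.lo < pu := by linarith [hbest.1, h.ε_pos]
  -- The truncation at `lo` and `hi` is inactive: the new interval contains `pD`, has length at most
  -- `ε`, and `pD` is `ε` away from both ends.
  have ha : q'.a = max hC' hU' - L / 3 * q.mesh := by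
    rw [ha', max_eq_right]
    linarith [hbest.1]
  have hb : q'.b = max hC' hU' + 2 * L / 3 * q.mesh := by
    rw [hb', min_eq_right]
    linarith [hbest.2]
  have hbest' : pD ∈ Icc q'.a q'.b := by
    rw [ha, hb]
    constructor <;> linarith
  have hmesh' : q'.mesh = L * q.mesh / ⌈kappaU n d (k + 1)⌉₊ := by
    rw [Period.mesh, periodU_grid, ha, hb]
    congr 1
    ring
  have hbounds := div_natCeil_bounds (κ := kappaU n d (k + 1)) (by linarith)
    (W₁ := L * (ε / 2 ^ k * (ω / L))) (W₂ := L * (K * M * (ω / L)))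
    (show 0 ≤ L * q.mesh by positivity) (by gcongr) (by gcongr)
  have hx : widthU n d (k + 1 + 1) / L = ω / kappaU n d (k + 1) := by
    have : kappaU n d (k + 1) ≠ 0 := by linarith
    rw [div_eq_div_iff (by linarith) this]
    exact hws
  have hmeshle : q'.mesh ≤ q.mesh := by
    rw [hmesh', div_le_iff₀ (by linarith [Nat.le_ceil (kappaU n d (k + 1))]), mul_comm]
    gcongr
    exact hκ.trans (Nat.le_ceil _)
  have hmesh0 := hreg'.mesh_nonneg
  have hE : ∀ e, 0 ≤ e → e ≤ curv + bend →
      e * (K * M * ω) ^ 2 ≤ lossConst M K curv bend * ω ^ 2 := by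
    intro e he0 he
    have := h.M_pos
    have := h.K_pos
    calc e * (K * M * ω) ^ 2 ≤ (curv + bend) * (K * M * ω) ^ 2 := by gcongr
      _ = ((curv + bend) * (K * M) ^ 2) * ω ^ 2 := by ring
      _ ≤ _ := by
        unfold lossConst
        gcongr
        have : 0 ≤ K ^ 2 * M + M := by positivity
        linarith
  refine ⟨hp, ha, hb, hbest', ?_, ?_, fun p hp' => ?_, ?_, Or.inr ?_⟩
  · rw [hx, hmesh']
    refine le_trans (le_of_eq ?_) hbounds.1
    rw [pow_succ]
    field_simp
  · rw [hx, hmesh']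
    refine hbounds.2.trans (le_of_eq ?_)
    field_simp
  -- Since `pu` is near `pD`, the loss relative to the maximum at `pu` is already quadratic in the
  -- width.
  · have h1 := h.le_curv hpulo p (hreg'.mem_of_mem hp')
    have h2 := h.le_opt pD h.best_mem_Icc
    have h3 : |p - pu| ≤ K * M * ω := by
      rw [ha, hb] at hp'
      rw [abs_le]
      constructor <;> linarith [hp'.1, hp'.2]
    have h4 : (p - pu) ^ 2 ≤ (K * M * ω) ^ 2 := by
      rw [← sq_abs]
      gcongr
    have h5 := mul_le_mul_of_nonneg_left h4 h.curv_nonneg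
    have h6 := hE curv h.curv_nonneg (by linarith [h.bend_nonneg])
    linarith
  · obtain ⟨s, hs, hs'⟩ := h.slope
    have hsum := hreg'.sum_price
    have hgrid : (0 : ℝ) ≤ q'.grid := Nat.cast_nonneg _
    -- The asymmetry at work: the midpoint exceeds the empirical price by `L g / 6`, which outweighs
    -- its error `√L g / 4` and the half mesh. The linear terms of the demand therefore sum to
    -- something nonpositive.
    have hmean : 0 ≤ (q'.a + q'.b) / 2 - q'.mesh / 2 - pD := by
      rw [ha, hb]
      linarith
    calc _ ≤ ∑ j ∈ Finset.range q'.grid,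
          (-s * (q'.price j - pD) + bend * (K * M * ω) ^ 2) := by
          refine Finset.sum_le_sum fun j hj => ?_
          have hpj := hreg'.price_mem (Finset.mem_range.1 hj)
          have h1 := hs' _ (hreg'.mem_of_mem hpj)
          have h2 : |q'.price j - pD| ≤ K * M * ω := by
            rw [ha, hb] at hpj
            rw [abs_le]
            constructor <;> linarith [hpj.1, hpj.2]
          have h4 : (q'.price j - pD) ^ 2 ≤ (K * M * ω) ^ 2 := by
            rw [← sq_abs]
            gcongr
          have h5 := mul_le_mul_of_nonneg_left h4 h.bend_nonneg
          have h6 := h.lam_best_le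
          linarith
      _ = -s * (q'.grid * ((q'.a + q'.b) / 2 - q'.mesh / 2 - pD)) +
          q'.grid * (bend * (K * M * ω) ^ 2) := by
          rw [Finset.sum_add_distrib, ← Finset.mul_sum, Finset.sum_sub_distrib, hsum,
            Finset.sum_const, Finset.sum_const, Finset.card_range, nsmul_eq_mul, nsmul_eq_mul]
          ring
      _ ≤ 0 + q'.grid * (lossConst M K curv bend * ω ^ 2) := by
          have h1 := mul_nonneg hs (mul_nonneg hgrid hmean)
          have h2 := mul_le_mul_of_nonneg_left
            (hE bend h.bend_nonneg (by linarith [h.curv_nonneg])) hgrid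
          linarith
      _ = _ := zero_add _
  -- The left margin is renewed: `L / 3 - √L / 4 ≥ 3 √L` because `√L ≥ 10`.
  · have h1 : √L * q'.mesh ≤ √L * q.mesh := by gcongr
    rw [ha]
    linarith

lemma locatedC_zero :
    LocatedC n d M K ε pc 0 (periodC (m.scale n) n d s D 0) := by
  have hL := h.log_ge
  have hκ := h.kappaC_ge 0
  have hw := widthC_succ (d := d) h.two_le 0
  rw [widthC_zero, one_mul] at hw
  have hx : widthC n d (0 + 1) / Real.log n = 1 / kappaC n d 0 := by
    rw [← hw]
    have := widthC_pos (d := d) h.two_le (0 + 1)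
    have : kappaC n d 0 ≠ 0 := by linarith
    field_simp
  have hb := div_natCeil_bounds (κ := kappaC n d 0) (by linarith)
    (show 0 ≤ m.hi - m.lo by linarith [h.lo_lt]) h.width_ge h.width_le
  refine ⟨h.pc_mem, ?_, ?_, ?_⟩
  · rw [hx]
    refine le_trans (le_of_eq ?_) hb.1
    ring
  · rw [hx]
    refine hb.2.trans (le_of_eq ?_)
    ring
  · rw [widthC_zero, mul_one]
    exact h.width_le

/-- The symmetric interval suffices, since Step 3 affords a first-order loss. Truncation is inactive
because `pc` is the best price when inventory is scarce. -/
lemma locatedC_succ (hpc : pu < pc)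
    (hloc : LocatedC n d M K ε pc k (periodC (m.scale n) n d s D k))
    (hC : |(periodC (m.scale n) n d s D k).hatC (n * (m.inventory / m.horizon)) D - pc| ≤
      Real.log n * (periodC (m.scale n) n d s D k).mesh / 4) :
    LocatedC n d M K ε pc (k + 1) (periodC (m.scale n) n d s D (k + 1)) ∧
    (periodC (m.scale n) n d s D k).hatC (n * (m.inventory / m.horizon)) D ∈
      Icc (periodC (m.scale n) n d s D (k + 1)).a (periodC (m.scale n) n d s D (k + 1)).b := by
  have hL := h.log_ge
  have hreg' := h.regularC s D (k + 1)
  have hbest := h.best_mem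
  rw [max_eq_right hpc.le] at hbest
  have hle := hloc.le_mesh
  have hme := hloc.mesh_le
  have hκ := h.kappaC_ge (k + 1)
  have hws := widthC_succ (d := d) h.two_le (k + 1)
  have hKM := h.KM_widthC_le k
  have hω := widthC_pos (d := d) h.two_le (k + 1)
  have hg : 0 < (periodC (m.scale n) n d s D k).mesh := by
    refine lt_of_lt_of_le ?_ hle
    have := h.ε_pos
    positivity
  have ha' : (periodC (m.scale n) n d s D (k + 1)).a = max m.lo
      ((periodC (m.scale n) n d s D k).hatC ((m.scale n).inventory / (m.scale n).horizon) D -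
          Real.log n / 2 * (periodC (m.scale n) n d s D k).mesh) := rfl
  have hb' : (periodC (m.scale n) n d s D (k + 1)).b = min m.hi
      ((periodC (m.scale n) n d s D k).hatC ((m.scale n).inventory / (m.scale n).horizon) D +
          Real.log n / 2 * (periodC (m.scale n) n d s D k).mesh) := rfl
  rw [target_eq] at ha' hb'
  set q := periodC (m.scale n) n d s D k
  set q' := periodC (m.scale n) n d s D (k + 1)
  set L := Real.log n
  set p := q.hatC (n * (m.inventory / m.horizon)) D
  set ω := widthC n d (k + 1) with hωdef
  have hLg0 : 0 < L * q.mesh := by positivity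
  have hLgω : L * q.mesh ≤ K * M * ω := by
    calc L * q.mesh ≤ L * (K * M * (ω / L)) := by gcongr
      _ = K * M * ω := by field_simp
  have hLgε : L * q.mesh ≤ ε := hLgω.trans hKM
  obtain ⟨hp1, hp2⟩ := abs_le.1 hC
  have ha : q'.a = p - L / 2 * q.mesh := by
    rw [ha', max_eq_right]
    linarith [hbest.1]
  have hb : q'.b = p + L / 2 * q.mesh := by
    rw [hb', min_eq_right]
    linarith [hbest.2]
  have hmesh' : q'.mesh = L * q.mesh / ⌈kappaC n d (k + 1)⌉₊ := by
    rw [Period.mesh, periodC_grid, ha, hb]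
    congr 1
    ring
  have hbounds := div_natCeil_bounds (κ := kappaC n d (k + 1)) (by linarith)
    (W₁ := L * (ε / 2 ^ k * (ω / L))) (W₂ := L * (K * M * (ω / L)))
    (show 0 ≤ L * q.mesh by positivity) (by gcongr) (by gcongr)
  have hx : widthC n d (k + 1 + 1) / L = ω / kappaC n d (k + 1) := by
    have : kappaC n d (k + 1) ≠ 0 := by linarith
    rw [div_eq_div_iff (by linarith) this]
    exact hws
  refine ⟨⟨?_, ?_, ?_, ?_⟩, ?_⟩
  · rw [ha, hb]
    constructor <;> linarith
  · rw [hx, hmesh']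
    refine le_trans (le_of_eq ?_) hbounds.1
    rw [pow_succ]
    field_simp
  · rw [hx, hmesh']
    refine hbounds.2.trans (le_of_eq ?_)
    field_simp
  · rw [ha, hb]
    linarith
  · rw [ha, hb]
    constructor <;> linarith

end

end Tuned

/-! ### The price in force in each phase of the algorithm -/

section Policy

variable {m : Market} {n : ℕ} {d : ℝ} {D : ℝ → ℕ} {k : ℕ} {t : ℝ}

lemma uncensoredDpa_stepTwo (hn : 2 ≤ n) (hT : 0 < m.horizon) (hk : k < periodsU n d)
    (hno : ∀ i < k, ¬ transition m n d D i) (ht : t ∈ Ico (startU m n d k) (startU m n d (k + 1))) :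
    uncensoredDpa m n d D t = (periodU m n d D k).priceAt t := by
  have hmono := startU_mono (d := d) hn hT
  rw [uncensoredDpa, if_neg, priceU, if_pos (ht.2.trans_le (hmono hk)), stepIndex_eq hmono ht]
  rintro ⟨i, hi, hit, htr⟩
  have : k ≤ i := by
    by_contra! hcon
    exact hno i hcon htr
  exact absurd (ht.2.trans_le (hmono (by omega : k + 1 ≤ i + 1))) (not_lt.2 hit)

lemma uncensoredDpa_finalU (hno : ∀ i < periodsU n d, ¬ transition m n d D i)
    (ht : startU m n d (periodsU n d) ≤ t) : uncensoredDpa m n d D t = finalPriceU m n d D := by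
  rw [uncensoredDpa, if_neg, priceU, if_neg (not_lt.2 ht)]
  rintro ⟨i, hi, -, htr⟩
  exact hno i hi htr

lemma uncensoredDpa_of_transition (hk : k < periodsU n d) (hno : ∀ i < k, ¬ transition m n d D i)
    (htr : transition m n d D k) (ht : startU m n d (k + 1) ≤ t) :
    uncensoredDpa m n d D t = priceC m n d (startU m n d (k + 1)) D t := by
  have h1 : transitionIndex m n d D = k := by
    have h2 := transitionIndex_spec (m := m) (D := D) ⟨k, hk, htr⟩
    refine le_antisymm (Nat.sInf_le ⟨hk, htr⟩) ?_
    by_contra! hcon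
    exact hno _ hcon h2.2
  rw [uncensoredDpa, if_pos ⟨k, hk, ht, htr⟩, h1]

lemma priceC_stepThree (hn : 2 ≤ n) (hT : 0 < m.horizon) {s : ℝ} (hk : k < periodsC n d)
    (ht : t ∈ Ico (s + startC m n d k) (s + startC m n d (k + 1))) :
    priceC m n d s D t = (periodC m n d s D k).priceAt t := by
  have hmono : Monotone fun k => s + startC m n d k := fun i j hij =>
    by simpa using startC_mono (d := d) hn hT hij
  rw [priceC, if_pos (ht.2.trans_le (hmono hk)), stepIndex_eq hmono ht]

lemma priceC_final {s : ℝ} (ht : s + startC m n d (periodsC n d) ≤ t) :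
    priceC m n d s D t = finalPriceC m n d s D := by
  rw [priceC, if_neg (not_lt.2 ht)]

end Policy

lemma Window.mono {n ρ c : ℝ} {F G : ℝ → ℝ} {u v e e' : ℝ} (hn : 0 ≤ n)
    (h : Window n ρ c F G u v e) (he : e ≤ e') : Window n ρ c F G u v e' := by
  have := mul_le_mul_of_nonneg_left he hn
  obtain ⟨h1, h2⟩ := h
  exact ⟨by linarith, by linarith⟩

/-! ### Revenue and demand of a single learning period -/

namespace Tuned

variable {m : Market} {n : ℕ} {d : ℝ} {lam : ℝ → ℝ} {M K ε R growth curv bend pu pc η : ℝ}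
  {D : ℝ → ℕ} {G : ℝ → ℝ} {s : ℝ} {k : ℕ}

/-- The order of the regret. -/
noncomputable def order (n : ℕ) (d : ℝ) : ℝ := (n : ℝ) ^ (-d) * Real.log n ^ 5

section

variable (h : Tuned m n d lam M K ε R growth curv bend pu pc η)
include h

lemma order_nonneg : 0 ≤ order n d := by
  have := h.log_ge
  unfold order
  positivity

lemma log_pow_le : (n : ℝ) ^ (-d) * Real.log n ^ 3 ≤ order n d := by
  have := h.log_ge
  unfold order
  gcongr
  · linarith
  · norm_num

/-- As `d ≤ 1/2`, the quantity `n * order` is at least `√n * log n`. It therefore absorbs the random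
fluctuation over the whole season and the rounding of the stock to whole units. -/
lemma one_le_mul_order : 1 ≤ n * order n d ∧
    noise (Real.log n) (n * M * m.horizon) ≤ n * ((5 * √(M * m.horizon) + 12) * order n d) := by
  have hL := h.log_ge
  have hn := natCast_pos_of_two_le h.two_le
  have hn1 : (1 : ℝ) ≤ n := by exact_mod_cast (by linarith [h.two_le] : 1 ≤ n)
  have hM := h.M_pos
  have hT := h.horizon_pos
  have h1 : √(n : ℝ) ≤ n * (n : ℝ) ^ (-d) := by
    rw [Real.sqrt_eq_rpow]
    nth_rewrite 2 [← Real.rpow_one (n : ℝ)]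
    rw [← Real.rpow_add hn]
    exact Real.rpow_le_rpow_of_exponent_le hn1 (by linarith [h.d_le])
  have h2 : 1 ≤ √(n : ℝ) := Real.one_le_sqrt.2 hn1
  have h3 : Real.log n ≤ Real.log n ^ 5 := le_self_pow₀ (by linarith) (by norm_num)
  have h4 : √(n : ℝ) * Real.log n ≤ n * order n d := by
    unfold order
    rw [← mul_assoc]
    gcongr
  have h5 : Real.log n ≤ √(n : ℝ) * Real.log n := by nlinarith
  refine ⟨by linarith, ?_⟩
  have h6 : √(Real.log n * (n * M * m.horizon)) ≤ √(n : ℝ) * Real.log n * √(M * m.horizon) := by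
    rw [show Real.log n * (n * M * m.horizon) = n * (Real.log n * (M * m.horizon)) by ring,
      Real.sqrt_mul hn.le, Real.sqrt_mul (by linarith), mul_assoc]
    gcongr
    rw [Real.sqrt_le_left (by linarith)]
    nlinarith
  have h7 : √(n : ℝ) * Real.log n * √(M * m.horizon) ≤ n * order n d * √(M * m.horizon) := by
    gcongr
  unfold noise
  linarith

/-- A period of Step 2 that begins well. -/
lemma periodU_window (hG : GoodPath (uncensoredDpa (m.scale n) n d) lam n M (Real.log n) m.horizon
      D G) (hk : k < periodsU n d) (hno : ∀ i < k, ¬ transition (m.scale n) n d D i)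
    (hloc : LocatedU m n d lam M K ε curv bend pu pc k (periodU (m.scale n) n d D k)) :
    |(periodU (m.scale n) n d D k).hatU D - max (periodU (m.scale n) n d D k).a pu| ≤
      √(Real.log n) * (periodU (m.scale n) n d D k).mesh / 4 ∧
    |(periodU (m.scale n) n d D k).hatC (n * (m.inventory / m.horizon)) D -
      max (periodU (m.scale n) n d D k).a pc| ≤
      √(Real.log n) * (periodU (m.scale n) n d D k).mesh / 4 ∧
    Window n (max pu pc * lam (max pu pc)) (m.inventory / m.horizon)
      (GoodPath.revenueBefore (uncensoredDpa (m.scale n) n d) D) G (startU m n d k)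
      (startU m n d (k + 1))
      (m.horizon * (lossConst M K curv bend + R * noiseConst M m.horizon) * order n d) := by
  obtain ⟨hS, hSS⟩ := h.sqrt_log
  have hL := h.log_ge
  have hn := natCast_pos_of_two_le h.two_le
  have hreg := h.regularU D k
  have hmono := startU_mono (d := d) h.two_le h.horizon_pos
  have hR := h.R_nonneg
  have hA := noiseConst_nonneg M m.horizon
  have hend : (periodU (m.scale n) n d D k).start + (periodU (m.scale n) n d D k).length =
      startU m n d (k + 1) := by
    rw [periodU_start, periodU_length, ← startU_succ]; rfl
  have hstart : (periodU (m.scale n) n d D k).start = startU m n d k := periodU_start D k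
  have h0 : 0 ≤ (periodU (m.scale n) n d D k).start := by
    rw [hstart, ← startU_zero (m := m) (n := n) (d := d)]
    exact hmono (Nat.zero_le k)
  have hT : (periodU (m.scale n) n d D k).start + (periodU (m.scale n) n d D k).length ≤
      m.horizon := by
    rw [hend]
    exact (hmono hk).trans (by linarith [h.startU_le, h.horizon_pos])
  have hpol : ∀ t ∈ Ico (periodU (m.scale n) n d D k).start
      ((periodU (m.scale n) n d D k).start + (periodU (m.scale n) n d D k).length),
      uncensoredDpa (m.scale n) n d D t = (periodU (m.scale n) n d D k).priceAt t := by
    intro t ht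
    rw [hend, hstart] at ht
    exact uncensoredDpa_stepTwo h.two_le h.horizon_pos hk hno ht
  have hν := h.noise_stepU (D := D) k
  obtain ⟨hrate, -, -⟩ := hreg.outcome hG h.lo_nonneg h0 hT hpol hν h.hi_le
  obtain ⟨e1, e2⟩ := h.estimatesU hk.le hloc hrate
  refine ⟨e1, e2, ?_⟩
  -- The error of the rates is dominated by the squared width, so the noise costs no more than the
  -- spread of the prices.
  have hw : (widthU n d (k + 1) / Real.log n) ^ 2 * √(Real.log n) ≤ widthU n d k ^ 2 := by
    have h1 := widthU_antitone (d := d) h.two_le (by linarith [h.d_le]) (Nat.le_succ k)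
    have h2 := widthU_pos (d := d) h.two_le (k + 1)
    calc (widthU n d (k + 1) / Real.log n) ^ 2 * √(Real.log n)
        = widthU n d (k + 1) ^ 2 * (√(Real.log n) / Real.log n ^ 2) := by ring
      _ ≤ widthU n d k ^ 2 * 1 := by
        gcongr
        rw [div_le_one (by positivity)]
        nlinarith
      _ = _ := mul_one _
  have hbound : 0 ≤ R * noiseConst M m.horizon := mul_nonneg hR hA
  have hwin := hreg.window hG hn h.lo_nonneg h0 hT hpol hν h.hi_le
    (ρ := max pu pc * lam (max pu pc)) (c := m.inventory / m.horizon)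
    (e := (lossConst M K curv bend + R * noiseConst M m.horizon) * widthU n d k ^ 2) ?_ ?_
  · rw [hend, hstart] at hwin
    refine hwin.mono hn.le (le_of_eq ?_)
    rw [periodU_length, order, ← tauU_mul_sq h.two_le k]
    change m.horizon * tauU n d k * _ = _
    ring
  · intro j hj
    have h1 := hloc.value _ (hreg.price_mem hj)
    have h2 := mul_le_mul_of_nonneg_left hw hbound
    linarith
  · refine hloc.demand.trans ?_
    have h2 : 0 ≤ R * noiseConst M m.horizon * widthU n d k ^ 2 := by positivity
    gcongr
    linarith

/-- A period of Step 3 that begins well. -/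
lemma periodC_window (hG : GoodPath (uncensoredDpa (m.scale n) n d) lam n M (Real.log n) m.horizon
      D G) (hs0 : 0 ≤ s) (hs : s ≤ m.horizon / 2) (hk : k < periodsC n d) (hpc : pu < pc)
    (hlopc : m.lo < pc)
    (hpolicy : ∀ t, s ≤ t → uncensoredDpa (m.scale n) n d D t = priceC (m.scale n) n d s D t)
    (hloc : LocatedC n d M K ε pc k (periodC (m.scale n) n d s D k)) :
    |(periodC (m.scale n) n d s D k).hatC (n * (m.inventory / m.horizon)) D - pc| ≤
      Real.log n * (periodC (m.scale n) n d s D k).mesh / 4 ∧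
    Window n (max pu pc * lam (max pu pc)) (m.inventory / m.horizon)
      (GoodPath.revenueBefore (uncensoredDpa (m.scale n) n d) D) G (s + startC m n d k)
      (s + startC m n d (k + 1))
      (m.horizon * (lossConst M K curv bend + R * noiseConst M m.horizon) * order n d) := by
  obtain ⟨hS, hSS⟩ := h.sqrt_log
  have hL := h.log_ge
  have hn := natCast_pos_of_two_le h.two_le
  have hreg := h.regularC s D k
  have hmono := startC_mono (d := d) h.two_le h.horizon_pos
  have hR := h.R_nonneg
  have hK := h.K_pos
  have hM := h.M_pos
  have hA := noiseConst_nonneg M m.horizon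
  have hw0 := widthC_pos (d := d) h.two_le k
  have hstart : (periodC (m.scale n) n d s D k).start = s + startC m n d k := periodC_start s D k
  have hend : (periodC (m.scale n) n d s D k).start + (periodC (m.scale n) n d s D k).length =
      s + startC m n d (k + 1) := by
    rw [hstart, periodC_length, startC_succ, add_assoc]; rfl
  have h00 : 0 ≤ startC m n d k := by
    rw [← startC_zero (m := m) (n := n) (d := d)]
    exact hmono (Nat.zero_le k)
  have h0 : 0 ≤ (periodC (m.scale n) n d s D k).start := by
    rw [hstart]
    linarith
  have hT : (periodC (m.scale n) n d s D k).start + (periodC (m.scale n) n d s D k).length ≤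
      m.horizon := by
    rw [hend]
    have h1 : startC m n d (k + 1) ≤ startC m n d (periodsC n d) := hmono hk
    linarith [h.startC_le]
  have hpol : ∀ t ∈ Ico (periodC (m.scale n) n d s D k).start
      ((periodC (m.scale n) n d s D k).start + (periodC (m.scale n) n d s D k).length),
      uncensoredDpa (m.scale n) n d D t = (periodC (m.scale n) n d s D k).priceAt t := by
    intro t ht
    rw [hend, hstart] at ht
    rw [hpolicy t (by linarith [ht.1])]
    exact priceC_stepThree (m := m.scale n) h.two_le h.horizon_pos hk ht
  have hν := h.noise_stepC (D := D) s k
  obtain ⟨hrate, -, -⟩ := hreg.outcome hG h.lo_nonneg h0 hT hpol hν h.hi_le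
  refine ⟨h.estimateC_period hk.le hloc hrate, ?_⟩
  have hw : widthC n d (k + 1) / Real.log n * √(Real.log n) ≤ widthC n d k := by
    have h1 := widthC_antitone (d := d) h.two_le (by linarith [h.d_le]) (Nat.le_succ k)
    have h2 := widthC_pos (d := d) h.two_le (k + 1)
    calc widthC n d (k + 1) / Real.log n * √(Real.log n)
        = widthC n d (k + 1) * (√(Real.log n) / Real.log n) := by ring
      _ ≤ widthC n d k * 1 := by
        gcongr
        rw [div_le_one (by positivity)]
        nlinarith
      _ = _ := mul_one _
  have hbound : 0 ≤ R * noiseConst M m.horizon := mul_nonneg hR hA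
  have hE : 0 ≤ (curv + bend) * (K * M) ^ 2 := by
    have := h.curv_nonneg
    have := h.bend_nonneg
    positivity
  have hdist : ∀ j < (periodC (m.scale n) n d s D k).grid,
      |pc - (periodC (m.scale n) n d s D k).price j| ≤ K * M * widthC n d k := by
    intro j hj
    refine le_trans ?_ hloc.width_le
    have h1 := hreg.price_mem hj
    have h2 := hloc.pc_mem
    rw [abs_le]
    constructor <;> linarith [h1.1, h1.2, h2.1, h2.2]
  have hloss : ∀ j < (periodC (m.scale n) n d s D k).grid,
      K * |pc - (periodC (m.scale n) n d s D k).price j| ≤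
        lossConst M K curv bend * widthC n d k := by
    intro j hj
    calc K * |pc - (periodC (m.scale n) n d s D k).price j| ≤ K * (K * M * widthC n d k) := by
          gcongr
          exact hdist j hj
      _ = K ^ 2 * M * widthC n d k := by ring
      _ ≤ _ := by
        unfold lossConst
        gcongr
        linarith
  have hmem : ∀ j < (periodC (m.scale n) n d s D k).grid,
      (periodC (m.scale n) n d s D k).price j ∈ Icc m.lo m.hi := fun j hj =>
    hreg.mem_of_mem (hreg.price_mem hj)
  have hwin := hreg.window hG hn h.lo_nonneg h0 hT hpol hν h.hi_le
    (ρ := max pu pc * lam (max pu pc)) (c := m.inventory / m.horizon)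
    (e := (lossConst M K curv bend + R * noiseConst M m.horizon) * widthC n d k) ?_ ?_
  · rw [hend, hstart] at hwin
    refine hwin.mono hn.le ?_
    have h3 := tauC_mul (d := d) h.two_le k
    have h4 := h.log_pow_le
    have h5 := h.lossConst_nonneg
    have h6 := h.horizon_pos
    calc (periodC (m.scale n) n d s D k).length *
          ((lossConst M K curv bend + R * noiseConst M m.horizon) * widthC n d k)
        = m.horizon * (lossConst M K curv bend + R * noiseConst M m.horizon) *
          (tauC n d k * widthC n d k) := by
          rw [periodC_length]
          change m.horizon * tauC n d k * _ = _
          ring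
      _ ≤ _ := by
          rw [h3]
          gcongr
  · intro j hj
    have h1 := (le_abs_self _).trans (h.rev_lip _ h.pc_mem _ (hmem j hj))
    have h2 := mul_le_mul_of_nonneg_left hw hbound
    have h3 := hloss j hj
    rw [max_eq_right hpc.le]
    linarith
  · calc _ ≤ ∑ _j ∈ Finset.range (periodC (m.scale n) n d s D k).grid,
          ((lossConst M K curv bend + R * noiseConst M m.horizon) * widthC n d k) := by
          refine Finset.sum_le_sum fun j hj => ?_
          rw [Finset.mem_range] at hj
          have h1 := (neg_abs_le _).trans' (neg_le_neg (h.lip _ h.pc_mem _ (hmem j hj)))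
          have h3 := hloss j hj
          have h2 : 0 ≤ R * noiseConst M m.horizon * widthC n d k := by positivity
          rw [h.pc_eq hlopc] at h1
          linarith
      _ = _ := by rw [Finset.sum_const, Finset.card_range, nsmul_eq_mul]

end

end Tuned

/-! ### Revenue and demand of the whole season -/

namespace Tuned

variable {m : Market} {n : ℕ} {d : ℝ} {lam : ℝ → ℝ} {M K ε R growth curv bend pu pc η : ℝ}
  {D : ℝ → ℕ} {G : ℝ → ℝ} {s : ℝ} {k : ℕ}

/-- The constant in the error of a learning period. -/
noncomputable def periodConst (T M K R curv bend : ℝ) : ℝ :=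
  T * (lossConst M K curv bend + R * noiseConst M T)

/-- The constant in the error of the final period. -/
noncomputable def finalConst (T M K R curv bend : ℝ) : ℝ :=
  T * lossConst M K curv bend + R * (5 * √(M * T) + 12)

section

variable (h : Tuned m n d lam M K ε R growth curv bend pu pc η)
include h

/-- Step 2 up to the start of period `k`. -/
lemma stepTwo_window (hG : GoodPath (uncensoredDpa (m.scale n) n d) lam n M (Real.log n) m.horizon
      D G) (hk : k ≤ periodsU n d) (hno : ∀ i < k, ¬ transition (m.scale n) n d D i) :
    LocatedU m n d lam M K ε curv bend pu pc k (periodU (m.scale n) n d D k) ∧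
    Window n (max pu pc * lam (max pu pc)) (m.inventory / m.horizon)
      (GoodPath.revenueBefore (uncensoredDpa (m.scale n) n d) D) G 0 (startU m n d k)
      (k * (periodConst m.horizon M K R curv bend * order n d)) := by
  induction k with
  | zero =>
    refine ⟨h.locatedU_zero, ?_⟩
    rw [startU_zero, Nat.cast_zero, zero_mul]
    exact Window.refl _ _ _ _ _ _
  | succ k ih =>
    obtain ⟨h1, h2⟩ := ih (by omega) fun i hi => hno i (by omega)
    obtain ⟨h3, h4, h5⟩ := h.periodU_window hG hk (fun i hi => hno i (by omega)) h1
    obtain ⟨-, -, -, h6⟩ := h.locatedU_succ h1 h3 h4 (hno k (by omega))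
    refine ⟨h6, (h2.trans h5).mono (Nat.cast_nonneg n) (le_of_eq ?_)⟩
    rw [periodConst]
    push_cast
    ring

/-- Step 3 up to the start of period `k`. -/
lemma stepThree_window (hG : GoodPath (uncensoredDpa (m.scale n) n d) lam n M (Real.log n)
      m.horizon D G) (hs0 : 0 ≤ s) (hs : s ≤ m.horizon / 2) (hpc : pu < pc) (hlopc : m.lo < pc)
    (hpolicy : ∀ t, s ≤ t → uncensoredDpa (m.scale n) n d D t = priceC (m.scale n) n d s D t)
    (hk : k ≤ periodsC n d) :
    LocatedC n d M K ε pc k (periodC (m.scale n) n d s D k) ∧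
    Window n (max pu pc * lam (max pu pc)) (m.inventory / m.horizon)
      (GoodPath.revenueBefore (uncensoredDpa (m.scale n) n d) D) G s (s + startC m n d k)
      (k * (periodConst m.horizon M K R curv bend * order n d)) := by
  induction k with
  | zero =>
    refine ⟨h.locatedC_zero, ?_⟩
    rw [startC_zero, Nat.cast_zero, zero_mul, add_zero]
    exact Window.refl _ _ _ _ _ _
  | succ k ih =>
    obtain ⟨h1, h2⟩ := ih (by omega)
    obtain ⟨h3, h4⟩ := h.periodC_window hG hs0 hs hk hpc hlopc hpolicy h1
    refine ⟨(h.locatedC_succ hpc h1 h3).1, (h2.trans h4).mono (Nat.cast_nonneg n) (le_of_eq ?_)⟩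
    rw [periodConst]
    push_cast
    ring

/-- The last part of the season, when a good price is fixed. -/
lemma final_window (hG : GoodPath (uncensoredDpa (m.scale n) n d) lam n M (Real.log n)
      m.horizon D G) {u p : ℝ} (hu : 0 ≤ u) (huT : u ≤ m.horizon)
    (hp : ∀ t, u ≤ t → uncensoredDpa (m.scale n) n d D t = p) (hpm : p ∈ Icc m.lo m.hi)
    (h1 : max pu pc * lam (max pu pc) - p * lam p ≤ lossConst M K curv bend * order n d)
    (h2 : lam p - m.inventory / m.horizon ≤ lossConst M K curv bend * order n d) :
    Window n (max pu pc * lam (max pu pc)) (m.inventory / m.horizon)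
      (GoodPath.revenueBefore (uncensoredDpa (m.scale n) n d) D) G u m.horizon
      (finalConst m.horizon M K R curv bend * order n d) := by
  have hn := natCast_pos_of_two_le h.two_le
  have hE := mul_nonneg h.lossConst_nonneg h.order_nonneg
  have hnoise : R * noise (Real.log n) (n * M * (m.horizon - u)) ≤
      n * (R * (5 * √(M * m.horizon) + 12) * order n d) := by
    have hL := h.log_ge
    have hM := h.M_pos
    have h3 : noise (Real.log n) (n * M * (m.horizon - u)) ≤
        noise (Real.log n) (n * M * m.horizon) := by
      refine noise_mono (by linarith) ?_
      gcongr
      linarith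
    have h4 := mul_le_mul_of_nonneg_left (h3.trans h.one_le_mul_order.2) h.R_nonneg
    linarith
  have hfin : 0 ≤ R * (5 * √(M * m.horizon) + 12) * order n d := by
    have := h.R_nonneg
    have := h.order_nonneg
    positivity
  refine (hG.final_window hn hu huT (fun t ht => hp t ht.1) (h.lo_nonneg.trans hpm.1)
    (hpm.2.trans h.hi_le) h1 h2 hE hnoise hfin).mono hn.le (le_of_eq ?_)
  rw [finalConst]
  ring

/-- The whole season. -/
theorem season_window (hG : GoodPath (uncensoredDpa (m.scale n) n d) lam n M (Real.log n)
      m.horizon D G) :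
    Window n (max pu pc * lam (max pu pc)) (m.inventory / m.horizon)
      (GoodPath.revenueBefore (uncensoredDpa (m.scale n) n d) D) G 0 m.horizon
      (((periodsU n d + periodsC n d) * periodConst m.horizon M K R curv bend +
        finalConst m.horizon M K R curv bend) * order n d) := by
  have hn := natCast_pos_of_two_le h.two_le
  have hT := h.horizon_pos
  have hO := h.order_nonneg
  have hE := h.lossConst_nonneg
  obtain ⟨hS, hSS⟩ := h.sqrt_log
  have hmono := startU_mono (d := d) h.two_le h.horizon_pos
  have hmonoC := startC_mono (d := d) h.two_le h.horizon_pos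
  have h00 : ∀ k, 0 ≤ startU m n d k := fun k => by
    rw [← startU_zero (m := m) (n := n) (d := d)]
    exact hmono (Nat.zero_le k)
  have hPC : 0 ≤ periodConst m.horizon M K R curv bend * order n d := by
    have := h.R_nonneg
    have := noiseConst_nonneg M m.horizon
    unfold periodConst
    positivity
  by_cases hex : ∃ k < periodsU n d, transition (m.scale n) n d D k
  · obtain ⟨k, ⟨hk, htr⟩, hno⟩ : ∃ k, (k < periodsU n d ∧ transition (m.scale n) n d D k) ∧
        ∀ i < k, ¬ transition (m.scale n) n d D i := by
      classical
      refine ⟨Nat.find hex, Nat.find_spec hex, fun i hi htr => Nat.find_min hex hi ⟨?_, htr⟩⟩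
      exact hi.trans (Nat.find_spec hex).1
    obtain ⟨h1, h2⟩ := h.stepTwo_window hG hk.le hno
    obtain ⟨h3, h4, h5⟩ := h.periodU_window hG hk hno h1
    obtain ⟨hpc, hlopc⟩ := h.scarce_of_transition h1 h3 h4 htr
    have hs : startU m n d (k + 1) ≤ m.horizon / 2 := (hmono hk).trans h.startU_le
    have hpolicy : ∀ t, startU m n d (k + 1) ≤ t → uncensoredDpa (m.scale n) n d D t =
        priceC (m.scale n) n d (startU m n d (k + 1)) D t := fun t ht =>
      uncensoredDpa_of_transition (m := m.scale n) hk hno htr ht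
    obtain ⟨N, hN⟩ : ∃ N, periodsC n d = N + 1 :=
      ⟨_, (Nat.succ_pred_eq_of_pos (periodsC_pos (n := n) (d := d))).symm⟩
    -- The location is needed at the start of the last period, where the final price is estimated;
    -- the window is needed up to its end.
    obtain ⟨h6, -⟩ := h.stepThree_window hG (h00 _) hs hpc hlopc hpolicy (k := N) (by omega)
    obtain ⟨-, h7⟩ := h.stepThree_window hG (h00 _) hs hpc hlopc hpolicy le_rfl
    obtain ⟨h8, -⟩ := h.periodC_window hG (h00 _) hs (by omega) hpc hlopc hpolicy h6
    obtain ⟨h9, h10⟩ := h.locatedC_succ hpc h6 h8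
    have hfinal : ∀ t, startU m n d (k + 1) + startC m n d (periodsC n d) ≤ t →
        uncensoredDpa (m.scale n) n d D t =
          (periodC (m.scale n) n d (startU m n d (k + 1)) D N).hatC
            (n * (m.inventory / m.horizon)) D := by
      intro t ht
      have h11 : 0 ≤ startC m n d (periodsC n d) := by
        rw [← startC_zero (m := m) (n := n) (d := d)]
        exact hmonoC (Nat.zero_le _)
      rw [hpolicy t (by linarith), priceC_final (m := m.scale n) ht, finalPriceC, hN,
        Nat.add_sub_cancel, target_eq]
    set pf := (periodC (m.scale n) n d (startU m n d (k + 1)) D N).hatC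
      (n * (m.inventory / m.horizon)) D
    have hpfm : pf ∈ Icc m.lo m.hi := (h.regularC _ D (N + 1)).mem_of_mem h10
    have hdist : K * |pc - pf| ≤ lossConst M K curv bend * order n d := by
      have h11 : |pc - pf| ≤ K * M * widthC n d (N + 1) := by
        refine le_trans ?_ h9.width_le
        have h12 := h9.pc_mem
        rw [abs_le]
        constructor <;> linarith [h10.1, h10.2, h12.1, h12.2]
      have hK := h.K_pos
      have hM := h.M_pos
      have h13 : widthC n d (N + 1) ≤ order n d := by
        rw [← hN]
        exact h.lastC.trans h.log_pow_le
      calc K * |pc - pf| ≤ K * (K * M * order n d) := by gcongr; exact h11.trans (by gcongr)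
        _ = K ^ 2 * M * order n d := by ring
        _ ≤ _ := by
          have := h.curv_nonneg
          have := h.bend_nonneg
          have : 0 ≤ (curv + bend) * (K * M) ^ 2 := by positivity
          unfold lossConst
          gcongr
          linarith
    have hfw := h.final_window hG (u := startU m n d (k + 1) + startC m n d (periodsC n d))
      (add_nonneg (h00 _) (by
        rw [← startC_zero (m := m) (n := n) (d := d)]
        exact hmonoC (Nat.zero_le _)))
      (by linarith [h.startC_le]) hfinal hpfm
      (by
        rw [max_eq_right hpc.le]
        exact ((le_abs_self _).trans (h.rev_lip _ h.pc_mem _ hpfm)).trans hdist)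
      (by
        have h14 := h.lip _ hpfm _ h.pc_mem
        rw [h.pc_eq hlopc, abs_sub_comm pf] at h14
        exact ((le_abs_self _).trans h14).trans hdist)
    refine (((h2.trans h5).trans h7).trans hfw).mono hn.le ?_
    have hk' : (k : ℝ) + 1 ≤ periodsU n d := by exact_mod_cast hk
    rw [← periodConst]
    have := mul_le_mul_of_nonneg_right hk' hPC
    linarith
  · push Not at hex
    obtain ⟨N, hN⟩ : ∃ N, periodsU n d = N + 1 :=
      ⟨_, (Nat.succ_pred_eq_of_pos (periodsU_pos (n := n) (d := d))).symm⟩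
    obtain ⟨h1, -⟩ := h.stepTwo_window hG (k := N) (by omega) fun i hi => hex i (by omega)
    obtain ⟨-, h2⟩ := h.stepTwo_window hG le_rfl hex
    obtain ⟨h3, h4, -⟩ := h.periodU_window hG (k := N) (by omega) (fun i hi => hex i (by omega)) h1
    obtain ⟨h5, h6, h7, h8⟩ := h.locatedU_succ h1 h3 h4 (hex N (by omega))
    have hg := h.mesh_pos_of_locatedU h1
    have hfinal : ∀ t, startU m n d (periodsU n d) ≤ t →
        uncensoredDpa (m.scale n) n d D t =
          min m.hi (max ((periodU (m.scale n) n d D N).hatC (n * (m.inventory / m.horizon)) D)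
            ((periodU (m.scale n) n d D N).hatU D) + 2 * √(Real.log n) *
              (periodU (m.scale n) n d D N).mesh) := by
      intro t ht
      rw [uncensoredDpa_finalU (m := m.scale n) hex ht, finalPriceU, hN, Nat.add_sub_cancel,
        target_eq]
      rfl
    set q := periodU (m.scale n) n d D N
    set ph := max (q.hatC (n * (m.inventory / m.horizon)) D) (q.hatU D)
    set pf := min m.hi (ph + 2 * √(Real.log n) * q.mesh) with hpf
    obtain ⟨h9, h10⟩ := abs_le.1 h5
    have hSg : 0 < √(Real.log n) * q.mesh := by positivity
    -- The surcharge `2 √L g` exceeds the error of the empirical price, so the final demand rate is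
    -- at most the target. The price still lies in the interval of the period that would come next,
    -- where the loss is quadratic in a width that ended Step 2.
    have hpfge : max pu pc ≤ pf := le_min h.best_mem_Icc.2 (by linarith)
    have hpfm : pf ∈ Icc m.lo m.hi := ⟨h.best_mem_Icc.1.trans hpfge, min_le_left _ _⟩
    have hpfmem : pf ∈ Icc (periodU (m.scale n) n d D (N + 1)).a
        (periodU (m.scale n) n d D (N + 1)).b := by
      refine ⟨h8.best_mem.1.trans hpfge, (min_le_right _ _).trans ?_⟩
      rw [h7]
      have : 10 * (√(Real.log n) * q.mesh) ≤ Real.log n * q.mesh := by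
        nth_rewrite 2 [← hSS]
        rw [mul_assoc]
        gcongr
      linarith
    have hfw := h.final_window hG (h00 _) (by linarith [h.startU_le]) hfinal hpfm
      ((h8.value pf hpfmem).trans (by
        rw [← hN]
        exact mul_le_mul_of_nonneg_left h.lastU hE))
      (by
        have h11 := h.anti.antitoneOn h.best_mem_Icc hpfm hpfge
        have h12 := h.lam_best_le
        have := mul_nonneg hE hO
        linarith)
    refine (h2.trans hfw).mono hn.le ?_
    have := mul_nonneg (Nat.cast_nonneg (α := ℝ) (periodsC n d)) hPC
    linarith

/-- The revenue of the season, when sales stop as soon as no whole unit is left. -/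
theorem revenue_ge (hG : GoodPath (uncensoredDpa (m.scale n) n d) lam n M (Real.log n)
      m.horizon D G) {e : ℝ}
    (he : ((periodsU n d + periodsC n d) * periodConst m.horizon M K R curv bend +
        finalConst m.horizon M K R curv bend) ≤ e) :
    n * (m.horizon * (max pu pc * lam (max pu pc)) -
      (e + R * (e + 5 * √(M * m.horizon) + 13)) * order n d) ≤
      cumRevenue (uncensoredDpa (m.scale n) n d) D (min (D m.horizon) ⌊n * m.inventory⌋₊) := by
  have hn := natCast_pos_of_two_le h.two_le
  have hT := h.horizon_pos
  have hR := h.R_nonneg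
  have hO := h.order_nonneg
  obtain ⟨h1, h2⟩ := (h.season_window hG).mono hn.le (mul_le_mul_of_nonneg_right he hO)
  rw [sub_zero] at h1 h2
  have hprice : ∀ k, uncensoredDpa (m.scale n) n d D (saleTime D k) ∈ Icc m.lo m.hi := fun k =>
    uncensoredDpa_mem (m := m.scale n) h.two_le h.horizon_pos h.lo_lt.le D (saleTime_nonneg D k)
  have hG0 : G 0 = 0 := by
    rw [(hG.intensity 0 ⟨le_rfl, hT.le⟩).2, intervalIntegral.integral_same]
  have hF0 : GoodPath.revenueBefore (uncensoredDpa (m.scale n) n d) D 0 = 0 := by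
    simp [GoodPath.revenueBefore, cumRevenue, demandBefore_zero]
  rw [hF0, sub_zero] at h1
  rw [hG0, sub_zero] at h2
  have hb : demandBefore D m.horizon ≤ D m.horizon :=
    demandBefore_le fun s hs => hG.mono hs.2.le
  have hclose := (abs_le.1 (hG.close 0 m.horizon le_rfl hT.le le_rfl)).2
  rw [hG0, demandBefore_zero, sub_zero, sub_zero, Nat.cast_zero, sub_zero] at hclose
  obtain ⟨h3, h4⟩ := h.one_le_mul_order
  have hinv : m.horizon * (m.inventory / m.horizon) = m.inventory := by field_simp
  rw [hinv] at h2
  set b := demandBefore D m.horizon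
  set c := min (D m.horizon) ⌊(n : ℝ) * m.inventory⌋₊ with hc
  have hF : GoodPath.revenueBefore (uncensoredDpa (m.scale n) n d) D m.horizon =
    cumRevenue (uncensoredDpa (m.scale n) n d) D b := rfl
  rw [hF] at h1
  have he0 : 0 ≤ R * (n * (e * order n d) + n * ((5 * √(M * m.horizon) + 12) * order n d) + 1) := by
    have : 0 ≤ n * ((5 * √(M * m.horizon) + 12) * order n d) := by positivity
    have h5 : 0 ≤ e := by
      refine le_trans ?_ he
      have := h.lossConst_nonneg
      have := noiseConst_nonneg M m.horizon
      unfold periodConst finalConst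
      positivity
    positivity
  -- The one unit lost by rounding the stock turns 12 into 13.
  have hfin : R * (n * (e * order n d) + n * ((5 * √(M * m.horizon) + 12) * order n d) + 1) ≤
      n * (R * (e + 5 * √(M * m.horizon) + 13) * order n d) := by
    have := mul_le_mul_of_nonneg_left h3 hR
    linarith
  rcases le_or_gt b c with hbc | hbc
  · have h5 : cumRevenue (uncensoredDpa (m.scale n) n d) D b ≤
        cumRevenue (uncensoredDpa (m.scale n) n d) D c :=
      Finset.sum_le_sum_of_subset_of_nonneg (Finset.range_mono hbc) fun k _ _ =>
        h.lo_nonneg.trans (hprice k).1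
    linarith
  · have hcI : c = ⌊(n : ℝ) * m.inventory⌋₊ := by
      rcases min_choice (D m.horizon) ⌊(n : ℝ) * m.inventory⌋₊ with h6 | h6
      · rw [← hc] at h6; omega
      · exact h6
    -- Demand exceeds the stock: the `b - c` unserved units would have brought at most `R` each, and
    -- their number is bounded by the excess intensity, the noise and one unit of rounding.
    have h7 : cumRevenue (uncensoredDpa (m.scale n) n d) D b -
        cumRevenue (uncensoredDpa (m.scale n) n d) D c ≤ R * (b - c) := by
      simp only [cumRevenue]
      rw [← Finset.sum_Ico_eq_sub _ hbc.le]
      refine (Finset.sum_le_card_nsmul _ _ R fun k _ => (hprice k).2.trans h.hi_le).trans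
        (le_of_eq ?_)
      rw [Nat.card_Ico, nsmul_eq_mul, Nat.cast_sub hbc.le, mul_comm]
    have h8 : (n : ℝ) * m.inventory < c + 1 := by
      rw [hcI]
      exact Nat.lt_floor_add_one _
    have h9 : (b : ℝ) - c ≤
        n * (e * order n d) + n * ((5 * √(M * m.horizon) + 12) * order n d) + 1 := by
      linarith
    have h10 := mul_le_mul_of_nonneg_left h9 hR
    linarith

end

end Tuned

/-! ### From good paths to the expected regret -/

section Regret

variable {Ω : Type*} [MeasurableSpace Ω] {P : Measure Ω} {N : ℝ≥0 → Ω → ℕ}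
  {m : Market} {n : ℕ} {d : ℝ} {lam : ℝ → ℝ} {M K ε R growth curv bend pu pc η : ℝ}

/-- The algorithm is an admissible policy, and its revenue is that of the uncensored algorithm up
to the stock-out. -/
lemma dpa_isAdmissible (hN : IsUnitPoissonProcess N P)
    (h : PriceFacts m lam M K ε R growth curv bend pu pc) (hlo : 0 ≤ m.lo) (hlh : m.lo ≤ m.hi)
    (hT : 0 < m.horizon) (hx : 0 ≤ m.inventory) (hcut : lam m.cut = 0) (hn : 2 ≤ n) :
    IsAdmissible (m.scale n) (dpa (m.scale n) n d) (scaleDemand n lam) N P ∧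
    ∃ G : Ω → ℝ → ℝ, (∀ ω, Monotone (G ω) ∧ G ω 0 = 0 ∧ ∀ t ∈ Icc 0 m.horizon,
      IntervalIntegrable (fun s => n * lam (uncensoredDpa (m.scale n) n d
        (demandPath (N · ω) (G ω)) s)) volume 0 t ∧
      G ω t = ∫ s in (0 : ℝ)..t, n * lam (uncensoredDpa (m.scale n) n d
        (demandPath (N · ω) (G ω)) s)) ∧
    ∀ᵐ ω ∂P, revenue (dpa (m.scale n) n d) m.horizon (fun t =>
        demandProcess (dpa (m.scale n) n d) (scaleDemand n lam) m.horizon N t ω) =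
      cumRevenue (uncensoredDpa (m.scale n) n d) (demandPath (N · ω) (G ω))
        (min (demandPath (N · ω) (G ω) m.horizon) ⌊n * m.inventory⌋₊) := by
  have := hN.isProbabilityMeasure
  have hnn : (0 : ℝ) ≤ n := Nat.cast_nonneg n
  obtain ⟨h1, G, h2, h3⟩ := censor_isAdmissible hN hN.ae_jump (m := m.scale n)
    (q := uncensoredDpa (m.scale n) n d) (lam := scaleDemand n lam) (Λ := n * M) hT
    (mul_nonneg hnn hx) hlo (isStepwise_uncensoredDpa hn hT hlh)
    (fun D t ht => uncensoredDpa_mem (m := m.scale n) hn hT hlh D ht)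
    (by change n * lam m.cut = 0; rw [hcut, mul_zero])
    (fun p hp => mul_nonneg hnn (h.nonneg p hp))
    (fun p hp => mul_le_mul_of_nonneg_left (h.le_bound p hp) hnn)
  rw [← dpa_eq_censor] at h1 h3
  exact ⟨h1, G, fun ω => ⟨(h2 ω).1, (h2 ω).2.2.1, (h2 ω).2.2.2⟩, h3⟩

lemma cumRevenue_uncensoredDpa_nonneg (hlo : 0 ≤ m.lo) (hlh : m.lo ≤ m.hi) (hT : 0 < m.horizon)
    (hn : 2 ≤ n) (D : ℝ → ℕ) (c : ℕ) : 0 ≤ cumRevenue (uncensoredDpa (m.scale n) n d) D c :=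
  Finset.sum_nonneg fun k _ => hlo.trans
    (uncensoredDpa_mem (m := m.scale n) hn hT hlh D (saleTime_nonneg D k)).1

/-- The regret of the algorithm is at most one. -/
lemma regretOfSize_dpa_le_one (hN : IsUnitPoissonProcess N P)
    (h : PriceFacts m lam M K ε R growth curv bend pu pc) (hK : 0 < K) (hlo : 0 ≤ m.lo)
    (hlh : m.lo ≤ m.hi) (hT : 0 < m.horizon) (hx : 0 ≤ m.inventory) (hcut : lam m.cut = 0)
    (hn : 2 ≤ n) : regretOfSize n m (dpa (m.scale n) n d) lam N P ≤ 1 := by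
  obtain ⟨-, G, -, h3⟩ := dpa_isAdmissible (d := d) hN h hlo hlh hT hx hcut hn
  have hJ : 0 ≤ expectedRevenue (m.scale n) (dpa (m.scale n) n d) (scaleDemand n lam) N P := by
    refine integral_nonneg_of_ae ?_
    filter_upwards [h3] with ω hω
    exact (cumRevenue_uncensoredDpa_nonneg hlo hlh hT hn _ _).trans hω.ge
  have hV : 0 ≤ max pu pc * lam (max pu pc) := le_trans (by positivity) h.value_pos
  rw [regretOfSize, regret, h.deterministicValue_scale hK hlh hcut hT hx (by omega)]
  have : 0 ≤ (n : ℝ) * (m.horizon * (max pu pc * lam (max pu pc))) := by positivity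
  linarith [div_nonneg hJ this]

/-- With a high probability, the path of the demand is good. -/
lemma Tuned.goodPath (h : Tuned m n d lam M K ε R growth curv bend pu pc η)
    (hN : IsUnitPoissonProcess N P) {ω : Ω} {G : ℝ → ℝ} (hmono : Monotone G) (hG0 : G 0 = 0)
    (hG : ∀ t ∈ Icc 0 m.horizon,
      IntervalIntegrable (fun s => n * lam (uncensoredDpa (m.scale n) n d
        (demandPath (N · ω) G) s)) volume 0 t ∧
      G t = ∫ s in (0 : ℝ)..t, n * lam (uncensoredDpa (m.scale n) n d
        (demandPath (N · ω) G) s))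
    (hω : ω ∈ concentrationEvent N (Real.log n) ⌈n * M * m.horizon⌉₊) :
    GoodPath (uncensoredDpa (m.scale n) n d) lam n M (Real.log n) m.horizon
      (demandPath (N · ω) G) G := by
  have hL := h.log_ge
  have hn := natCast_pos_of_two_le h.two_le
  have hM := h.M_pos
  have hT := h.horizon_pos
  have hinc : ∀ u v, 0 ≤ u → u ≤ v → v ≤ m.horizon →
      0 ≤ G v - G u ∧ G v - G u ≤ n * M * (v - u) := by
    intro u v hu huv hv
    refine ⟨by linarith [hmono huv], ?_⟩
    obtain ⟨h1, h2⟩ := hG v ⟨hu.trans huv, hv⟩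
    obtain ⟨h3, h4⟩ := hG u ⟨hu, huv.trans hv⟩
    rw [h2, h4, intervalIntegral.integral_interval_sub_left h1 h3]
    calc _ ≤ ∫ s in u..v, n * M := by
          refine intervalIntegral.integral_mono_on huv (h3.symm.trans h1)
            intervalIntegrable_const fun s hs => ?_
          exact mul_le_mul_of_nonneg_left (h.le_bound _ (uncensoredDpa_mem (m := m.scale n)
            h.two_le h.horizon_pos h.lo_lt.le _ (hu.trans hs.1))) hn.le
      _ = _ := by rw [intervalIntegral.integral_const, smul_eq_mul]; ring
  refine ⟨demandPath_mono (hN.monotone ω) hmono, hG, fun u v hu huv hv => ?_⟩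
  refine demandBefore_close (by linarith) (by positivity)
    (demandPath_mono (hN.monotone ω) hmono) ?_ hinc (fun u v hu huv hv => ?_) hu huv hv
  · simp [demandPath, hG0, hN.zero]
  · have hGu : 0 ≤ G u := by rw [← hG0]; exact hmono hu
    refine increment_bound hN (by linarith) hω hGu (hmono huv) ?_
    have h1 := (hinc 0 v le_rfl (hu.trans huv) hv).2
    rw [hG0, sub_zero, sub_zero] at h1
    refine h1.trans (le_trans ?_ (Nat.le_ceil _))
    gcongr

/-- The probability that the demand path is not good. -/
lemma Tuned.real_compl_le (h : Tuned m n d lam M K ε R growth curv bend pu pc η)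
    (hN : IsUnitPoissonProcess N P) :
    P.real (concentrationEvent N (Real.log n) ⌈n * M * m.horizon⌉₊)ᶜ ≤
      2 * (M * m.horizon + 2) ^ 2 * Tuned.order n d := by
  have hL := h.log_ge
  have hn := natCast_pos_of_two_le h.two_le
  have hn1 : (1 : ℝ) ≤ n := by exact_mod_cast (by linarith [h.two_le] : 1 ≤ n)
  have hM := h.M_pos
  have hT := h.horizon_pos
  refine (real_compl_concentrationEvent hN (by linarith) _).trans ?_
  have h1 : (⌈n * M * m.horizon⌉₊ : ℝ) + 1 ≤ n * (M * m.horizon + 2) := by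
    have := Nat.ceil_lt_add_one (show 0 ≤ n * M * m.horizon by positivity)
    linarith
  -- The number of pairs contributes `n²` and the tail `n^(-4)`; what remains, `n^(-2)`, is below
  -- `n^(-d)`.
  have h2 : (n : ℝ) ^ 2 * Real.exp (-4 * Real.log n) ≤ Tuned.order n d := by
    have h3 : (n : ℝ) ^ 2 = Real.exp (2 * Real.log n) := by
      rw [mul_comm, Real.exp_mul, Real.exp_log hn]
      norm_cast
    rw [h3, ← Real.exp_add, Tuned.order, Real.rpow_def_of_pos hn]
    have h4 : Real.exp (2 * Real.log n + -4 * Real.log n) ≤ Real.exp (Real.log n * -d) := by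
      refine Real.exp_le_exp.2 ?_
      nlinarith [h.d_le]
    have h5 : 1 ≤ Real.log n ^ 5 := one_le_pow₀ (by linarith)
    have h6 := Real.exp_pos (Real.log n * -d)
    nlinarith
  calc 2 * ((⌈n * M * m.horizon⌉₊ : ℝ) + 1) ^ 2 * Real.exp (-4 * Real.log n)
      ≤ 2 * (n * (M * m.horizon + 2)) ^ 2 * Real.exp (-4 * Real.log n) := by gcongr
    _ = 2 * (M * m.horizon + 2) ^ 2 * ((n : ℝ) ^ 2 * Real.exp (-4 * Real.log n)) := by ring
    _ ≤ _ := by gcongr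

/-- The regret in large problems. -/
theorem Tuned.regretOfSize_le (h : Tuned m n d lam M K ε R growth curv bend pu pc η)
    (hN : IsUnitPoissonProcess N P) (hcut : lam m.cut = 0) {e : ℝ} (he0 : 0 ≤ e)
    (he : ((periodsU n d + periodsC n d) * Tuned.periodConst m.horizon M K R curv bend +
        Tuned.finalConst m.horizon M K R curv bend) ≤ e) :
    regretOfSize n m (dpa (m.scale n) n d) lam N P ≤
      ((e + R * (e + 5 * √(M * m.horizon) + 13)) / (m.horizon * (ε ^ 2 / K)) +
        2 * (M * m.horizon + 2) ^ 2) * Tuned.order n d := by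
  have := hN.isProbabilityMeasure
  have hn := natCast_pos_of_two_le h.two_le
  have hT := h.horizon_pos
  have hK := h.K_pos
  have hε := h.ε_pos
  have hR := h.R_nonneg
  have hO := h.order_nonneg
  obtain ⟨hadm, G, hG, hrev⟩ := dpa_isAdmissible (d := d) hN h.toPriceFacts h.lo_nonneg h.lo_lt.le
    hT h.inventory_pos.le hcut h.two_le
  have hVpos : 0 < max pu pc * lam (max pu pc) := lt_of_lt_of_le (by positivity) h.value_pos
  have hval := h.value_pos
  set V := max pu pc * lam (max pu pc) with hV
  set e' := e + R * (e + 5 * √(M * m.horizon) + 13) with he'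
  have he'0 : 0 ≤ e' := by positivity
  set E := concentrationEvent N (Real.log n) ⌈n * M * m.horizon⌉₊ with hE
  have hEm : MeasurableSet E := measurableSet_concentrationEvent hN _ _
  set W : ℝ := n * (m.horizon * V) with hW
  have hW0 : 0 < W := by positivity
  -- On the good event the revenue bound applies; off it the revenue is only nonnegative, and
  -- subtracting `W` there is enough.
  have hJ : W - n * (e' * Tuned.order n d) - W * P.real Eᶜ ≤
      expectedRevenue (m.scale n) (dpa (m.scale n) n d) (scaleDemand n lam) N P := by
    have h1 : ∫ ω, (W - n * (e' * Tuned.order n d) - Eᶜ.indicator (fun _ => W) ω) ∂P =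
        W - n * (e' * Tuned.order n d) - W * P.real Eᶜ := by
      rw [integral_sub (integrable_const _) ((integrable_const W).indicator hEm.compl),
        integral_indicator_const _ hEm.compl]
      simp [mul_comm]
    rw [← h1, expectedRevenue]
    refine integral_mono_ae ((integrable_const _).sub ((integrable_const W).indicator hEm.compl))
      hadm.integrable ?_
    filter_upwards [hrev] with ω hω
    refine le_trans ?_ hω.ge
    by_cases hωE : ω ∈ E
    · have h2 := h.revenue_ge (h.goodPath hN (hG ω).1 (hG ω).2.1 (hG ω).2.2 hωE) he
      have h3 : Eᶜ.indicator (fun _ => W) ω = 0 := indicator_of_notMem (by simpa using hωE) _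
      simp only [h3]
      rw [← he', ← hV] at h2
      linarith
    · have h3 : Eᶜ.indicator (fun _ => W) ω = W := indicator_of_mem (by simpa using hωE) _
      simp only [h3]
      have h4 := cumRevenue_uncensoredDpa_nonneg (d := d) h.lo_nonneg h.lo_lt.le hT h.two_le
        (demandPath (N · ω) (G ω)) (min (demandPath (N · ω) (G ω) m.horizon) ⌊n * m.inventory⌋₊)
      have h5 : 0 ≤ n * (e' * Tuned.order n d) := by positivity
      linarith
  rw [regretOfSize, regret, h.deterministicValue_scale hK h.lo_lt.le hcut hT h.inventory_pos.le
    (by linarith [h.two_le])]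
  rw [← hV, ← hW]
  have h6 : W - n * (e' * Tuned.order n d) - W * P.real Eᶜ =
      W * (1 - e' * Tuned.order n d / (m.horizon * V) - P.real Eᶜ) := by
    rw [hW]
    field_simp
  rw [h6] at hJ
  have h7 : 1 - e' * Tuned.order n d / (m.horizon * V) - P.real Eᶜ ≤
      expectedRevenue (m.scale n) (dpa (m.scale n) n d) (scaleDemand n lam) N P / W := by
    rw [le_div_iff₀ hW0, mul_comm]
    exact hJ
  have h8 : e' * Tuned.order n d / (m.horizon * V) ≤
      e' / (m.horizon * (ε ^ 2 / K)) * Tuned.order n d := by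
    rw [div_mul_eq_mul_div]
    gcongr
  have h9 := h.real_compl_le hN
  linarith

end Regret

/-! ### Asymptotics -/

section Asymptotics

variable {n : ℕ} {d : ℝ}

lemma rpow_seven_halves {L : ℝ} (hL : 0 < L) : L ^ (7 / 2 : ℝ) = L ^ 3 * √L := by
  rw [Real.sqrt_eq_rpow, ← Real.rpow_natCast, ← Real.rpow_add hL]
  norm_num

lemma rpow_five_halves {L : ℝ} (hL : 0 < L) : L ^ (5 / 2 : ℝ) = L ^ 2 * √L := by
  rw [Real.sqrt_eq_rpow, ← Real.rpow_natCast, ← Real.rpow_add hL]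
  norm_num

/-- The condition that ends Step 2. -/
lemma lastU_iff (hn : 2 ≤ n) (k : ℕ) :
    (widthU n d k / kappaU n d k) ^ 2 * √(Real.log n) <
      (n : ℝ) ^ (-d) * Real.log n ^ (7 / 2 : ℝ) ↔
    widthU n d (k + 1) ^ 2 < (n : ℝ) ^ (-d) * Real.log n ^ 5 := by
  have hL := log_natCast_pos hn
  have hκ := kappaU_pos (d := d) hn k
  have h1 : widthU n d k / kappaU n d k = widthU n d (k + 1) / Real.log n := by
    rw [div_eq_div_iff hκ.ne' hL.ne', widthU_succ hn]
  rw [h1, rpow_seven_halves hL, ← mul_assoc, mul_lt_mul_iff_left₀ (Real.sqrt_pos.2 hL), div_pow,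
    div_lt_iff₀ (by positivity)]
  ring_nf

/-- The condition that ends Step 3. -/
lemma lastC_iff (hn : 2 ≤ n) (k : ℕ) :
    (widthC n d k / kappaC n d k) * √(Real.log n) <
      (n : ℝ) ^ (-d) * Real.log n ^ (5 / 2 : ℝ) ↔
    widthC n d (k + 1) < (n : ℝ) ^ (-d) * Real.log n ^ 3 := by
  have hL := log_natCast_pos hn
  have hκ := kappaC_pos (d := d) hn k
  have h1 : widthC n d k / kappaC n d k = widthC n d (k + 1) / Real.log n := by
    rw [div_eq_div_iff hκ.ne' hL.ne', widthC_succ hn]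
  rw [h1, rpow_five_halves hL, ← mul_assoc, mul_lt_mul_iff_left₀ (Real.sqrt_pos.2 hL),
    div_lt_iff₀ (by positivity)]
  ring_nf

lemma sInf_spec_of_mem {S : Set ℕ} {l : ℕ} (hl : l ∈ S) (hS : ∀ k ∈ S, 1 ≤ k) :
    max 1 (sInf S) ∈ S ∧ max 1 (sInf S) ≤ l := by
  have h1 : sInf S ∈ S := Nat.sInf_mem ⟨l, hl⟩
  rw [max_eq_right (hS _ h1)]
  exact ⟨h1, Nat.sInf_le hl⟩

/-- The bound `l` does not depend on `n`: once `(1 - d) (3/5)^l ≤ 1 - 2 d`, the squared width is at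
most `n^(-d)`, and the logarithms make the inequality strict. The set in the definition is then
nonempty, so its infimum is attained. -/
lemma periodsU_spec (hn : 2 ≤ n) (hL : 1 < Real.log n) {l : ℕ} (hl : 1 ≤ l)
    (h : (1 - d) * (3 / 5 : ℝ) ^ l ≤ 1 - 2 * d) :
    periodsU n d ≤ l ∧ widthU n d (periodsU n d) ^ 2 < (n : ℝ) ^ (-d) * Real.log n ^ 5 := by
  have hn1 : (1 : ℝ) ≤ n := by exact_mod_cast (by omega : 1 ≤ n)
  have hn0 := natCast_pos_of_two_le hn
  have hmem : widthU n d l ^ 2 < (n : ℝ) ^ (-d) * Real.log n ^ 5 := by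
    have h1 : widthU n d l ^ 2 ≤ (n : ℝ) ^ (-d) := by
      rw [widthU, ← Real.rpow_natCast _ 2, ← Real.rpow_mul hn0.le]
      refine Real.rpow_le_rpow_of_exponent_le hn1 ?_
      push_cast
      linarith
    have h2 : 1 < Real.log n ^ 5 := one_lt_pow₀ hL (by norm_num)
    have h3 := Real.rpow_pos_of_pos hn0 (-d)
    nlinarith
  obtain ⟨⟨h1, h2⟩, h3⟩ := sInf_spec_of_mem (S := {l : ℕ | 1 ≤ l ∧
    (widthU n d (l - 1) / kappaU n d (l - 1)) ^ 2 * √(Real.log n) <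
      (n : ℝ) ^ (-d) * Real.log n ^ (7 / 2 : ℝ)}) (l := l)
    ⟨hl, (lastU_iff hn _).2 (by rwa [Nat.sub_add_cancel hl])⟩ fun k hk => hk.1
  refine ⟨h3, ?_⟩
  rw [lastU_iff hn, Nat.sub_add_cancel h1] at h2
  exact h2

lemma periodsC_spec (hn : 2 ≤ n) (hL : 1 < Real.log n) {l : ℕ} (hl : 1 ≤ l)
    (h : (1 - d) * (2 / 3 : ℝ) ^ l ≤ 1 - 2 * d) :
    periodsC n d ≤ l ∧ widthC n d (periodsC n d) < (n : ℝ) ^ (-d) * Real.log n ^ 3 := by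
  have hn1 : (1 : ℝ) ≤ n := by exact_mod_cast (by omega : 1 ≤ n)
  have hn0 := natCast_pos_of_two_le hn
  have hmem : widthC n d l < (n : ℝ) ^ (-d) * Real.log n ^ 3 := by
    have h1 : widthC n d l ≤ (n : ℝ) ^ (-d) := by
      rw [widthC]
      refine Real.rpow_le_rpow_of_exponent_le hn1 ?_
      linarith
    have h2 : 1 < Real.log n ^ 3 := one_lt_pow₀ hL (by norm_num)
    have h3 := Real.rpow_pos_of_pos hn0 (-d)
    nlinarith
  obtain ⟨⟨h1, h2⟩, h3⟩ := sInf_spec_of_mem (S := {l : ℕ | 1 ≤ l ∧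
    (widthC n d (l - 1) / kappaC n d (l - 1)) * √(Real.log n) <
      (n : ℝ) ^ (-d) * Real.log n ^ (5 / 2 : ℝ)}) (l := l)
    ⟨hl, (lastC_iff hn _).2 (by rwa [Nat.sub_add_cancel hl])⟩ fun k hk => hk.1
  refine ⟨h3, ?_⟩
  rw [lastC_iff hn, Nat.sub_add_cancel h1] at h2
  exact h2

/-- The least `l ≥ 1` at which a geometric sequence is small. -/
lemma exists_first_le {r a b : ℝ} (hr0 : 0 ≤ r) (hr : r < 1) (hb : 0 < b) :
    ∃ l : ℕ, 1 ≤ l ∧ a * r ^ l ≤ b ∧ ∀ k, 1 ≤ k → k < l → b < a * r ^ k := by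
  have h1 : Filter.Tendsto (fun l : ℕ => a * r ^ l) Filter.atTop (nhds (a * 0)) :=
    (tendsto_pow_atTop_nhds_zero_of_lt_one hr0 hr).const_mul a
  rw [mul_zero] at h1
  have h2 : ∃ l : ℕ, 1 ≤ l ∧ a * r ^ l ≤ b := by
    obtain ⟨l, hl1, hl2⟩ := ((Filter.eventually_ge_atTop 1).and (h1.eventually_le_const hb)).exists
    exact ⟨l, hl1, hl2⟩
  classical
  refine ⟨Nat.find h2, (Nat.find_spec h2).1, (Nat.find_spec h2).2, fun k hk hkl => ?_⟩
  have := Nat.find_min h2 hkl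
  push Not at this
  exact this hk

lemma tendsto_rpow_mul_log_pow {a : ℝ} (ha : a < 0) (k : ℕ) :
    Filter.Tendsto (fun n : ℕ => (n : ℝ) ^ a * Real.log n ^ k) Filter.atTop (nhds 0) := by
  have h1 := (isLittleO_log_rpow_rpow_atTop (k : ℝ) (show 0 < -a by linarith)).tendsto_div_nhds_zero
  refine (h1.comp tendsto_natCast_atTop_atTop).congr fun n => ?_
  simp only [Function.comp_apply, Real.rpow_natCast]
  rw [Real.rpow_neg (Nat.cast_nonneg n), div_inv_eq_mul, mul_comm]

lemma tendsto_natCast_rpow {a : ℝ} (ha : a < 0) :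
    Filter.Tendsto (fun n : ℕ => (n : ℝ) ^ a) Filter.atTop (nhds 0) := by
  simpa using tendsto_rpow_mul_log_pow ha 0

/-- Large problems are tuned, uniformly in the demand function. -/
theorem exists_tuned {T M K ε R growth curv bend : ℝ} (hT : 0 < T) (hM : 0 < M) (hK : 0 < K)
    (hε : 0 < ε) (hR : 0 ≤ R) (hgrowth : 0 < growth) (hcurv : 0 ≤ curv) (hbend : 0 ≤ bend)
    (hd0 : 0 < d) (hd : d < 1 / 2) :
    ∃ B : ℕ, ∃ η : ℝ, ∀ᶠ n : ℕ in Filter.atTop, periodsU n d + periodsC n d ≤ B ∧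
      ∀ (m : Market) (lam : ℝ → ℝ) (pu pc : ℝ), m.horizon = T → 0 < m.inventory → 0 ≤ m.lo →
        m.lo < m.hi → PriceFacts m lam M K ε R growth curv bend pu pc →
        Tuned m n d lam M K ε R growth curv bend pu pc η := by
  -- Minimality of `lU` serves the lengths: for `1 ≤ k < lU` the exponent of `n` in `tauU` is
  -- negative, and for `k = 0` it is `-d`. All lengths tend to 0, so the periods fit into half of
  -- the season; `lC` plays the same role for Step 3.
  obtain ⟨lU, hlU1, hlU, hlU'⟩ := exists_first_le (r := 3 / 5) (a := 1 - d) (b := 1 - 2 * d)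
    (by norm_num) (by norm_num) (by linarith)
  obtain ⟨lC, hlC1, hlC, hlC'⟩ := exists_first_le (r := 2 / 3) (a := 1 - d) (b := 1 - 2 * d)
    (by norm_num) (by norm_num) (by linarith)
  -- What remains of `ε` after one factor 2 of rounding for each possible period.
  set η := ε / 2 ^ (lU + lC) with hη
  have hη0 : 0 < η := by positivity
  refine ⟨lU + lC, η, ?_⟩
  set A := noiseConst M T with hA
  have hA0 : 0 ≤ A := noiseConst_nonneg M T
  -- Each summand is the lower bound on `√(log n)` that one of the conditions in `Tuned` asks for.
  set S := 10 + 2 / T + 16 * (curv * (K * M) ^ 2 + 2 * (R * A)) / (growth * η ^ 2) + 8 * K ^ 2 +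
    16 * (K * A) / η with hS
  have hlog : Filter.Tendsto (fun n : ℕ => √(Real.log n)) Filter.atTop Filter.atTop :=
    Real.tendsto_sqrt_atTop.comp (Real.tendsto_log_atTop.comp tendsto_natCast_atTop_atTop)
  have hwU : ∀ᶠ n : ℕ in Filter.atTop, widthU n d 1 ≤ ε / (K * M) :=
    (tendsto_natCast_rpow (by nlinarith)).eventually_le_const (by positivity)
  have hwC : ∀ᶠ n : ℕ in Filter.atTop, widthC n d 1 ≤ ε / (K * M) :=
    (tendsto_natCast_rpow (by nlinarith)).eventually_le_const (by positivity)
  have hτU : ∀ᶠ n : ℕ in Filter.atTop, ∀ k ∈ Finset.range lU, tauU n d k ≤ 1 / (2 * lU) := by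
    rw [Filter.eventually_all_finset]
    intro k hk
    refine (tendsto_rpow_mul_log_pow ?_ 5).eventually_le_const (by positivity)
    rcases Nat.eq_zero_or_pos k with rfl | hk0
    · simpa using by linarith
    · linarith [hlU' k hk0 (Finset.mem_range.1 hk)]
  have hτC : ∀ᶠ n : ℕ in Filter.atTop, ∀ k ∈ Finset.range lC, tauC n d k ≤ 1 / (2 * lC) := by
    rw [Filter.eventually_all_finset]
    intro k hk
    refine (tendsto_rpow_mul_log_pow ?_ 3).eventually_le_const (by positivity)
    rcases Nat.eq_zero_or_pos k with rfl | hk0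
    · simpa using by linarith
    · linarith [hlC' k hk0 (Finset.mem_range.1 hk)]
  filter_upwards [hlog.eventually_ge_atTop S, hwU, hwC, hτU, hτC, Filter.eventually_ge_atTop 2]
    with n hSn hwU hwC hτU hτC hn
  have h1 : 0 ≤ 2 / T := by positivity
  have h2 : 0 ≤ 16 * (curv * (K * M) ^ 2 + 2 * (R * A)) / (growth * η ^ 2) := by positivity
  have h3 : 0 ≤ 8 * K ^ 2 := by positivity
  have h4 : 0 ≤ 16 * (K * A) / η := by positivity
  have hs10 : 10 ≤ √(Real.log n) := by linarith
  have hL0 := log_natCast_pos hn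
  have hsq : √(Real.log n) * √(Real.log n) = Real.log n := Real.mul_self_sqrt hL0.le
  have hL100 : 100 ≤ Real.log n := by nlinarith
  obtain ⟨hpU, hlastU⟩ := periodsU_spec hn (by linarith) hlU1 hlU
  obtain ⟨hpC, hlastC⟩ := periodsC_spec hn (by linarith) hlC1 hlC
  refine ⟨by omega, ?_⟩
  rintro m lam pu pc rfl hx hlo hlh hF
  have hηle : ∀ k ≤ lU + lC, η * 2 ^ k ≤ ε := by
    intro k hk
    rw [hη, div_mul_eq_mul_div, div_le_iff₀ (by positivity)]
    gcongr
    norm_num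
  have hKM : 0 < K * M := by positivity
  exact
    { toPriceFacts := hF
      lo_nonneg := hlo
      lo_lt := hlh
      inventory_pos := hx
      horizon_pos := hT
      M_pos := hM
      K_pos := hK
      ε_pos := hε
      growth_pos := hgrowth
      curv_nonneg := hcurv
      bend_nonneg := hbend
      η_pos := hη0
      two_le := hn
      d_le := hd.le
      log_ge := hL100
      horizon_log := by
        have : 2 / m.horizon ≤ √(Real.log n) := by linarith
        nlinarith
      estimateU := by
        have h5 : 16 * (curv * (K * M) ^ 2 + 2 * (R * A)) / (growth * η ^ 2) ≤ √(Real.log n) := by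
          linarith
        rw [div_le_iff₀ (by positivity)] at h5
        have h6 : 0 ≤ curv * (K * M) ^ 2 := by positivity
        calc 16 * (curv * (K * M) ^ 2 + 2 * (R * A) * √(Real.log n))
            ≤ 16 * (curv * (K * M) ^ 2 + 2 * (R * A)) * √(Real.log n) := by nlinarith
          _ ≤ √(Real.log n) * (growth * η ^ 2) * √(Real.log n) := by gcongr
          _ = growth * (√(Real.log n) * √(Real.log n)) * η ^ 2 := by ring
          _ = _ := by rw [hsq]
      sqrt_log_ge := by linarith
      estimateC := by
        have h5 : 16 * (K * A) / η ≤ √(Real.log n) := by linarith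
        rwa [div_le_iff₀ hη0] at h5
      widthU_le := by rwa [le_div_iff₀ hKM, mul_comm] at hwU
      widthC_le := by rwa [le_div_iff₀ hKM, mul_comm] at hwC
      startU_le := by
        refine (startU_mono (d := d) hn hT hpU).trans ?_
        calc startU m n d lU ≤ ∑ i ∈ Finset.range lU, m.horizon * (1 / (2 * lU)) :=
              Finset.sum_le_sum fun i hi => mul_le_mul_of_nonneg_left (hτU i hi) hT.le
          _ = m.horizon / 2 := by
              rw [Finset.sum_const, Finset.card_range, nsmul_eq_mul]
              field_simp
      startC_le := by
        refine (startC_mono (d := d) hn hT hpC).trans ?_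
        calc startC m n d lC ≤ ∑ i ∈ Finset.range lC, m.horizon * (1 / (2 * lC)) :=
              Finset.sum_le_sum fun i hi => mul_le_mul_of_nonneg_left (hτC i hi) hT.le
          _ = m.horizon / 2 := by
              rw [Finset.sum_const, Finset.card_range, nsmul_eq_mul]
              field_simp
      lastU := hlastU.le
      lastC := hlastC.le
      η_leU := hηle _ (by omega)
      η_leC := hηle _ (by omega) }

/-- The order of the regret for the exponent `d` is better than for a smaller exponent `δ`. -/
lemma order_le {δ : ℝ} (hδ : δ < d) : ∀ᶠ n : ℕ in Filter.atTop,
    Tuned.order n d ≤ Real.log n ^ (7 / 2 : ℝ) / (n : ℝ) ^ δ := by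
  filter_upwards [(tendsto_rpow_mul_log_pow (show δ - d < 0 by linarith) 2).eventually_le_const
    one_pos, Filter.eventually_ge_atTop 2, (Real.tendsto_log_atTop.comp
      tendsto_natCast_atTop_atTop).eventually_ge_atTop 1] with n h1 hn hL
  have hn0 := natCast_pos_of_two_le hn
  rw [Function.comp_apply] at hL
  rw [Tuned.order, rpow_seven_halves (by linarith), le_div_iff₀ (Real.rpow_pos_of_pos hn0 _)]
  have h2 : 1 ≤ √(Real.log n) := Real.one_le_sqrt.2 hL
  have h3 : 0 < Real.log n ^ 3 := by positivity
  calc (n : ℝ) ^ (-d) * Real.log n ^ 5 * (n : ℝ) ^ δ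
      = ((n : ℝ) ^ (-d) * (n : ℝ) ^ δ) * Real.log n ^ 2 * Real.log n ^ 3 := by ring
    _ = (n : ℝ) ^ (δ - d) * Real.log n ^ 2 * Real.log n ^ 3 := by
        rw [← Real.rpow_add hn0]; ring_nf
    _ ≤ 1 * Real.log n ^ 3 := by gcongr
    _ ≤ Real.log n ^ 3 * √(Real.log n) := by nlinarith

end Asymptotics

/-- For a single demand function: the regret is of the order `(log n) ^ 3.5 / n ^ δ`, with a
constant that depends only on the constants of the assumptions. -/
theorem exists_regret_bound {δ d : ℝ} (hδ : δ < d) (hd0 : 0 < d) (hd : d < 1 / 2)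
    {M K mL mU ε x T : ℝ} (hM : 0 < M) (hK : 0 < K) (hmL : 0 < mL) (hmU : 0 < mU) (hε : 0 < ε)
    (hx : 0 < x) (hT : 0 < T) :
    ∃ C : ℝ, 0 < C ∧ ∀ m : Market, 0 ≤ m.lo → m.lo < m.hi → m.inventory = x → m.horizon = T →
      ∀ lam : ℝ → ℝ, AssumptionA m M K mL mU lam → AssumptionB m ε lam → ∀ n : ℕ, 2 ≤ n →
      ∀ (Ω : Type*) [MeasurableSpace Ω] (P : Measure Ω) (N : ℝ≥0 → Ω → ℕ),
        IsUnitPoissonProcess N P →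
        regretOfSize n m (dpa (m.scale n) n d) lam N P ≤
          C * Real.log n ^ (7 / 2 : ℝ) / (n : ℝ) ^ δ := by
  set R := K * (K + M) with hR
  set growth := mU / (4 * K ^ 2)
  set curv := mL * K ^ 2
  set bend := 2 * K ^ 3 / ε
  have hR0 : 0 ≤ R := by positivity
  have hcurv : 0 ≤ curv := by positivity
  have hbend : 0 ≤ bend := by positivity
  obtain ⟨B, η, hB⟩ := exists_tuned (T := T) (d := d) (growth := growth) hT hM hK hε hR0
    (by positivity) hcurv hbend hd0 hd
  obtain ⟨n₀, hn₀⟩ := Filter.eventually_atTop.1 (hB.and (order_le hδ))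
  have hper : 0 ≤ Tuned.periodConst T M K R curv bend := by
    have := noiseConst_nonneg M T
    unfold Tuned.periodConst lossConst
    positivity
  have hfin : 0 ≤ Tuned.finalConst T M K R curv bend := by
    unfold Tuned.finalConst lossConst
    positivity
  set e := B * Tuned.periodConst T M K R curv bend + Tuned.finalConst T M K R curv bend with he
  have he0 : 0 ≤ e := by positivity
  set C₁ := (e + R * (e + 5 * √(M * T) + 13)) / (T * (ε ^ 2 / K)) + 2 * (M * T + 2) ^ 2
  have hC₁ : 0 < C₁ := by positivity
  have hterm : ∀ n : ℕ, 0 ≤ (n : ℝ) ^ δ / Real.log n ^ (7 / 2 : ℝ) := fun n =>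
    div_nonneg (Real.rpow_nonneg (Nat.cast_nonneg n) _)
      (Real.rpow_nonneg (Real.log_natCast_nonneg n) _)
  -- For sizes below `n₀` the regret is at most 1, and a single term of this sum already suffices.
  -- The terms at 0 and 1, where the logarithm vanishes, are 0 by default and play no role.
  set C₂ := ∑ n ∈ Finset.range n₀, (n : ℝ) ^ δ / Real.log n ^ (7 / 2 : ℝ)
  have hC₂ : 0 ≤ C₂ := Finset.sum_nonneg fun n _ => hterm n
  refine ⟨C₁ + C₂, by positivity, ?_⟩
  intro m hlo hlh hmx hmT lam hA hBB n hn Ω _ P N hN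
  obtain ⟨pu, pc, hF⟩ := exists_priceFacts hK hmL hmU hε hlo hlh hA hBB
  have hcut := hA.regular.cutoff
  have hnpos : 0 < (n : ℝ) ^ δ := Real.rpow_pos_of_pos (natCast_pos_of_two_le hn) _
  have hLpos : 0 < Real.log n ^ (7 / 2 : ℝ) := Real.rpow_pos_of_pos (log_natCast_pos hn) _
  rcases lt_or_ge n n₀ with hlt | hge
  · refine (regretOfSize_dpa_le_one hN hF hK hlo hlh.le (hmT ▸ hT) (hmx ▸ hx.le) hcut hn).trans ?_
    have h1 : (n : ℝ) ^ δ / Real.log n ^ (7 / 2 : ℝ) ≤ C₂ :=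
      Finset.single_le_sum (f := fun n : ℕ => (n : ℝ) ^ δ / Real.log n ^ (7 / 2 : ℝ))
        (fun i _ => hterm i) (Finset.mem_range.2 hlt)
    rw [div_le_iff₀ hLpos] at h1
    rw [le_div_iff₀ hnpos, one_mul]
    refine h1.trans ?_
    gcongr
    linarith
  · obtain ⟨⟨h1, h2⟩, h3⟩ := hn₀ n hge
    have ht := h2 m lam pu pc hmT (hmx ▸ hx) hlo hlh hF
    have h4 := ht.regretOfSize_le hN hcut (e := e) he0 (by
      rw [hmT, he]
      gcongr
      exact_mod_cast h1)
    rw [hmT] at h4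
    calc _ ≤ C₁ * Tuned.order n d := h4
      _ ≤ (C₁ + C₂) * (Real.log n ^ (7 / 2 : ℝ) / (n : ℝ) ^ δ) := by
        gcongr
        · exact ht.order_nonneg
        · linarith
      _ = _ := by ring

end DynamicPricing

/-- The constant is found for a single demand function before the family is introduced, so it is
uniform over families. The supremum is taken in `EReal`, where `iSup_le` needs no boundedness or
nonemptiness. -/
theorem corollary1 (δ : ℝ) (hδ : δ < 1 / 2) :
    ∃ d : ℝ, δ ≤ d ∧ d < 1 / 2 ∧
      ∀ M K mL mU ε x T : ℝ, 0 < M → 0 < K → 0 < mL → 0 < mU → 0 < ε → 0 < x → 0 < T →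
        ∃ C : ℝ, 0 < C ∧
          ∀ m : DynamicPricing.Market, 0 ≤ m.lo → m.lo < m.hi → m.inventory = x → m.horizon = T →
          ∀ (Z : Type*) (lam : Z → ℝ → ℝ),
            (∀ z, DynamicPricing.AssumptionA m M K mL mU (lam z)) →
            (∀ z, DynamicPricing.AssumptionB m ε (lam z)) →
          ∀ n : ℕ, 2 ≤ n →
          ∀ (Ω : Type*) [MeasurableSpace Ω] (P : MeasureTheory.Measure Ω)
            (N : NNReal → Ω → ℕ), DynamicPricing.IsUnitPoissonProcess N P →
            (∀ z, DynamicPricing.IsAdmissible (m.scale n) (DynamicPricing.dpa (m.scale n) n d)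
              (DynamicPricing.scaleDemand n (lam z)) N P) ∧
            (⨆ z, (DynamicPricing.regretOfSize n m (DynamicPricing.dpa (m.scale n) n d)
                (lam z) N P : EReal)) ≤
              ((C * Real.log n ^ (7 / 2 : ℝ) / (n : ℝ) ^ δ : ℝ) : EReal) := by
  have hlt : δ < max δ (1 / 3) / 2 + 1 / 4 := by
    rcases max_cases δ (1 / 3 : ℝ) with h | h <;> linarith [h.1, h.2]
  -- The midpoint of `max δ (1/3)` and `1/2`: strictly above `δ`, strictly below `1/2`, and positive
  -- even for negative `δ`.
  refine ⟨max δ (1 / 3) / 2 + 1 / 4, hlt.le, ?_, ?_⟩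
  · linarith [max_lt hδ (show (1 / 3 : ℝ) < 1 / 2 by norm_num)]
  intro M K mL mU ε x T hM hK hmL hmU hε hx hT
  obtain ⟨C, hC, h⟩ := DynamicPricing.exists_regret_bound hlt
    (by linarith [le_max_right δ (1 / 3)])
    (by linarith [max_lt hδ (show (1 / 3 : ℝ) < 1 / 2 by norm_num)]) hM hK hmL hmU hε hx hT
  refine ⟨C, hC, ?_⟩
  intro m hlo hlh hmx hmT Z lam hA hB n hn Ω _ P N hN
  refine ⟨fun z => ?_, iSup_le fun z => EReal.coe_le_coe
    (h m hlo hlh hmx hmT (lam z) (hA z) (hB z) n hn Ω P N hN)⟩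
  obtain ⟨pu, pc, hF⟩ := DynamicPricing.exists_priceFacts hK hmL hmU hε hlo hlh (hA z) (hB z)
  exact (DynamicPricing.dpa_isAdmissible hN hF hlo hlh.le (hmT ▸ hT) (hmx ▸ hx.le)
    (hA z).regular.cutoff hn).1
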